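/- Consider the following infinite-server systems, empty at time $0$, with parameter $\nu\ge 0$. Batches of type $i$ ($i=1,\dots,k$) arrive in independent Poisson streams of rates $\lambda_i>0$; the sizes of the type-$i$ batches are i.i.d. with values in $\{1,2,\dots\}$ and generating function $Q_i(z)$; the service times of type-$i$ customers are i.i.d., nonnegative, with distribution function $B_i$ and finite mean; every customer starts service on arrival. Catastrophes arrive in a Poisson stream of rate $\nu$ (none if $\nu=0$), and a catastrophe removes all the customers present. The arrival streams, the catastrophe stream, the batch sizes and the service times are mutually independent. $M|G|\infty$ is the case $k=1$ with batches of size $1$; $BM|G|\infty$ is the case $k=1$ with general batch size, of generating function $Q$; $M_k|G_k|\infty$ is the case of $k\ge1$ types with batches of size $1$. For $k=1$ the index is dropped. Let $P_0(t)$ be the probability that the system is empty at time $t$. The busy period $\pi\in[0,\infty]$ is the time from the first arrival to the empty system until the system is next free of customers, and the busy cycle $\omega$ is the sum of the idle period (until the first arrival) and the busy period. Put $\hat\pi(s)=\mathbb E[e^{-s\pi};\pi<\infty]$ and $\hat\omega(s)=\mathbb E[e^{-s\omega};\omega<\infty]$. For $a:[0,\infty)\to[0,\infty)$ put $$\Phi_a(t)=e^{-\int_0^t[a(x)+\nu]\,dx}+\nu\int_0^t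 e^{-\int_0^u[a(x)+\nu]\,dx}\,du .$$ A tilde denotes the Laplace transform, $\tilde f(s)=\int_0^\infty e^{-st}f(t)\,dt$. Then $\pi$ and $\omega$ are random variables and the following hold for all $t\ge0$ and all complex $s$ with $\operatorname{Re}s>0$; in particular, $\tilde P_0(s)\neq0$. 1. ($M|G|\infty$ with catastrophes.) $\pi<\infty$ almost surely, $P_0(t)=\Phi_a(t)$ with $a(x)=\lambda(1-B(x))$, and $$\hat\pi(s)=1+\frac s\lambda\Bigl(1-\frac1{s\tilde P_0(s)}\Bigr),\qquad \hat\omega(s)=1-\frac{1}{(\lambda+s)\tilde P_0(s)} .$$ Moreover, if $p_0(t)$ is the probability that the same system without catastrophes is empty at time $t$, then $p_0(t)=e^{-\int_0^t\lambda(1-B(x))\,dx}$ and $s\tilde P_0(s)=(\nu+s)\,\tilde p_0(\nu+s)$. 2. ($BM|G|\infty$ with catastrophes.) $P_0(t)=\Phi_a(t)$ with $a(x)=\lambda(1-Q(B(x)))$, and $$\hat\pi(s)=1+\lambda^{-1}\Bigl[s-\frac1{\int_0^\infty e^{-st}\Phi_a(t)\,dt}\Bigr],\qquad \hat\omega(s)=1-\frac{1}{(\lambda+s)\int_0^\infty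 e^{-st}\Phi_a(t)\,dt} .$$ If $\nu>0$ or the mean batch size is finite, then $\pi<\infty$ almost surely. 3. ($M_k|G_k|\infty$ with catastrophes.) $\pi<\infty$ almost surely, $P_0(t)=\Phi_a(t)$ with $a(x)=\sum_{i=1}^k\lambda_i(1-B_i(x))$, and the two formulas of part 2 hold for this $a$, with $\lambda=\sum_{i=1}^k\lambda_i$. -/

import Mathlib

open MeasureTheory ProbabilityTheory Set
open scoped ENNReal NNReal

noncomputable section

namespace InfServer

/-- The random inputs of an infinite-server system with customer types `ι`: each type has its own
stream of batches, and there is one stream of catastrophes. -/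
structure Inputs (ι Ω : Type*) where
  /-- `gap i n`: time between the `(n-1)`-st and the `n`-th batch of type `i`
  (`gap i 0` is counted from time `0`). -/
  gap : ι → ℕ → Ω → ℝ
  /-- `size i n`: number of customers in the `n`-th batch of type `i`. -/
  size : ι → ℕ → Ω → ℕ
  /-- `service i n j`: service time of the `j`-th customer in the `n`-th batch of type `i`. -/
  service : ι → ℕ → ℕ → Ω → ℝ
  /-- `clock m`: the `m`-th gap of the unit-rate Poisson clock that drives the catastrophes. -/
  clock : ℕ → Ω → ℝ

/-- Labels of the individual input variables. -/
inductive Label (ι : Type*) where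
  | gap (i : ι) (n : ℕ)
  | size (i : ι) (n : ℕ)
  | service (i : ι) (n j : ℕ)
  | clock (m : ℕ)

variable {ι Ω : Type*}

/-- All the input variables as one real-valued family (used to state joint independence). -/
def Inputs.family (X : Inputs ι Ω) : Label ι → Ω → ℝ
  | .gap i n => X.gap i n
  | .size i n => fun ω => (X.size i n ω : ℝ)
  | .service i n j => X.service i n j
  | .clock m => X.clock m

/-- The model `BM_k|G_k|∞`: all inputs are independent, batches of type `i` arrive in a Poisson
stream of rate `lam i`, have sizes of law `q i`, and their customers have service times of
law `B i`. The case of batches of size one is `M_k|G_k|∞`. -/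
structure IsModel [MeasurableSpace Ω] (X : Inputs ι Ω) (P : Measure Ω)
    (lam : ι → ℝ) (q : ι → PMF ℕ) (B : ι → Measure ℝ) : Prop where
  gap_law : ∀ i n, HasLaw (X.gap i n) (expMeasure (lam i)) P
  size_law : ∀ i n, HasLaw (X.size i n) (q i).toMeasure P
  service_law : ∀ i n j, HasLaw (X.service i n j) (B i) P
  clock_law : ∀ m, HasLaw (X.clock m) (expMeasure 1) P
  indep : iIndepFun X.family P

namespace Inputs

/-- Arrival epoch of the `n`-th batch of type `i`. -/
def arrival (X : Inputs ι Ω) (i : ι) (n : ℕ) (ω : Ω) : ℝ :=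
  ∑ l ∈ Finset.range (n + 1), X.gap i l ω

/-- The epochs of the Poisson stream of catastrophes of rate `ν`: the unit-rate Poisson stream run
at speed `ν`. For `ν > 0` its successive gaps are the variables `clock m / ν`, which are
exponential with parameter `ν`; for `ν = 0` there are (almost surely) no catastrophes. -/
def catastrophes (X : Inputs ι Ω) (ν : ℝ) (ω : Ω) : Set ℝ :=
  {c | ∃ m : ℕ, ν * c = ∑ l ∈ Finset.range (m + 1), X.clock l ω}

/-- `X.number K i t ω`: the number of type `i` customers in the system at time `t` when the set of
catastrophe epochs is `K`. A customer (the `j`-th one of the `n`-th batch) is present if it has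
arrived, its service is not completed, and no catastrophe has occurred since its arrival. -/
def number (X : Inputs ι Ω) (K : Ω → Set ℝ) (i : ι) (t : ℝ) (ω : Ω) : ℕ∞ :=
  Set.encard {p : ℕ × ℕ | p.2 < X.size i p.1 ω ∧ X.arrival i p.1 ω ≤ t ∧
    t < X.arrival i p.1 ω + X.service i p.1 p.2 ω ∧
    ∀ c ∈ K ω, ¬ (X.arrival i p.1 ω < c ∧ c ≤ t)}

/-- The system is empty at time `t`. -/
def IsIdle (X : Inputs ι Ω) (K : Ω → Set ℝ) (t : ℝ) (ω : Ω) : Prop :=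
  ∀ i, X.number K i t ω = 0

/-- The probability that the system is empty at time `t`. -/
def idleProb [MeasurableSpace Ω] (X : Inputs ι Ω) (P : Measure Ω) (K : Ω → Set ℝ) (t : ℝ) : ℝ :=
  P.real {ω | X.IsIdle K t ω}

/-- The length of the first idle period: the system is empty at time `0`, so this is the epoch of
the first arrival of any type. -/
def idlePeriod (X : Inputs ι Ω) (ω : Ω) : ℝ := ⨅ i, X.arrival i 0 ω

/-- The length of the busy period that starts with the first arrival to the empty system: the time
until the system is next free of customers (`⊤` if that never happens). -/
def busyPeriod (X : Inputs ι Ω) (K : Ω → Set ℝ) (ω : Ω) : ℝ≥0∞ :=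
  ⨅ (u : ℝ≥0) (_ : X.IsIdle K (X.idlePeriod ω + u) ω), (u : ℝ≥0∞)

/-- The length of the busy cycle: idle period plus busy period. -/
def busyCycle (X : Inputs ι Ω) (K : Ω → Set ℝ) (ω : Ω) : ℝ≥0∞ :=
  ENNReal.ofReal (X.idlePeriod ω) + X.busyPeriod K ω

end Inputs

/-- Laplace transform `∫_0^∞ e^{-st} f(t) dt`. -/
def laplace (f : ℝ → ℝ) (s : ℂ) : ℂ :=
  ∫ t in Ioi (0 : ℝ), Complex.exp (-s * t) * (f t : ℂ)

open Classical in
/-- Laplace–Stieltjes transform `∫_{[0,∞)} e^{-st} dP(Y ≤ t)` of the distribution of a random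
variable `Y` with values in `[0, ∞]`. -/
def lst [MeasurableSpace Ω] (P : Measure Ω) (Y : Ω → ℝ≥0∞) (s : ℂ) : ℂ :=
  ∫ ω, (if Y ω = ⊤ then 0 else Complex.exp (-s * ((Y ω).toReal : ℂ))) ∂P

/-- Probability generating function of a law on `ℕ`. -/
def pgf (q : PMF ℕ) (z : ℝ) : ℝ := ∑' r : ℕ, (q r).toReal * z ^ r

/-- `exp(-∫_0^t [a(x)+ν] dx) + ν ∫_0^t exp(-∫_0^u [a(x)+ν] dx) du`. -/
def idleFormula (a : ℝ → ℝ) (ν t : ℝ) : ℝ :=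
  Real.exp (-∫ x in (0 : ℝ)..t, (a x + ν)) +
    ν * ∫ u in (0 : ℝ)..t, Real.exp (-∫ x in (0 : ℝ)..u, (a x + ν))

end InfServer

end

/-! A batch arriving at epoch `x` keeps the system nonempty at time `t` exactly when one of its
customers has service time above `t - x` and no catastrophe falls in `(x, t]`. Given the
catastrophes, the system is therefore empty when independent marked Poisson streams avoid a bad set,
and the void probability (`Stream.law_real_avoids`) is `exp(-∫_0^t 1_V(x) a(t-x) dx)`, where `V`
consists of the `x` with no catastrophe in `(x, t]`. Since `V` is closed upwards, one minus this
equals `∫_0^t 1_V(x) a(t-x) exp(-∫_x^t a(t-y) dy) dx`, which is linear in `1_V`. Averaging over the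
catastrophes then needs only the probability `e^{-ν(t-x)}` that `x` lies in `V`, and the result is
`Φ_a(t)` (`World.law_real_idle`).

For the transforms, let `Λ` be the total arrival rate. The system starts afresh at the end of the
busy cycle, so `P_0(t) = e^{-Λt} + E[P_0(t-ω); ω ≤ t]` (`World.law_real_idle_renewal`). Laplace
transforms turn this into `P̃_0 = 1/(Λ+s) + ω̂ P̃_0`, which shows `P̃_0 ≠ 0` and determines `ω̂`.
The busy period is independent of the idle period, which is exponential of rate `Λ`, so `ω̂ =
Λ/(Λ+s) π̂` (`World.lst_cycle`), and `π̂` follows. This works for defective laws too; finiteness of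
`π` is not presupposed.

Regeneration is used only at deterministic times, where it is the Markov property of Poisson streams
(`Stream.law_map_past_shift`), a consequence of the memorylessness of the exponential law. The end
of the busy cycle is approximated from above by the first point of a grid of mesh `h`, after the
first arrival, at which the system is empty. The limit `h → 0` is legitimate because an empty system
stays empty for a while and `P_0` is continuous.

If `P_0 ≥ c > 0`, then `P̃_0(x) ≥ c/x` for real `x > 0`, so `π̂(x) → 1` as `x → 0` and `π` is almost
surely finite (`World.ae_busy_lt_top`). Such a `c` is `ν/(Λ+ν)` when `ν > 0`. When `ν = 0` it comes
from a bound on `∫_0^t a` by arrival rate times mean batch size times mean service time, summed over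
the types.

All this is done on the canonical space `World`, where catastrophes are the ticks of a unit-rate
clock read at speed `ν`, so that `ν = 0` needs no separate treatment; `IsModel.hasLaw_world`
transfers the results to an arbitrary model. -/

noncomputable section

namespace InfServer

/-! ### Independent blocks of an infinite product measure -/

section ProductMeasure

open Measure

variable {α β γ E : Type*} [MeasurableSpace E]

lemma measurable_sumElim :
    Measurable (fun p : (α → E) × (β → E) => (Sum.elim p.1 p.2 : α ⊕ β → E)) := by
  refine measurable_pi_lambda _ fun c => ?_
  rcases c with a | b <;> simp only [Sum.elim_inl, Sum.elim_inr] <;> fun_prop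

/-- An infinite product measure is determined by finite boxes, and the preimage of a box is a
product of two boxes, one for the left indices and one for the right ones. -/
lemma map_sumElim_prod_infinitePi (μ : α ⊕ β → Measure E) [∀ c, IsProbabilityMeasure (μ c)] :
    ((infinitePi fun a => μ (.inl a)).prod (infinitePi fun b => μ (.inr b))).map
      (fun p => (Sum.elim p.1 p.2 : α ⊕ β → E)) = infinitePi μ := by
  classical
  refine eq_infinitePi μ fun s t ht => ?_
  rw [map_apply measurable_sumElim (.pi s.countable_toSet fun _ _ => ht _)]
  have : (fun p : (α → E) × (β → E) => (Sum.elim p.1 p.2 : α ⊕ β → E)) ⁻¹' ((s : Set _).pi t) =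
      ((s.toLeft : Set α).pi fun a => t (.inl a)) ×ˢ
        ((s.toRight : Set β).pi fun b => t (.inr b)) := by
    ext p
    simp [Set.mem_pi]
  rw [this, prod_prod, infinitePi_pi _ (fun _ _ => ht _), infinitePi_pi _ (fun _ _ => ht _),
    ← Finset.prod_disjSum s.toLeft s.toRight fun c => μ c (t c), Finset.toLeft_disjSum_toRight]

/-- Disjoint blocks of coordinates of a product measure are independent. -/
lemma infinitePi_map_prodMk (μ : γ → Measure E) [∀ c, IsProbabilityMeasure (μ c)]
    {f : α → γ} {g : β → γ} (hfg : Function.Injective (Sum.elim f g)) :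
    (infinitePi μ).map (fun x => (fun a => x (f a), fun b => x (g b))) =
      (infinitePi fun a => μ (f a)).prod (infinitePi fun b => μ (g b)) := by
  -- Injectivity of `Sum.elim f g` says that the two blocks are disjoint and without repetition; the
  -- selected coordinates form a product over `α ⊕ β`, which then splits.
  have h1 := map_infinitePi_infinitePi_of_inj (P := μ) hfg
  have h2 := map_sumElim_prod_infinitePi (fun c : α ⊕ β => μ (Sum.elim f g c))
  simp only [Sum.elim_inl, Sum.elim_inr] at h2
  have h3 : Measurable (fun y : α ⊕ β → E => (fun a => y (.inl a), fun b => y (.inr b))) := by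
    fun_prop
  have h4 := congrArg (map (fun y : α ⊕ β → E => (fun a => y (.inl a), fun b => y (.inr b))))
    (h1.trans h2.symm)
  rw [map_map h3 (by fun_prop), map_map h3 measurable_sumElim] at h4
  simpa [Function.comp_def] using h4

end ProductMeasure

/-! ### The exponential law and its memorylessness -/

section Exponential

variable {r : ℝ}

lemma lintegral_expMeasure {f : ℝ → ℝ≥0∞} (hf : Measurable f) :
    ∫⁻ x, f x ∂(expMeasure r) = ∫⁻ x in Ioi 0, ENNReal.ofReal (r * Real.exp (-(r * x))) * f x := by
  rw [expMeasure, gammaMeasure, lintegral_withDensity_eq_lintegral_mul _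
    (show Measurable (gammaPDF 1 r) from (measurable_gammaPDFReal 1 r).ennreal_ofReal) hf]
  change ∫⁻ x, exponentialPDF r x * f x = _
  rw [setLIntegral_congr Ioi_ae_eq_Ici, ← lintegral_indicator measurableSet_Ici]
  refine lintegral_congr fun x => ?_
  by_cases hx : 0 ≤ x
  · rw [indicator_of_mem (by exact hx), exponentialPDF_of_nonneg hx]
  · rw [indicator_of_notMem (by exact hx), exponentialPDF_of_neg (not_le.1 hx), zero_mul]

lemma expMeasure_Ioi (hr : 0 < r) {x : ℝ} (hx : 0 ≤ x) :
    expMeasure r (Ioi x) = ENNReal.ofReal (Real.exp (-(r * x))) := by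
  have := isProbabilityMeasure_expMeasure hr
  have h := cdf_expMeasure_eq hr x
  rw [cdf_eq_real, if_pos hx] at h
  rw [← compl_Iic, ← ENNReal.ofReal_toReal (measure_ne_top (expMeasure r) (Iic x)ᶜ)]
  congr 1
  change (expMeasure r).real _ = _
  rw [probReal_compl_eq_one_sub measurableSet_Iic, h]
  ring

lemma expMeasure_ae_pos (hr : 0 < r) : ∀ᵐ x ∂(expMeasure r), 0 < x := by
  have := isProbabilityMeasure_expMeasure hr
  have h : expMeasure r (Ioi 0) = 1 := by simpa using expMeasure_Ioi hr le_rfl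
  exact (prob_compl_eq_zero_iff measurableSet_Ioi).2 h

/-- The exponential law is memoryless. -/
lemma lintegral_expMeasure_memoryless {f : ℝ → ℝ≥0∞} (hf : Measurable f) {y : ℝ}
    (hy : 0 ≤ y) :
    ∫⁻ x in Ioi y, f (x - y) ∂(expMeasure r) =
      ENNReal.ofReal (Real.exp (-(r * y))) * ∫⁻ x, f x ∂(expMeasure r) := by
  have hm : Measurable fun x => (Ioi y).indicator (fun x => f (x - y)) x :=
    (hf.comp (measurable_sub_const y)).indicator measurableSet_Ioi
  rw [← lintegral_indicator measurableSet_Ioi, lintegral_expMeasure hm,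
    lintegral_expMeasure hf, ← lintegral_const_mul _ (by fun_prop),
    ← lintegral_indicator measurableSet_Ioi, ← lintegral_indicator measurableSet_Ioi,
    ← lintegral_sub_right_eq_self ((Ioi (0 : ℝ)).indicator fun x =>
      ENNReal.ofReal (Real.exp (-(r * y))) * (ENNReal.ofReal (r * Real.exp (-(r * x))) * f x)) y]
  refine lintegral_congr fun x => ?_
  by_cases hx : 0 < x - y
  · have h1 : x ∈ Ioi (0 : ℝ) := by simp only [mem_Ioi]; linarith
    have h2 : x ∈ Ioi y := by simp only [mem_Ioi]; linarith
    rw [indicator_of_mem h1, indicator_of_mem h2, indicator_of_mem (by exact hx), ← mul_assoc,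
      ← ENNReal.ofReal_mul (Real.exp_pos _).le]
    congr 2
    rw [mul_left_comm, ← Real.exp_add]
    ring_nf
  · have h2 : x ∉ Ioi y := by simp only [mem_Ioi]; linarith
    have h3 : x - y ∉ Ioi (0 : ℝ) := hx
    simp [indicator_of_notMem h2, indicator_of_notMem h3]

end Exponential

/-! ### Marked point streams: epochs, past and shift, pathwise -/

/-- A marked point stream, given by the successive gaps and the marks of its points. -/
abbrev Stream (M : Type*) := ℕ → ℝ × M

namespace Stream

variable {M : Type*}

/-- Sum of the first `n` gaps. -/
def gapSum (x : Stream M) (n : ℕ) : ℝ := ∑ l ∈ Finset.range n, (x l).1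

/-- Epoch of the `n`-th point. -/
def epoch (x : Stream M) (n : ℕ) : ℝ := x.gapSum (n + 1)

/-- Number of points up to time `t` (for proper streams). -/
def count (t : ℝ) (x : Stream M) : ℕ := sInf {n | t < x.epoch n}

/-- The stream with everything after time `t` erased. -/
def past [Inhabited M] (t : ℝ) (x : Stream M) : Stream M :=
  -- For `t ≥ 0` the filler gap `t + 1` puts every erased epoch beyond `t`, so the erased stream has
  -- no spurious points up to `t`.
  fun j => if j < x.count t then x j else (t + 1, default)

/-- Reduce the first gap by `y`. -/
def advance (y : ℝ) (z : Stream M) : Stream M :=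
  fun j => if j = 0 then ((z 0).1 - y, (z 0).2) else z j

/-- The stream seen from time `t` on. -/
def shift (t : ℝ) (x : Stream M) : Stream M :=
  advance (t - x.gapSum (x.count t)) fun j => x (x.count t + j)

/-- All gaps are positive and the points do not accumulate. -/
def IsProper (x : Stream M) : Prop := (∀ n, 0 < (x n).1) ∧ ∀ t, ∃ n, t < x.epoch n

lemma gapSum_succ (x : Stream M) (n : ℕ) : x.gapSum (n + 1) = x.gapSum n + (x n).1 :=
  Finset.sum_range_succ _ _

@[simp] lemma gapSum_zero (x : Stream M) : x.gapSum 0 = 0 := rfl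

lemma gapSum_congr {x y : Stream M} {n : ℕ} (h : ∀ j < n, x j = y j) :
    x.gapSum n = y.gapSum n :=
  Finset.sum_congr rfl fun j hj => by rw [h j (Finset.mem_range.1 hj)]

lemma gapSum_add (x : Stream M) (n k : ℕ) :
    x.gapSum (n + k) = x.gapSum n + gapSum (fun j => x (n + j)) k :=
  Finset.sum_range_add _ _ _

lemma gapSum_advance (y : ℝ) (z : Stream M) (n : ℕ) :
    (advance y z).gapSum (n + 1) = z.gapSum (n + 1) - y := by
  induction n with
  | zero => simp [gapSum, advance]
  | succ n ih => rw [gapSum_succ, ih, gapSum_succ z (n + 1)]; simp [advance]; ring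

lemma epoch_shift (t : ℝ) (x : Stream M) (n : ℕ) :
    (x.shift t).epoch n = x.epoch (x.count t + n) - t := by
  rw [epoch, shift, gapSum_advance, epoch, add_assoc, gapSum_add x (count t x) (n + 1)]
  ring

lemma shift_snd (t : ℝ) (x : Stream M) (n : ℕ) : (x.shift t n).2 = (x (x.count t + n)).2 := by
  rcases n with _ | n <;> simp [shift, advance]

namespace IsProper

variable {x : Stream M}

lemma strictMono_gapSum (hx : x.IsProper) : StrictMono x.gapSum :=
  strictMono_nat_of_lt_succ fun n => by rw [gapSum_succ]; linarith [hx.1 n]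

lemma strictMono_epoch (hx : x.IsProper) : StrictMono x.epoch :=
  fun _ _ h => hx.strictMono_gapSum (Nat.succ_lt_succ h)

lemma epoch_pos (hx : x.IsProper) (n : ℕ) : 0 < x.epoch n := by
  simpa [epoch] using hx.strictMono_gapSum (Nat.succ_pos n)

lemma lt_epoch_iff (hx : x.IsProper) {t : ℝ} {n : ℕ} : t < x.epoch n ↔ x.count t ≤ n :=
  ⟨fun h => Nat.sInf_le h, fun h =>
    lt_of_lt_of_le (Nat.sInf_mem (hx.2 t)) (hx.strictMono_epoch.monotone h)⟩

lemma epoch_le_iff (hx : x.IsProper) {t : ℝ} {n : ℕ} : x.epoch n ≤ t ↔ n < x.count t := by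
  rw [← not_lt, hx.lt_epoch_iff, not_le]

lemma gapSum_count_le (hx : x.IsProper) {t : ℝ} (ht : 0 ≤ t) : x.gapSum (x.count t) ≤ t := by
  rcases h : x.count t with _ | n
  · simpa using ht
  · exact hx.epoch_le_iff.2 (by omega)

lemma shift (hx : x.IsProper) (t : ℝ) : (x.shift t).IsProper := by
  refine ⟨fun n => ?_, fun u => ?_⟩
  · rcases n with _ | n
    · have h1 := hx.lt_epoch_iff (t := t).2 le_rfl
      have h2 := epoch_shift t x 0
      simp only [epoch, gapSum_succ, gapSum_zero, zero_add, add_zero] at h1 h2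
      linarith
    · simpa [Stream.shift, advance] using hx.1 _
  · obtain ⟨n, hn⟩ := hx.2 (u + t)
    refine ⟨n, ?_⟩
    rw [epoch_shift]
    linarith [hx.strictMono_epoch.monotone (Nat.le_add_left n (x.count t))]

lemma epoch_past_of_lt [Inhabited M] {t : ℝ} {n : ℕ} (hn : n < x.count t) :
    (x.past t).epoch n = x.epoch n :=
  gapSum_congr fun j hj => by rw [past, if_pos (by omega)]

lemma lt_epoch_past [Inhabited M] (hx : x.IsProper) {t : ℝ} (ht : 0 ≤ t) {n : ℕ}
    (hn : x.count t ≤ n) : t < (x.past t).epoch n := by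
  induction n, hn using Nat.le_induction with
  | base =>
    rw [epoch, gapSum_succ, gapSum_congr (y := x) fun j hj => by rw [past, if_pos hj]]
    have : 0 ≤ x.gapSum (x.count t) := hx.strictMono_gapSum.monotone (Nat.zero_le _)
    simp only [past, lt_irrefl, if_false]
    linarith
  | succ n hn ih =>
    rw [epoch, gapSum_succ]
    have : (x.past t (n + 1)).1 = t + 1 := by rw [past, if_neg (by omega)]
    rw [this]
    change t < (x.past t).epoch n + (t + 1)
    linarith

end IsProper

/-- The event that exactly `n` points occur up to time `t`. -/
def countEvent (M : Type*) (t : ℝ) (n : ℕ) : Set (Stream M) :=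
  {x | (∀ k ≤ n, x.gapSum k ≤ t) ∧ t < x.gapSum (n + 1)}

/-- `countEvent` bounds all partial sums up to `n`, not only the last one, so this holds even for
streams whose gaps are not positive. The event can thus be handled without almost sure exceptions.
-/
lemma count_eq_of_mem {t : ℝ} {n : ℕ} {x : Stream M} (hx : x ∈ countEvent M t n) :
    x.count t = n := by
  refine le_antisymm (Nat.sInf_le hx.2) (le_csInf ⟨n, hx.2⟩ fun k hk => ?_)
  by_contra! hkn
  exact absurd (hx.1 (k + 1) hkn) (not_le.2 hk)

lemma IsProper.mem_countEvent {x : Stream M} (hx : x.IsProper) {t : ℝ} (ht : 0 ≤ t) :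
    x ∈ countEvent M t (x.count t) :=
  ⟨fun _ hk => (hx.strictMono_gapSum.monotone hk).trans (hx.gapSum_count_le ht),
    hx.lt_epoch_iff.2 le_rfl⟩

section Measurable

variable [MeasurableSpace M]

@[fun_prop]
lemma measurable_gapSum (n : ℕ) : Measurable fun x : Stream M => x.gapSum n := by
  unfold gapSum; fun_prop

@[fun_prop]
lemma measurable_epoch (n : ℕ) : Measurable fun x : Stream M => x.epoch n :=
  measurable_gapSum _

lemma measurable_count (t : ℝ) : Measurable (count t : Stream M → ℕ) := by
  have hm : ∀ n, MeasurableSet {x : Stream M | t < x.epoch n} := fun n =>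
    measurableSet_lt measurable_const (measurable_epoch n)
  refine measurable_of_Iic fun k => ?_
  -- The infimum of the empty set is `0`, so streams whose epochs never exceed `t` belong to every
  -- one of these preimages.
  have : count t ⁻¹' Iic k = (⋃ n ≤ k, {x : Stream M | t < x.epoch n}) ∪
      (⋃ n, {x : Stream M | t < x.epoch n})ᶜ := by
    ext x
    simp only [mem_preimage, mem_Iic, mem_union, mem_iUnion, mem_ofPred_eq, mem_compl_iff,
      exists_prop]
    constructor
    · intro h
      by_cases hne : ∃ n, t < x.epoch n
      · exact .inl ⟨_, h, Nat.sInf_mem hne⟩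
      · exact .inr hne
    · rintro (⟨n, hn, h⟩ | h)
      · exact (Nat.sInf_le h).trans hn
      · have : {n | t < x.epoch n} = ∅ := by ext n; simpa using not_exists.1 h n
        simp [count, this]
  rw [this]
  exact (MeasurableSet.biUnion (to_countable _) fun n _ => hm n).union
    (MeasurableSet.iUnion hm).compl

@[fun_prop]
lemma measurable_past [Inhabited M] (t : ℝ) : Measurable (past t : Stream M → Stream M) := by
  refine measurable_pi_lambda _ fun j => Measurable.ite ?_ (by fun_prop) measurable_const
  exact measurableSet_lt measurable_const (measurable_count t)

lemma measurable_advance :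
    Measurable fun p : ℝ × Stream M => advance p.1 p.2 := by
  refine measurable_pi_lambda _ fun j => ?_
  unfold advance
  split_ifs <;> fun_prop

@[fun_prop]
lemma measurable_shift (t : ℝ) : Measurable (shift t : Stream M → Stream M) := by
  have h : ∀ n, Measurable fun x : Stream M =>
      advance (t - x.gapSum n) fun j => x (n + j) := fun n =>
    measurable_advance.comp (f := fun x : Stream M => (t - x.gapSum n, fun j => x (n + j)))
      (by fun_prop)
  have h2 : Measurable fun p : Stream M × ℕ =>
      advance (t - p.1.gapSum p.2) fun j => p.1 (p.2 + j) :=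
    measurable_from_prod_countable_left h
  exact h2.comp (measurable_id.prodMk (measurable_count t))

end Measurable

end Stream

/-! ### Poisson streams and their Markov property -/

namespace Stream

variable {M : Type*} [MeasurableSpace M]

/-- Law of a Poisson stream of rate `r` with i.i.d. marks of law `m`. -/
def law (r : ℝ) (m : Measure M) : Measure (Stream M) :=
  Measure.infinitePi fun _ : ℕ => (expMeasure r).prod m

variable {r : ℝ} {m : Measure M}

lemma isProbabilityMeasure_law (hr : 0 < r) [IsProbabilityMeasure m] :
    IsProbabilityMeasure (law r m) := by
  have := isProbabilityMeasure_expMeasure hr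
  unfold law; infer_instance

lemma law_map_split (hr : 0 < r) [IsProbabilityMeasure m] (n : ℕ) :
    (law r m).map (fun x => ((fun j : Fin n => x j), fun j => x (n + j))) =
      (Measure.infinitePi fun _ : Fin n => (expMeasure r).prod m).prod (law r m) := by
  have := isProbabilityMeasure_expMeasure hr
  refine infinitePi_map_prodMk (fun _ : ℕ => (expMeasure r).prod m) (f := fun j : Fin n => (j : ℕ))
    (g := fun j => n + j) ?_
  refine Function.Injective.sumElim Fin.val_injective (add_right_injective n) fun a b => ?_
  have := a.2
  omega

lemma law_map_cons (hr : 0 < r) [IsProbabilityMeasure m] :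
    (law r m).map (fun x => (x 0, fun j => x (1 + j))) =
      ((expMeasure r).prod m).prod (law r m) := by
  have := isProbabilityMeasure_expMeasure hr
  have := isProbabilityMeasure_law hr (m := m)
  have h := congrArg (Measure.map (Prod.map (fun u : Fin 1 → ℝ × M => u 0) id))
    (law_map_split hr (m := m) 1)
  rw [Measure.map_map (by fun_prop) (by fun_prop),
    ← Measure.map_prod_map _ _ (by fun_prop) measurable_id,
    Measure.infinitePi_map_eval, Measure.map_id] at h
  exact h

/-- Decomposition of a stream at its first point. -/
lemma lintegral_law_cons (hr : 0 < r) [IsProbabilityMeasure m]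
    {f : (ℝ × M) × Stream M → ℝ≥0∞} (hf : Measurable f) :
    ∫⁻ x, f (x 0, fun j => x (1 + j)) ∂(law r m) =
      ∫⁻ g, ∫⁻ k, ∫⁻ w, f ((g, k), w) ∂(law r m) ∂m ∂(expMeasure r) := by
  have := isProbabilityMeasure_expMeasure hr
  have := isProbabilityMeasure_law hr (m := m)
  rw [← lintegral_map (μ := law r m) hf (by fun_prop), law_map_cons hr,
    lintegral_prod _ hf.aemeasurable, lintegral_prod _ (by fun_prop)]

lemma ae_gap_pos (hr : 0 < r) [IsProbabilityMeasure m] :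
    ∀ᵐ x ∂(law r m), ∀ n, 0 < (x n).1 := by
  have := isProbabilityMeasure_expMeasure hr
  refine ae_all_iff.2 fun n => ?_
  have h := Measure.infinitePi_map_eval (fun _ : ℕ => (expMeasure r).prod m) n
  have h2 : ∀ᵐ y ∂((expMeasure r).prod m), 0 < y.1 :=
    Measure.quasiMeasurePreserving_fst.ae (expMeasure_ae_pos hr)
  rw [← h] at h2
  exact ae_of_ae_map (f := fun x : Stream M => x n) (measurable_pi_apply n).aemeasurable h2

/-- The first `n` gaps are all at most `t` with probability `p ^ n`, where `p < 1`. -/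
lemma ae_exists_lt_gap (hr : 0 < r) [IsProbabilityMeasure m] {t : ℝ} (ht : 0 ≤ t) :
    ∀ᵐ x ∂(law r m), ∃ n, t < (x n).1 := by
  have := isProbabilityMeasure_expMeasure hr
  have hle : expMeasure r (Iic t) < 1 := by
    have h := prob_compl_eq_one_sub (μ := expMeasure r) (measurableSet_Ioi (a := t))
    rw [compl_Ioi, expMeasure_Ioi hr ht] at h
    rw [h]
    exact ENNReal.sub_lt_self (by simp) one_ne_zero (by simp [Real.exp_pos])
  have key : ∀ n : ℕ, law r m {x | ∀ j, (x j).1 ≤ t} ≤ (expMeasure r (Iic t)) ^ n := fun n => by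
    calc law r m {x | ∀ j, (x j).1 ≤ t}
        ≤ law r m ((Finset.range n : Set ℕ).pi fun _ => Iic t ×ˢ univ) :=
          measure_mono fun x hx j _ => ⟨hx j, mem_univ _⟩
      _ = _ := by
          rw [law, Measure.infinitePi_pi _ fun _ _ => measurableSet_Iic.prod .univ]
          simp [Measure.prod_prod]
  have h0 : law r m {x | ∀ j, (x j).1 ≤ t} ≤ 0 :=
    ge_of_tendsto' (ENNReal.tendsto_pow_atTop_nhds_zero_of_lt_one hle) key
  rw [ae_iff]
  simpa using h0

/-- A single gap longer than `k` already places its epoch after `k`, so arbitrarily long gaps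
exclude accumulation. -/
lemma ae_isProper (hr : 0 < r) [IsProbabilityMeasure m] :
    ∀ᵐ x ∂(law r m), x.IsProper := by
  have h : ∀ᵐ x ∂(law r m), ∀ k : ℕ, ∃ n, (k : ℝ) < (x n).1 :=
    ae_all_iff.2 fun k => ae_exists_lt_gap hr k.cast_nonneg
  filter_upwards [ae_gap_pos hr, h] with x hpos hx
  refine ⟨hpos, fun t => ?_⟩
  obtain ⟨k, hk⟩ := exists_nat_ge t
  obtain ⟨n, hn⟩ := hx k
  refine ⟨n, ?_⟩
  rw [epoch, gapSum_succ]
  have : 0 ≤ x.gapSum n := Finset.sum_nonneg fun j _ => (hpos j).le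
  linarith

/-- Only the first gap is altered. With the first mark and the rest of the stream integrated out, a
function of that gap remains, to which memorylessness of the exponential law applies. -/
lemma lintegral_law_advance (hr : 0 < r) [IsProbabilityMeasure m] {f : Stream M → ℝ≥0∞}
    (hf : Measurable f) {y : ℝ} (hy : 0 ≤ y) :
    ∫⁻ z in {z | y < (z 0).1}, f (advance y z) ∂(law r m) =
      ENNReal.ofReal (Real.exp (-(r * y))) * ∫⁻ z, f z ∂(law r m) := by
  have := isProbabilityMeasure_expMeasure hr
  have := isProbabilityMeasure_law hr (m := m)
  let c : (ℝ × M) × Stream M → Stream M := fun p j => Nat.casesOn j p.1 fun k => p.2 k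
  have hc : Measurable c := by
    refine measurable_pi_lambda _ fun j => ?_
    rcases j with _ | j <;> simp only [c] <;> fun_prop
  have hcx : ∀ x : Stream M, c (x 0, fun j => x (1 + j)) = x := fun x => by
    funext j
    rcases j with _ | j
    · rfl
    · simp [c, add_comm]
  have hca : ∀ g k w, advance y (c ((g, k), w)) = c ((g - y, k), w) := fun g k w => by
    funext j
    rcases j with _ | j <;> simp [advance, c]
  have hs : MeasurableSet {z : Stream M | y < (z 0).1} :=
    measurableSet_lt measurable_const (by fun_prop)
  have hfa : Measurable fun z : Stream M => f (advance y z) :=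
    hf.comp (measurable_advance.comp measurable_prodMk_left)
  let φ : ℝ → ℝ≥0∞ := fun g => ∫⁻ k, ∫⁻ w, f (c ((g, k), w)) ∂(law r m) ∂m
  have hφ : Measurable φ := by
    have h1 : Measurable fun p : (ℝ × M) × Stream M => f (c p) := hf.comp hc
    have h2 : Measurable fun p : ℝ × M => ∫⁻ w, f (c (p, w)) ∂(law r m) := h1.lintegral_prod_right'
    exact h2.lintegral_prod_right'
  have e1 : ∫⁻ z, f z ∂(law r m) = ∫⁻ g, φ g ∂(expMeasure r) := by
    have := lintegral_law_cons hr (m := m) (hf.comp hc)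
    simp only [Function.comp_def, hcx] at this
    exact this
  have e2 : ∫⁻ z in {z | y < (z 0).1}, f (advance y z) ∂(law r m) =
      ∫⁻ g in Ioi y, φ (g - y) ∂(expMeasure r) := by
    rw [← lintegral_indicator hs, ← lintegral_indicator measurableSet_Ioi]
    have := lintegral_law_cons hr (m := m) ((hfa.indicator hs).comp hc)
    simp only [Function.comp_def, hcx] at this
    rw [this]
    refine lintegral_congr fun g => ?_
    by_cases hg : y < g
    · rw [indicator_of_mem (by exact hg)]
      refine lintegral_congr fun k => lintegral_congr fun w => ?_
      rw [indicator_of_mem (by exact hg), hca]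
    · rw [indicator_of_notMem (by exact hg)]
      have : ∀ k w, ({z : Stream M | y < (z 0).1}.indicator (fun z => f (advance y z)))
          (c ((g, k), w)) = 0 := fun k w => indicator_of_notMem (by exact hg) _
      simp [this]
  rw [e1, e2, lintegral_expMeasure_memoryless hφ hy]

lemma law_advance (hr : 0 < r) [IsProbabilityMeasure m] {F : Set (Stream M)}
    (hF : MeasurableSet F) {y : ℝ} (hy : 0 ≤ y) :
    law r m {z | y < (z 0).1 ∧ advance y z ∈ F} =
      ENNReal.ofReal (Real.exp (-(r * y))) * law r m F := by
  have hs : MeasurableSet {z : Stream M | y < (z 0).1} :=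
    measurableSet_lt measurable_const (by fun_prop)
  have ha : Measurable fun z : Stream M => advance y z :=
    measurable_advance.comp measurable_prodMk_left
  have h := lintegral_law_advance hr (m := m) (measurable_one.indicator hF) hy
  rw [lintegral_indicator_one hF, ← lintegral_indicator hs] at h
  change law r m ({z | y < (z 0).1} ∩ (fun z => advance y z) ⁻¹' F) = _
  rw [← h, ← lintegral_indicator_one (hs.inter (ha hF))]
  refine lintegral_congr fun z => ?_
  by_cases h1 : y < (z 0).1 <;> by_cases h2 : advance y z ∈ F <;> simp [indicator, h1, h2]

lemma measurableSet_countEvent (t : ℝ) (n : ℕ) : MeasurableSet (countEvent M t n) := by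
  have h : MeasurableSet {x : Stream M | ∀ k ≤ n, x.gapSum k ≤ t} := by
    simp only [ofPred_forall]
    exact .iInter fun k => .iInter fun _ => measurableSet_le (measurable_gapSum _) measurable_const
  exact h.inter (measurableSet_lt measurable_const (measurable_gapSum _))

variable [Inhabited M]

/-- With exactly `n` points up to `t`, the past is a function of the first `n` entries, and the
shifted stream is the tail with its first gap shortened by the residual time `t - gapSum n`. Given
the first `n` entries, memorylessness produces an exponential factor times the probability of `F`.
The value of the constant is irrelevant; what matters is that it does not depend on `F`. -/
lemma law_countEvent_inter (hr : 0 < r) [IsProbabilityMeasure m] {t : ℝ} (n : ℕ)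
    {E : Set (Stream M)} (hE : MeasurableSet E) :
    ∃ c : ℝ≥0∞, ∀ F : Set (Stream M), MeasurableSet F →
      law r m (countEvent M t n ∩ {x | x.past t ∈ E ∧ x.shift t ∈ F}) = c * law r m F := by
  have := isProbabilityMeasure_expMeasure hr
  have := isProbabilityMeasure_law hr (m := m)
  -- The filler is the one of `past`, so that on the event of `n` points `ext` applied to the first
  -- `n` entries is the past itself.
  let ext : (Fin n → ℝ × M) → Stream M :=
    fun u j => if h : j < n then u ⟨j, h⟩ else (t + 1, default)
  have hext : Measurable ext := by
    refine measurable_pi_lambda _ fun j => ?_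
    by_cases h : j < n <;> simp only [ext, h, dite_true, dite_false] <;> fun_prop
  let D : Set (Fin n → ℝ × M) := {u | ext u ∈ E ∧ ∀ k ≤ n, (ext u).gapSum k ≤ t}
  have hD : MeasurableSet D := by
    have h : MeasurableSet {u : Fin n → ℝ × M | ∀ k ≤ n, (ext u).gapSum k ≤ t} := by
      simp only [ofPred_forall]
      exact .iInter fun k => .iInter fun _ =>
        measurableSet_le ((measurable_gapSum _).comp hext) measurable_const
    exact (hext hE).inter h
  let μ := Measure.infinitePi fun _ : Fin n => (expMeasure r).prod m
  refine ⟨∫⁻ u in D, ENNReal.ofReal (Real.exp (-(r * (t - (ext u).gapSum n)))) ∂μ,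
    fun F hF => ?_⟩
  let G : Set ((Fin n → ℝ × M) × Stream M) :=
    {p | p.1 ∈ D ∧ t - (ext p.1).gapSum n < (p.2 0).1 ∧
      advance (t - (ext p.1).gapSum n) p.2 ∈ F}
  have hS : Measurable fun p : (Fin n → ℝ × M) × Stream M => t - (ext p.1).gapSum n :=
    measurable_const.sub ((measurable_gapSum n).comp (hext.comp measurable_fst))
  have hG : MeasurableSet G :=
    (measurable_fst hD).inter ((measurableSet_lt hS (by fun_prop)).inter
      ((measurable_advance.comp (hS.prodMk measurable_snd)) hF))
  have hset : countEvent M t n ∩ {x | x.past t ∈ E ∧ x.shift t ∈ F} =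
      (fun x : Stream M => ((fun j : Fin n => x j), fun j => x (n + j))) ⁻¹' G := by
    ext x
    have hg : ∀ k ≤ n, (ext fun j : Fin n => x j).gapSum k = x.gapSum k := fun k hk =>
      gapSum_congr fun j hj => by simp [ext, show j < n by omega]
    have hp : x.count t = n → x.past t = ext fun j : Fin n => x j := fun h => by
      funext j
      simp [past, ext, h]
    simp only [mem_inter_iff, mem_preimage, G, D, mem_ofPred_eq, hg n le_rfl]
    constructor
    · rintro ⟨hx, h1, h2⟩
      have hc := count_eq_of_mem hx
      have h3 := hx.2
      rw [gapSum_succ] at h3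
      refine ⟨⟨hp hc ▸ h1, fun k hk => (hg k hk).trans_le (hx.1 k hk)⟩, by
        simp only [add_zero]; linarith, ?_⟩
      simpa [shift, hc] using h2
    · rintro ⟨⟨h1, h2⟩, h3, h4⟩
      have hx : x ∈ countEvent M t n := by
        refine ⟨fun k hk => (hg k hk).symm.trans_le (h2 k hk), ?_⟩
        rw [gapSum_succ]
        simp only [add_zero] at h3
        linarith
      have hc := count_eq_of_mem hx
      refine ⟨hx, hp hc ▸ h1, ?_⟩
      simpa [shift, hc] using h4
  rw [hset, ← Measure.map_apply (by fun_prop) hG, law_map_split hr, Measure.prod_apply hG,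
    ← lintegral_mul_const' _ _ (measure_ne_top _ _), ← lintegral_indicator hD]
  refine lintegral_congr fun u => ?_
  by_cases hu : u ∈ D
  · rw [indicator_of_mem hu, ← law_advance hr hF (sub_nonneg.2 (hu.2 n le_rfl))]
    congr 1
    ext z
    simp [G, hu]
  · rw [indicator_of_notMem hu]
    have : Prod.mk u ⁻¹' G = ∅ := by ext z; simp [G, hu]
    rw [this, measure_empty]

/-- Markov property of a Poisson stream: from time `t` on it is a Poisson stream with the same law,
independent of the past. -/
lemma law_map_past_shift (hr : 0 < r) [IsProbabilityMeasure m] {t : ℝ} (ht : 0 ≤ t) :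
    (law r m).map (fun x => (x.past t, x.shift t)) =
      ((law r m).map (past t)).prod (law r m) := by
  have := isProbabilityMeasure_law hr (m := m)
  have hm : Measurable fun x : Stream M => (x.past t, x.shift t) := by fun_prop
  have := Measure.isProbabilityMeasure_map (μ := law r m) (measurable_past t).aemeasurable
  have H : ∀ (n : ℕ) (E : Set (Stream M)), MeasurableSet E → ∃ c : ℝ≥0∞, ∀ F : Set (Stream M),
      MeasurableSet F → law r m (countEvent M t n ∩ {x | x.past t ∈ E ∧ x.shift t ∈ F}) =
        c * law r m F := fun n E hE => law_countEvent_inter hr n hE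
  choose! c hc using H
  have key : ∀ E F : Set (Stream M), MeasurableSet E → MeasurableSet F →
      law r m {x | x.past t ∈ E ∧ x.shift t ∈ F} = (∑' n, c n E) * law r m F := by
    intro E F hE hF
    have hEF : MeasurableSet {x : Stream M | x.past t ∈ E ∧ x.shift t ∈ F} :=
      (measurable_past t hE).inter (measurable_shift t hF)
    rw [← ENNReal.tsum_mul_right]
    simp_rw [← fun n => hc n E hE F hF]
    rw [← measure_iUnion _ fun n => (measurableSet_countEvent t n).inter hEF]
    · refine measure_congr ?_
      filter_upwards [ae_isProper hr] with x hx
      refine propext ⟨fun h => mem_iUnion.2 ⟨_, hx.mem_countEvent ht, h⟩, fun h => ?_⟩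
      obtain ⟨n, hn⟩ := mem_iUnion.1 h
      exact hn.2
    · intro a b hab
      refine disjoint_left.2 fun x ha hb => hab ?_
      rw [← count_eq_of_mem ha.1, ← count_eq_of_mem hb.1]
  refine (Measure.prod_eq fun E F hE hF => ?_).symm
  rw [Measure.map_apply hm (hE.prod hF), Measure.map_apply (measurable_past t) hE]
  -- The choice `F = univ` identifies the sum of the constants with the probability that the past
  -- lies in `E`.
  have h1 := key E univ hE .univ
  simp only [mem_univ, and_true, measure_univ, mul_one] at h1
  have h2 := key E F hE hF
  rw [← h1] at h2
  exact h2

end Stream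

/-! ### Linear integral equations with coefficients continuous off a countable set -/

section Calculus

variable {b W : ℝ → ℝ} {C t : ℝ}

/-- The linear Volterra equation `W(x) = C + ∫_x^t b W` has an explicit solution. -/
lemma volterra_solution (ht : 0 ≤ t) (hb : Measurable b) (hW : Measurable W)
    (hbi : ∀ x y, IntervalIntegrable b volume x y)
    (hbW : ∀ x y, IntervalIntegrable (fun z => b z * W z) volume x y)
    (hc : {x | ¬ ContinuousAt b x}.Countable)
    (h : ∀ x ∈ Icc 0 t, W x = C + ∫ y in x..t, b y * W y) :
    W 0 = C * Real.exp (∫ y in (0 : ℝ)..t, b y) := by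
  have hWc : ContinuousOn W (Icc 0 t) := by
    have : Continuous fun x => C + ∫ y in x..t, b y * W y := by
      refine continuous_const.add ?_
      simp_rw [intervalIntegral.integral_symm t]
      exact (intervalIntegral.continuous_primitive hbW t).neg
    exact this.continuousOn.congr h
  -- With the integrating factor, the derivative vanishes off the countable set of discontinuities
  -- of `b`, so the values at `0` and `t` agree.
  let f : ℝ → ℝ := fun x => W x * Real.exp (∫ y in (0 : ℝ)..x, b y)
  have hf : ContinuousOn f (Icc 0 t) :=
    hWc.mul (Real.continuous_exp.comp (intervalIntegral.continuous_primitive hbi 0)).continuousOn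
  have hd : ∀ x ∈ Ioo 0 t \ {x | ¬ ContinuousAt b x}, HasDerivAt f 0 x := by
    rintro x ⟨hx, hxb⟩
    have hxb : ContinuousAt b x := not_not.1 hxb
    have hWx : ContinuousAt W x := hWc.continuousAt (Icc_mem_nhds hx.1 hx.2)
    have h1 : HasDerivAt (fun z => C + ∫ y in z..t, b y * W y) (-(b x * W x)) x :=
      (intervalIntegral.integral_hasDerivAt_left (hbW x t)
        ((hb.mul hW).stronglyMeasurable.stronglyMeasurableAtFilter) (hxb.mul hWx)).const_add C
    have h2 : HasDerivAt W (-(b x * W x)) x := by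
      refine h1.congr_of_eventuallyEq ?_
      filter_upwards [Icc_mem_nhds hx.1 hx.2] with z hz using h z hz
    have h3 : HasDerivAt (fun z => ∫ y in (0 : ℝ)..z, b y) (b x) x :=
      intervalIntegral.integral_hasDerivAt_right (hbi 0 x)
        hb.stronglyMeasurable.stronglyMeasurableAtFilter hxb
    convert! h2.mul h3.exp using 1
    ring
  have h0 := integral_eq_of_hasDerivAt_off_countable_of_le f (fun _ => 0) ht hc hf hd
    intervalIntegrable_const
  have ht' := h t ⟨ht, le_rfl⟩
  simp only [intervalIntegral.integral_same, add_zero] at ht'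
  simp only [intervalIntegral.integral_zero, f, intervalIntegral.integral_same, Real.exp_zero,
    mul_one, ht'] at h0
  linarith

/-- Fundamental theorem of calculus for `x ↦ exp(-∫_x^t b)`, with countably many exceptional points.
This is the expansion that makes the void probability linear in the indicator of the
catastrophe-free set. -/
lemma one_sub_exp_neg_integral (ht : 0 ≤ t) (hb : Measurable b)
    (hbi : ∀ x y, IntervalIntegrable b volume x y)
    (hc : {x | ¬ ContinuousAt b x}.Countable) :
    1 - Real.exp (-∫ y in (0 : ℝ)..t, b y) =
      ∫ x in (0 : ℝ)..t, b x * Real.exp (-∫ y in x..t, b y) := by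
  have hcont : Continuous fun x => Real.exp (-∫ y in x..t, b y) := by
    simp_rw [intervalIntegral.integral_symm t, neg_neg]
    exact Real.continuous_exp.comp (intervalIntegral.continuous_primitive hbi t)
  have h0 := integral_eq_of_hasDerivAt_off_countable_of_le
    (fun x => Real.exp (-∫ y in x..t, b y)) (fun x => b x * Real.exp (-∫ y in x..t, b y)) ht hc
    hcont.continuousOn (fun x hx => ?_) ((hbi 0 t).mul_continuousOn hcont.continuousOn)
  · rw [h0]
    simp
  · have h1 : HasDerivAt (fun z => ∫ y in z..t, b y) (-b x) x :=
      intervalIntegral.integral_hasDerivAt_left (hbi x t)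
        hb.stronglyMeasurable.stronglyMeasurableAtFilter (not_not.1 hx.2)
    convert! h1.neg.exp using 1
    simp only [Pi.neg_apply]
    ring

end Calculus

/-! ### Void probabilities of marked Poisson streams -/

namespace Stream

variable {M : Type*} {R : Set (ℝ × M)}

/-- The marked points of the stream, started at `a`, all avoid `R`. -/
def Avoids (R : Set (ℝ × M)) (a : ℝ) (x : Stream M) : Prop :=
  ∀ n, (a + x.epoch n, (x n).2) ∉ R

lemma avoids_cons {a : ℝ} {x : Stream M} :
    Avoids R a x ↔ (a + (x 0).1, (x 0).2) ∉ R ∧ Avoids R (a + (x 0).1) fun j => x (1 + j) := by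
  have h : ∀ n, x.epoch (n + 1) = (x 0).1 + epoch (fun j => x (1 + j)) n := fun n => by
    rw [epoch, show n + 1 + 1 = 1 + (n + 1) by ring, gapSum_add x 1 (n + 1)]
    simp [epoch, gapSum]
  have h0 : x.epoch 0 = (x 0).1 := by simp [epoch, gapSum]
  constructor
  · refine fun hx => ⟨by simpa only [h0] using hx 0, fun n => ?_⟩
    have := hx (n + 1)
    rwa [h, ← add_assoc, add_comm n 1] at this
  · rintro ⟨h1, h2⟩ n
    rcases n with _ | n
    · rwa [h0]
    · have := h2 n
      rwa [h, ← add_assoc, add_comm n 1]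

variable [MeasurableSpace M] {r t : ℝ} {m : Measure M}

lemma measurableSet_avoids (hR : MeasurableSet R) :
    MeasurableSet {p : ℝ × Stream M | Avoids R p.1 p.2} := by
  simp only [Avoids, ofPred_forall]
  refine .iInter fun n => (MeasurableSet.compl hR).preimage ?_
  exact (measurable_fst.add ((measurable_epoch n).comp measurable_snd)).prodMk (by fun_prop)

/-- First-point decomposition: the first point, at `a + g`, must avoid `R`, and from there on an
independent stream of the same law starts at `a + g`. -/
lemma law_avoids_eq_lintegral (hr : 0 < r) [IsProbabilityMeasure m] (hR : MeasurableSet R)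
    (a : ℝ) :
    law r m {x | Avoids R a x} = ∫⁻ g in Ioi 0, ENNReal.ofReal (r * Real.exp (-(r * g))) *
      (m {k | (a + g, k) ∉ R} * law r m {x | Avoids R (a + g) x}) := by
  have := isProbabilityMeasure_law hr (m := m)
  have hA := measurableSet_avoids hR
  have hV : Measurable fun a => law r m {x | Avoids R a x} := measurable_measure_prodMk_left hA
  have hG : Measurable fun a => m {k | (a, k) ∉ R} := measurable_measure_prodMk_left hR.compl
  have hAa : ∀ a, MeasurableSet {x : Stream M | Avoids R a x} := fun a =>
    hA.preimage measurable_prodMk_left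
  have hRa : ∀ a, MeasurableSet {k : M | (a, k) ∉ R} := fun a =>
    hR.compl.preimage measurable_prodMk_left
  let S : Set ((ℝ × M) × Stream M) := {p | (a + p.1.1, p.1.2) ∉ R ∧ Avoids R (a + p.1.1) p.2}
  have hS : MeasurableSet S := by
    refine (hR.compl.preimage (f := fun p : (ℝ × M) × Stream M => (a + p.1.1, p.1.2))
      (by fun_prop)).inter (hA.preimage (f := fun p : (ℝ × M) × Stream M => (a + p.1.1, p.2))
      (by fun_prop))
  rw [← lintegral_expMeasure (f := fun g => m {k | (a + g, k) ∉ R} *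
    law r m {x | Avoids R (a + g) x}) ((hG.mul hV).comp (measurable_const_add a)),
    ← lintegral_indicator_one (hAa a)]
  have h := lintegral_law_cons hr (m := m) (measurable_one.indicator hS)
  convert! h using 1
  · refine lintegral_congr fun x => ?_
    have : x ∈ {x | Avoids R a x} ↔ (x 0, fun j => x (1 + j)) ∈ S := avoids_cons
    by_cases hx : x ∈ {x | Avoids R a x}
    · rw [indicator_of_mem hx, indicator_of_mem (this.1 hx)]; rfl
    · rw [indicator_of_notMem hx, indicator_of_notMem (this.not.1 hx)]
  · refine lintegral_congr fun g => ?_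
    rw [mul_comm, ← setLIntegral_const, ← lintegral_indicator (hRa (a + g))]
    refine lintegral_congr fun k => ?_
    by_cases hk : (a + g, k) ∉ R
    · rw [indicator_of_mem (by exact hk), ← lintegral_indicator_one (hAa (a + g))]
      refine lintegral_congr fun w => ?_
      by_cases hw : Avoids R (a + g) w <;> simp [indicator, S, hk, hw]
    · rw [indicator_of_notMem (by exact hk)]
      have : ∀ w, S.indicator (1 : (ℝ × M) × Stream M → ℝ≥0∞) ((g, k), w) = 0 := fun w =>
        indicator_of_notMem (fun h => hk h.1) _
      simp only [this, lintegral_zero]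

/-- Every point of a stream started at `a ≥ t` lies strictly beyond `t`, hence outside `R`. -/
lemma law_real_avoids_eq_one (hr : 0 < r) [IsProbabilityMeasure m]
    (hRt : ∀ p ∈ R, p.1 ≤ t) {a : ℝ} (ha : t ≤ a) : (law r m).real {x | Avoids R a x} = 1 := by
  have := isProbabilityMeasure_law hr (m := m)
  have h : ∀ᵐ x ∂(law r m), Avoids R a x := by
    filter_upwards [ae_isProper hr] with x hx n hn
    have h1 := hRt _ hn
    have h2 := hx.epoch_pos n
    simp only at h1
    linarith
  have h1 : law r m {x | Avoids R a x} = law r m univ :=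
    measure_congr (Filter.eventuallyEq_univ.2 h)
  rw [measureReal_def, h1, measure_univ, ENNReal.toReal_one]

/-- Void probabilities of a marked Poisson stream. -/
lemma law_real_avoids (hr : 0 < r) [IsProbabilityMeasure m] (hR : MeasurableSet R) (ht : 0 ≤ t)
    (hRt : ∀ p ∈ R, p.1 ≤ t) {G : ℝ → ℝ} (hG : Measurable G)
    (hc : {x | ¬ ContinuousAt G x}.Countable)
    (hGm : ∀ a ≤ t, G a = m.real {k | (a, k) ∉ R}) (hG01 : ∀ a, G a ∈ Icc 0 1) :
    (law r m).real {x | ∀ n, (x.epoch n, (x n).2) ∉ R} =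
      Real.exp (-∫ a in (0 : ℝ)..t, r * (1 - G a)) := by
  have := isProbabilityMeasure_law hr (m := m)
  let V : ℝ → ℝ := fun a => (law r m).real {x | Avoids R a x}
  have hV : Measurable V :=
    (measurable_measure_prodMk_left (measurableSet_avoids hR)).ennreal_toReal
  have hV01 : ∀ a, V a ∈ Icc 0 1 := fun a => ⟨measureReal_nonneg, measureReal_le_one⟩
  have hGi : ∀ x y, IntervalIntegrable G volume x y := fun x y =>
    (intervalIntegrable_const (c := (1 : ℝ))).mono_fun hG.aestronglyMeasurable
      (Filter.Eventually.of_forall fun a => by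
        simp only [Real.norm_eq_abs, abs_one]
        rw [abs_of_nonneg (hG01 a).1]; exact (hG01 a).2)
  -- The weight `e^{-ra}` turns the integral over the first gap into an integral over the position
  -- `y = a + g`, in which `a` survives only as the lower limit.
  let W : ℝ → ℝ := fun a => Real.exp (-(r * a)) * V a
  have hW : Measurable W := by fun_prop
  have hbW : ∀ x y, IntervalIntegrable (fun z => r * G z * W z) volume x y := fun x y => by
    have h1 : Continuous fun z => r * Real.exp (-(r * z)) := by fun_prop
    refine (h1.intervalIntegrable x y).mono_fun (by fun_prop)
      (Filter.Eventually.of_forall fun a => ?_)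
    simp only [W, Real.norm_eq_abs, abs_mul, abs_of_nonneg (hG01 a).1, abs_of_nonneg (hV01 a).1]
    calc |r| * G a * (|Real.exp (-(r * a))| * V a)
        ≤ |r| * 1 * (|Real.exp (-(r * a))| * 1) := by
          gcongr
          · exact (hG01 a).2
          · exact (hV01 a).2
      _ = _ := by ring
  have hrec : ∀ a ∈ Icc 0 t, W a = Real.exp (-(r * t)) + ∫ y in a..t, r * G y * W y := by
    intro a ha
    -- The integrand contains the true avoidance probability, since `G` is known to agree with it
    -- only up to `t`.
    let F : ℝ → ℝ := fun y => r * m.real {k | (y, k) ∉ R} * W y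
    have hF : Measurable F :=
      (measurable_const.mul (measurable_measure_prodMk_left hR.compl).ennreal_toReal).mul hW
    have hF0 : ∀ y, 0 ≤ F y := fun y =>
      mul_nonneg (mul_nonneg hr.le measureReal_nonneg) (mul_nonneg (Real.exp_pos _).le (hV01 y).1)
    have h1 : ENNReal.ofReal (W a) = ∫⁻ y in Ioi a, ENNReal.ofReal (F y) := by
      have e1 : ENNReal.ofReal (W a) = ENNReal.ofReal (Real.exp (-(r * a))) *
          law r m {x | Avoids R a x} := by
        rw [ENNReal.ofReal_mul (Real.exp_pos _).le, ofReal_measureReal]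
      rw [e1, law_avoids_eq_lintegral hr hR a, ← lintegral_const_mul' _ _ ENNReal.ofReal_ne_top,
        ← lintegral_indicator measurableSet_Ioi, ← lintegral_indicator measurableSet_Ioi,
        ← lintegral_add_left_eq_self ((Ioi a).indicator fun y => ENNReal.ofReal (F y)) a]
      refine lintegral_congr fun g => ?_
      by_cases hg : 0 < g
      · have h2 : a + g ∈ Ioi a := by simpa using hg
        rw [indicator_of_mem (by exact hg), indicator_of_mem h2]
        simp only [F, W, V]
        rw [← ofReal_measureReal (μ := m), ← ofReal_measureReal (μ := law r m),
          ← ENNReal.ofReal_mul measureReal_nonneg, ← ENNReal.ofReal_mul (by positivity),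
          ← ENNReal.ofReal_mul (Real.exp_pos _).le]
        congr 1
        rw [mul_add, neg_add, Real.exp_add]
        ring
      · have h2 : a + g ∉ Ioi a := by simpa using hg
        have h3 : g ∉ Ioi (0 : ℝ) := hg
        rw [indicator_of_notMem h3, indicator_of_notMem h2]
    have h2 : W a = ∫ y in Ioi a, F y := by
      rw [integral_eq_lintegral_of_nonneg_ae (Filter.Eventually.of_forall hF0)
        hF.aestronglyMeasurable, ← h1,
        ENNReal.toReal_ofReal (mul_nonneg (Real.exp_pos _).le (hV01 a).1)]
    -- Beyond `t` nothing can be hit any more, so the tail of the integral is `e^{-rt}`, the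
    -- constant of the Volterra equation.
    have h3 : ∀ y ∈ Ioi t, F y = r * Real.exp (-(r * y)) := fun y hy => by
      have hy' : t < y := hy
      have e1 : m.real {k | (y, k) ∉ R} = 1 := by
        have : {k | (y, k) ∉ R} = univ :=
          eq_univ_of_forall fun k hk => absurd (hRt _ hk) (not_le.2 hy')
        rw [this]; simp
      simp only [F, W, V, e1, law_real_avoids_eq_one hr hRt hy'.le, mul_one]
    have h4 : ∀ y ∈ Ioc a t, F y = r * G y * W y := fun y hy => by simp only [F, hGm y hy.2]
    have hi1 : IntegrableOn F (Ioc a t) := by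
      refine IntegrableOn.congr_fun ?_ (fun y hy => (h4 y hy).symm) measurableSet_Ioc
      exact (intervalIntegrable_iff_integrableOn_Ioc_of_le ha.2).1 (hbW a t)
    have hexp : IntegrableOn (fun y => r * Real.exp (-(r * y))) (Ioi t) := by
      have := (integrableOn_exp_mul_Ioi (a := -r) (by linarith) t).const_mul r
      simpa [neg_mul, IntegrableOn] using this
    have hi2 : IntegrableOn F (Ioi t) := hexp.congr_fun (fun y hy => (h3 y hy).symm) measurableSet_Ioi
    rw [h2, ← Ioc_union_Ioi_eq_Ioi ha.2, setIntegral_union (Ioc_disjoint_Ioi le_rfl)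
      measurableSet_Ioi hi1 hi2, setIntegral_congr_fun measurableSet_Ioc h4,
      setIntegral_congr_fun measurableSet_Ioi h3, ← intervalIntegral.integral_of_le ha.2,
      add_comm]
    congr 1
    have := integral_exp_mul_Ioi (a := -r) (by linarith) t
    rw [integral_const_mul]
    simp only [neg_mul] at this
    rw [this]
    field_simp
  have hcr : {x | ¬ ContinuousAt (fun y => r * G y) x}.Countable :=
    hc.mono fun x hx hx' => hx (continuousAt_const.mul hx')
  have h := volterra_solution ht (hG.const_mul r) hW (fun x y => (hGi x y).const_mul r) hbW hcr hrec
  have h0 : W 0 = (law r m).real {x | ∀ n, (x.epoch n, (x n).2) ∉ R} := by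
    simp [W, V, Avoids]
  rw [← h0, h, ← Real.exp_add]
  congr 1
  simp_rw [mul_sub, mul_one]
  rw [intervalIntegral.integral_sub intervalIntegrable_const ((hGi 0 t).const_mul r)]
  simp
  ring

end Stream

/-! ### The canonical system, pathwise -/

/-- The mark of a batch: its size and the service times of its customers. -/
abbrev Mark := ℝ × (ℕ → ℝ)

/-- The canonical sample space: one stream of batches for each type, and the clock that drives the
catastrophes. -/
abbrev World (ι : Type*) := (ι → Stream Mark) × Stream Unit

namespace World

variable {ι : Type*} {ν t u : ℝ} {w : World ι}

/-- The `j`-th customer of the `n`-th batch of type `i` is present at time `t`. -/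
def Present (ν : ℝ) (w : World ι) (i : ι) (n j : ℕ) (t : ℝ) : Prop :=
  (j : ℝ) < (w.1 i n).2.1 ∧ (w.1 i).epoch n ≤ t ∧ t < (w.1 i).epoch n + (w.1 i n).2.2 j ∧
    ∀ m, ¬ (ν * (w.1 i).epoch n < w.2.epoch m ∧ w.2.epoch m ≤ ν * t)

/-- The system is empty at time `t`. -/
def Idle (ν t : ℝ) (w : World ι) : Prop := ∀ i n j, ¬ Present ν w i n j t

/-- The epoch of the first arrival. -/
def start (w : World ι) : ℝ := ⨅ i, (w.1 i).epoch 0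

/-- The length of the first busy period. -/
def busy (ν : ℝ) (w : World ι) : ℝ≥0∞ :=
  ⨅ (u : ℝ≥0) (_ : Idle ν (w.start + u) w), (u : ℝ≥0∞)

/-- The length of the first busy cycle. -/
def cycle (ν : ℝ) (w : World ι) : ℝ≥0∞ := ENNReal.ofReal w.start + busy ν w

/-- Everything that has happened up to time `t`. -/
def past (ν t : ℝ) (w : World ι) : World ι := (fun i => (w.1 i).past t, w.2.past (ν * t))

/-- The world seen from time `t` on. -/
def shift (ν t : ℝ) (w : World ι) : World ι := (fun i => (w.1 i).shift t, w.2.shift (ν * t))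

/-- All the streams are proper. -/
def IsProper (w : World ι) : Prop := (∀ i, (w.1 i).IsProper) ∧ w.2.IsProper

lemma IsProper.shift (hw : w.IsProper) : (w.shift ν t).IsProper :=
  ⟨fun i => (hw.1 i).shift t, hw.2.shift _⟩

/-- Batches and clock ticks kept by `past` are unchanged, and the erased ones come after `t` both
before and after erasure, so they have no effect at `u ≤ t`. -/
lemma idle_past (hw : w.IsProper) (hν : 0 ≤ ν) (hu : 0 ≤ u) (hut : u ≤ t) :
    Idle ν u (w.past ν t) ↔ Idle ν u w := by
  have ht := hu.trans hut
  refine forall_congr' fun i => forall_congr' fun n => forall_congr' fun j => not_congr ?_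
  by_cases hn : n < (w.1 i).count t
  · have h1 : ((w.past ν t).1 i).epoch n = (w.1 i).epoch n := Stream.IsProper.epoch_past_of_lt hn
    have h2 : (w.past ν t).1 i n = w.1 i n := if_pos hn
    simp only [Present, h1, h2]
    refine and_congr_right fun _ => and_congr_right fun _ => and_congr_right fun _ =>
      forall_congr' fun m => not_congr ?_
    by_cases hm : m < w.2.count (ν * t)
    · have h3 : (w.past ν t).2.epoch m = w.2.epoch m := Stream.IsProper.epoch_past_of_lt hm
      rw [h3]
    · have hνu : ν * u ≤ ν * t := mul_le_mul_of_nonneg_left hut hν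
      have h3 : ν * t < (w.past ν t).2.epoch m := hw.2.lt_epoch_past (mul_nonneg hν ht) (not_lt.1 hm)
      have h4 := hw.2.lt_epoch_iff.2 (not_lt.1 hm)
      exact ⟨fun h => absurd h.2 (by linarith), fun h => absurd h.2 (by linarith)⟩
  · have h1 : t < ((w.past ν t).1 i).epoch n := (hw.1 i).lt_epoch_past ht (not_lt.1 hn)
    have h2 := (hw.1 i).lt_epoch_iff.2 (not_lt.1 hn)
    exact ⟨fun h => absurd h.2.1 (by linarith), fun h => absurd h.2.1 (by linarith)⟩

/-- If the system is empty at `t`, nobody who arrived by then matters later, so emptiness at `t + u`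
concerns only arrivals after `t`, and for these only clock ticks after `ν t`. Both are retained by
the shift. -/
lemma idle_shift (hw : w.IsProper) (hν : 0 ≤ ν) (hu : 0 ≤ u) (h : Idle ν t w) :
    Idle ν u (w.shift ν t) ↔ Idle ν (t + u) w := by
  have hνu := mul_nonneg hν hu
  have hep : ∀ i n, ((w.shift ν t).1 i).epoch n = (w.1 i).epoch ((w.1 i).count t + n) - t :=
    fun i n => Stream.epoch_shift _ _ _
  have hec : ∀ m, (w.shift ν t).2.epoch m = w.2.epoch (w.2.count (ν * t) + m) - ν * t :=
    fun m => Stream.epoch_shift _ _ _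
  have hmk : ∀ i n, ((w.shift ν t).1 i n).2 = (w.1 i ((w.1 i).count t + n)).2 :=
    fun i n => Stream.shift_snd _ _ _
  constructor
  · rintro hs i n j ⟨h1, h2, h3, h4⟩
    by_cases hn : n < (w.1 i).count t
    -- A customer who arrived by `t` and is present at `t + u` would have been present at `t`.
    · refine h i n j ⟨h1, (hw.1 i).epoch_le_iff.2 hn, by linarith, fun m hm => h4 m ⟨hm.1, ?_⟩⟩
      rw [mul_add]; linarith [hm.2]
    · obtain ⟨k, rfl⟩ := Nat.exists_eq_add_of_le (not_lt.1 hn)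
      refine hs i k j ⟨by rwa [hmk], by rw [hep]; linarith, by rw [hep, hmk]; linarith,
        fun m hm => h4 (w.2.count (ν * t) + m) ?_⟩
      rw [hep, hec, mul_sub] at hm
      rw [mul_add]
      exact ⟨by linarith [hm.1], by linarith [hm.2]⟩
  · rintro hs i n j ⟨h1, h2, h3, h4⟩
    rw [hmk] at h1 h3
    rw [hep] at h2 h3
    refine hs i _ j ⟨h1, by linarith, by linarith, fun m hm => ?_⟩
    have ht : t < (w.1 i).epoch ((w.1 i).count t + n) :=
      (hw.1 i).lt_epoch_iff.2 (Nat.le_add_right _ _)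
    have hνt : ν * t ≤ ν * (w.1 i).epoch ((w.1 i).count t + n) :=
      mul_le_mul_of_nonneg_left ht.le hν
    -- A tick that removes a customer who arrived after `t` comes after `ν t`, so it is also a tick
    -- of the shifted clock.
    obtain ⟨k, rfl⟩ := Nat.exists_eq_add_of_le (hw.2.lt_epoch_iff.1 (hνt.trans_lt hm.1))
    refine h4 k ?_
    rw [hep, hec, mul_sub]
    rw [mul_add] at hm
    exact ⟨by linarith [hm.1], by linarith [hm.2]⟩

lemma cycle_le (h1 : 0 ≤ w.start) (h2 : w.start ≤ t) (h3 : Idle ν t w) :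
    cycle ν w ≤ ENNReal.ofReal t := by
  have h : busy ν w ≤ ENNReal.ofReal (t - w.start) := by
    refine iInf₂_le_of_le (Real.toNNReal (t - w.start)) ?_ le_rfl
    rwa [Real.coe_toNNReal _ (by linarith), add_sub_cancel]
  calc cycle ν w ≤ ENNReal.ofReal w.start + ENNReal.ofReal (t - w.start) := by
        unfold cycle; gcongr
    _ = ENNReal.ofReal t := by rw [← ENNReal.ofReal_add h1 (by linarith), add_sub_cancel]

lemma exists_idle_of_cycle_lt (h1 : 0 ≤ w.start) (h : cycle ν w < ENNReal.ofReal t) :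
    ∃ s, w.start ≤ s ∧ s < t ∧ Idle ν s w := by
  have hst : ENNReal.ofReal w.start < ENNReal.ofReal t := le_self_add.trans_lt h
  have hst' : w.start < t := (ENNReal.ofReal_lt_ofReal_iff'.1 hst).1
  have h2 : busy ν w < ENNReal.ofReal (t - w.start) := by
    rw [ENNReal.ofReal_sub _ h1]
    exact lt_tsub_iff_left.2 h
  simp only [busy, iInf_lt_iff] at h2
  obtain ⟨s, hs, hlt⟩ := h2
  refine ⟨w.start + s, by simp, ?_, hs⟩
  rw [ENNReal.ofReal, ENNReal.coe_lt_coe, ← NNReal.coe_lt_coe, Real.coe_toNNReal _ (by linarith)] at hlt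
  linarith

section Finite

variable [Finite ι] [Nonempty ι]

lemma lt_start_iff : t < w.start ↔ ∀ i, t < (w.1 i).epoch 0 := by
  constructor
  · exact fun h i => h.trans_le (ciInf_le (Set.finite_range _).bddBelow i)
  · intro h
    obtain ⟨i, hi⟩ := exists_eq_ciInf_of_finite (f := fun i => (w.1 i).epoch 0)
    exact (h i).trans_eq hi

lemma start_pos (hw : w.IsProper) : 0 < w.start :=
  lt_start_iff.2 fun i => (hw.1 i).epoch_pos 0

lemma lt_start_past (hw : w.IsProper) (hu : 0 ≤ u) (hut : u ≤ t) :
    u < (w.past ν t).start ↔ u < w.start := by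
  rw [lt_start_iff, lt_start_iff]
  refine forall_congr' fun i => ?_
  by_cases hn : 0 < (w.1 i).count t
  · have h1 : ((w.past ν t).1 i).epoch 0 = (w.1 i).epoch 0 := Stream.IsProper.epoch_past_of_lt hn
    rw [h1]
  · have h1 : t < ((w.past ν t).1 i).epoch 0 :=
      (hw.1 i).lt_epoch_past (hu.trans hut) (not_lt.1 hn)
    have h2 := (hw.1 i).lt_epoch_iff.2 (not_lt.1 hn)
    exact ⟨fun _ => by linarith, fun _ => by linarith⟩

lemma idle_of_lt_start (hw : w.IsProper) (h : t < w.start) : Idle ν t w := by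
  intro i n j hp
  have h1 := lt_start_iff.1 h i
  have h2 := (hw.1 i).strictMono_epoch.monotone (Nat.zero_le n)
  linarith [hp.2.1]

lemma start_shift (hw : w.IsProper) (h : t < w.start) : (w.shift ν t).start = w.start - t := by
  have h1 : ∀ i, (w.1 i).count t = 0 := fun i => by
    have := (hw.1 i).lt_epoch_iff.1 (lt_start_iff.1 h i)
    omega
  have h2 : ∀ i, ((w.shift ν t).1 i).epoch 0 = (w.1 i).epoch 0 - t := fun i => by
    have := Stream.epoch_shift t (w.1 i) 0
    rwa [h1] at this
  have h3 : ∀ s, s < (w.shift ν t).start ↔ s < w.start - t := fun s => by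
    rw [lt_sub_iff_add_lt, lt_start_iff, lt_start_iff]
    simp only [h2, lt_sub_iff_add_lt]
  exact eq_of_forall_lt_iff h3

/-- Before the first arrival the passage of time only shortens the idle period. This is the source
of the independence of idle period and busy period. -/
lemma busy_shift (hw : w.IsProper) (hν : 0 ≤ ν) (h : t < w.start) :
    busy ν (w.shift ν t) = busy ν w := by
  have h1 : ∀ s : ℝ≥0, Idle ν ((w.shift ν t).start + s) (w.shift ν t) ↔
      Idle ν (w.start + s) w := fun s => by
    rw [start_shift hw h, idle_shift hw hν _ (idle_of_lt_start hw h)]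
    · ring_nf
    · have := s.coe_nonneg
      linarith
  simp only [busy, h1]

/-- An empty system stays empty for some time. -/
lemma exists_idle_add (hw : w.IsProper) (hν : 0 ≤ ν) (h : Idle ν t w) :
    ∃ δ > 0, ∀ s, 0 ≤ s → s < δ → Idle ν (t + s) w :=
  ⟨(w.shift ν t).start, start_pos hw.shift, fun _ hs hδ =>
    (idle_shift hw hν hs h).1 (idle_of_lt_start hw.shift hδ)⟩

/-- Emptiness persists for a short time to the right, so every admissible duration can be
approximated from above by rational ones. A countable infimum makes measurability accessible. -/
lemma busy_eq_iInf_rat (hw : w.IsProper) (hν : 0 ≤ ν) :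
    busy ν w = ⨅ (q : ℚ≥0) (_ : Idle ν (w.start + q) w), ((q : ℝ≥0) : ℝ≥0∞) := by
  refine le_antisymm (le_iInf₂ fun q hq => iInf₂_le (q : ℝ≥0) (by rwa [show (((q : ℚ≥0) : ℝ≥0) : ℝ) = (q : ℝ) from rfl]))
    (le_iInf₂ fun s hs => ENNReal.le_of_forall_pos_le_add fun ε hε _ => ?_)
  obtain ⟨δ, hδ, hd⟩ := exists_idle_add hw hν hs
  obtain ⟨q, hq1, hq2⟩ := exists_rat_btwn (show (s : ℝ) < s + min δ ε by
    have : 0 < min δ (ε : ℝ) := lt_min hδ hε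
    linarith)
  have hq0 : 0 ≤ q := by
    have : (0 : ℝ) ≤ q := s.coe_nonneg.trans hq1.le
    exact_mod_cast this
  lift q to ℚ≥0 using hq0
  have h1 := min_le_left δ (ε : ℝ)
  have h2 := min_le_right δ (ε : ℝ)
  have hq3 : ((q : ℚ) : ℝ) = (q : ℝ) := by push_cast; rfl
  rw [hq3] at hq1 hq2
  have hi : Idle ν (w.start + (q : ℝ)) w := by
    have := hd ((q : ℝ) - s) (by linarith) (by linarith)
    convert! this using 1
    ring
  refine (iInf₂_le q hi).trans ?_
  rw [← ENNReal.coe_add, ENNReal.coe_le_coe, ← NNReal.coe_le_coe]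
  rw [show (((q : ℚ≥0) : ℝ≥0) : ℝ) = (q : ℝ) from rfl]
  push_cast
  linarith

end Finite

end World

/-! ### The law of the canonical system: measurability and Markov property -/

lemma measurePreserving_prodProdProdComm {α β γ δ : Type*} [MeasurableSpace α] [MeasurableSpace β]
    [MeasurableSpace γ] [MeasurableSpace δ] (a : Measure α) (b : Measure β) (c : Measure γ)
    (d : Measure δ) [SFinite a] [SFinite b] [SFinite c] [SFinite d] :
    MeasurePreserving (fun p : (α × β) × γ × δ => ((p.1.1, p.2.1), (p.1.2, p.2.2)))
      ((a.prod b).prod (c.prod d)) ((a.prod c).prod (b.prod d)) := by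
  have hm : Measurable fun p : (α × β) × γ × δ => ((p.1.1, p.2.1), (p.1.2, p.2.2)) := by fun_prop
  refine ⟨hm, Measure.ext_of_lintegral _ fun f hf => ?_⟩
  rw [lintegral_map hf hm, lintegral_prod (μ := a.prod b) (ν := c.prod d) _ (by fun_prop),
    lintegral_prod _ hf.aemeasurable, lintegral_prod _ (by fun_prop),
    lintegral_prod _ (by fun_prop)]
  refine lintegral_congr fun x => ?_
  have h1 : ∀ y, ∫⁻ q : γ × δ, f ((x, q.1), (y, q.2)) ∂(c.prod d) =
      ∫⁻ z, ∫⁻ v, f ((x, z), (y, v)) ∂d ∂c := fun y => lintegral_prod _ (by fun_prop)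
  have h2 : ∀ z, ∫⁻ q : β × δ, f ((x, z), q) ∂(b.prod d) =
      ∫⁻ y, ∫⁻ v, f ((x, z), (y, v)) ∂d ∂b := fun y => lintegral_prod _ (by fun_prop)
  simp only [h1, h2]
  refine lintegral_lintegral_swap (Measurable.aemeasurable ?_)
  have h3 : Measurable fun p : (β × γ) × δ => f ((x, p.1.2), (p.1.1, p.2)) := by fun_prop
  exact h3.lintegral_prod_right'

namespace World

variable {ι : Type*} {ν t : ℝ}

@[fun_prop]
lemma measurable_past (ν t : ℝ) : Measurable (past ν t : World ι → World ι) := by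
  refine Measurable.prodMk (measurable_pi_lambda _ fun i => ?_) ?_
  · exact (Stream.measurable_past t).comp (by fun_prop)
  · exact (Stream.measurable_past _).comp (by fun_prop)

@[fun_prop]
lemma measurable_shift (ν t : ℝ) : Measurable (shift ν t : World ι → World ι) := by
  refine Measurable.prodMk (measurable_pi_lambda _ fun i => ?_) ?_
  · exact (Stream.measurable_shift t).comp (by fun_prop)
  · exact (Stream.measurable_shift _).comp (by fun_prop)

section Measurable

variable [Countable ι]

lemma measurableSet_idle_prod (ν : ℝ) : MeasurableSet {p : ℝ × World ι | Idle ν p.1 p.2} := by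
  simp only [Idle, ofPred_forall]
  refine .iInter fun i => .iInter fun n => .iInter fun j => MeasurableSet.compl ?_
  have he : Measurable fun p : ℝ × World ι => (p.2.1 i).epoch n :=
    (Stream.measurable_epoch n).comp (by fun_prop)
  have hx : Measurable fun p : ℝ × World ι => p.2.1 i n :=
    (measurable_pi_apply n).comp ((measurable_pi_apply i).comp (by fun_prop))
  have h1 : MeasurableSet {p : ℝ × World ι | (j : ℝ) < (p.2.1 i n).2.1} :=
    measurableSet_lt measurable_const (measurable_fst.comp (measurable_snd.comp hx))
  have h2 : MeasurableSet {p : ℝ × World ι | (p.2.1 i).epoch n ≤ p.1} :=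
    measurableSet_le he measurable_fst
  have h3 : MeasurableSet {p : ℝ × World ι | p.1 < (p.2.1 i).epoch n + (p.2.1 i n).2.2 j} :=
    measurableSet_lt measurable_fst
      (he.add ((measurable_pi_apply j).comp (measurable_snd.comp (measurable_snd.comp hx))))
  have h4 : MeasurableSet {p : ℝ × World ι | ∀ m, ¬ (ν * (p.2.1 i).epoch n < p.2.2.epoch m ∧
      p.2.2.epoch m ≤ ν * p.1)} := by
    simp only [ofPred_forall]
    refine .iInter fun m => MeasurableSet.compl ?_
    have hc : Measurable fun p : ℝ × World ι => p.2.2.epoch m :=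
      (Stream.measurable_epoch m).comp (by fun_prop)
    exact (measurableSet_lt (he.const_mul ν) hc).inter
      (measurableSet_le hc (measurable_fst.const_mul ν))
  exact h1.inter (h2.inter (h3.inter h4))

lemma measurableSet_idle (ν t : ℝ) : MeasurableSet {w : World ι | Idle ν t w} :=
  (measurableSet_idle_prod ν).preimage (measurable_prodMk_left (x := t))

end Measurable

@[fun_prop]
lemma measurable_start [Finite ι] [Nonempty ι] : Measurable (start : World ι → ℝ) := by
  refine measurable_of_Ioi fun t => ?_
  have : start ⁻¹' Ioi t = ⋂ i, {w : World ι | t < (w.1 i).epoch 0} := by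
    ext w
    simp [lt_start_iff]
  rw [this]
  exact .iInter fun i => measurableSet_lt measurable_const
    ((Stream.measurable_epoch 0).comp (by fun_prop))

variable [Fintype ι]

/-- The law of the world. -/
def law (lam : ι → ℝ) (m : ι → Measure Mark) : Measure (World ι) :=
  (Measure.pi fun i => Stream.law (lam i) (m i)).prod (Stream.law 1 (Measure.dirac ()))

variable {lam : ι → ℝ} {m : ι → Measure Mark}

section

variable [∀ i, IsProbabilityMeasure (m i)]

lemma isProbabilityMeasure_law (hlam : ∀ i, 0 < lam i) : IsProbabilityMeasure (law lam m) := by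
  have := fun i => Stream.isProbabilityMeasure_law (hlam i) (m := m i)
  have := Stream.isProbabilityMeasure_law one_pos (m := Measure.dirac ())
  unfold law; infer_instance

lemma ae_isProper (hlam : ∀ i, 0 < lam i) : ∀ᵐ w ∂(law lam m), w.IsProper := by
  have := fun i => Stream.isProbabilityMeasure_law (hlam i) (m := m i)
  have := Stream.isProbabilityMeasure_law one_pos (m := Measure.dirac ())
  have h1 : ∀ᵐ x ∂(Measure.pi fun i => Stream.law (lam i) (m i)), ∀ i, (x i).IsProper :=
    ae_all_iff.2 fun i => (Measure.tendsto_eval_ae_ae (i := i)).eventually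
      (Stream.ae_isProper (hlam i))
  exact (Measure.quasiMeasurePreserving_fst.ae h1).and
    (Measure.quasiMeasurePreserving_snd.ae (Stream.ae_isProper one_pos))

/-- Markov property of the world. -/
lemma law_map_past_shift (hlam : ∀ i, 0 < lam i) (hν : 0 ≤ ν) (ht : 0 ≤ t) :
    (law lam m).map (fun w => (w.past ν t, w.shift ν t)) =
      ((law lam m).map (past ν t)).prod (law lam m) := by
  have := fun i => Stream.isProbabilityMeasure_law (hlam i) (m := m i)
  have := Stream.isProbabilityMeasure_law one_pos (m := Measure.dirac ())
  have := isProbabilityMeasure_law hlam (m := m)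
  have hp := fun i => Measure.isProbabilityMeasure_map (μ := Stream.law (lam i) (m i))
    (Stream.measurable_past t).aemeasurable
  have hc := Measure.isProbabilityMeasure_map (μ := Stream.law 1 (Measure.dirac ()))
    (Stream.measurable_past (ν * t)).aemeasurable
  have h1 := measurePreserving_pi (fun i => Stream.law (lam i) (m i))
    (fun i => ((Stream.law (lam i) (m i)).map (Stream.past t)).prod (Stream.law (lam i) (m i)))
    fun i => ⟨(Stream.measurable_past t).prodMk (Stream.measurable_shift t),
      Stream.law_map_past_shift (hlam i) ht⟩
  have h2 := (measurePreserving_arrowProdEquivProdArrow (Stream Mark) (Stream Mark) ι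
    (fun i => (Stream.law (lam i) (m i)).map (Stream.past t))
    (fun i => Stream.law (lam i) (m i))).comp h1
  have h3 : MeasurePreserving (fun x : Stream Unit => (x.past (ν * t), x.shift (ν * t)))
      (Stream.law 1 (Measure.dirac ())) _ :=
    ⟨(Stream.measurable_past _).prodMk (Stream.measurable_shift _),
      Stream.law_map_past_shift one_pos (mul_nonneg hν ht)⟩
  -- The pairs (past, future) of the batch streams and of the clock are regrouped into the joint
  -- past and the joint future.
  have h4 := (measurePreserving_prodProdProdComm _ _ _ _).comp (h2.prod h3)
  have h5 := h4.map_eq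
  have h6 : (law lam m).map (fun w => (w.past ν t, w.shift ν t)) =
      ((Measure.pi fun i => (Stream.law (lam i) (m i)).map (Stream.past t)).prod
        ((Stream.law 1 (Measure.dirac ())).map (Stream.past (ν * t)))).prod (law lam m) := h5
  have h7 : (law lam m).map (past ν t) = (Measure.pi fun i =>
      (Stream.law (lam i) (m i)).map (Stream.past t)).prod
        ((Stream.law 1 (Measure.dirac ())).map (Stream.past (ν * t))) := by
    have h8 := congrArg (Measure.map Prod.fst) h6
    rw [Measure.map_map measurable_fst (by fun_prop), ← Measure.fst, Measure.fst_prod] at h8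
    exact h8
  rw [h6, h7]

/-- Events of the past are independent of events of the future. -/
lemma law_inter_shift (hlam : ∀ i, 0 < lam i) (hν : 0 ≤ ν) (ht : 0 ≤ t) {A F : Set (World ι)}
    (hA : MeasurableSet A) (hF : MeasurableSet F)
    (hAp : ∀ w : World ι, w.IsProper → (w.past ν t ∈ A ↔ w ∈ A)) :
    law lam m (A ∩ {w | w.shift ν t ∈ F}) = law lam m A * law lam m F := by
  have := isProbabilityMeasure_law hlam (m := m)
  have h := congrArg (fun μ => μ (A ×ˢ F)) (law_map_past_shift (m := m) hlam hν ht)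
  simp only [Measure.prod_prod] at h
  rw [Measure.map_apply ((measurable_past ν t).prodMk (measurable_shift ν t)) (hA.prod hF),
    Measure.map_apply (measurable_past ν t) hA] at h
  have e1 : law lam m (past ν t ⁻¹' A) = law lam m A := by
    refine measure_congr ?_
    filter_upwards [ae_isProper hlam] with w hw using propext (hAp w hw)
  have e2 : law lam m ((fun w => (w.past ν t, w.shift ν t)) ⁻¹' A ×ˢ F) =
      law lam m (A ∩ {w | w.shift ν t ∈ F}) := by
    refine measure_congr ?_
    filter_upwards [ae_isProper hlam] with w hw
    exact propext (and_congr_left fun _ => hAp w hw)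
  rw [← e1, ← e2, h]

lemma law_shift (hlam : ∀ i, 0 < lam i) (hν : 0 ≤ ν) (ht : 0 ≤ t) {F : Set (World ι)}
    (hF : MeasurableSet F) : law lam m {w | w.shift ν t ∈ F} = law lam m F := by
  have := isProbabilityMeasure_law hlam (m := m)
  have h := law_inter_shift (m := m) hlam hν ht .univ hF (by simp)
  simpa using h

lemma measurePreserving_shift (hlam : ∀ i, 0 < lam i) (hν : 0 ≤ ν) (ht : 0 ≤ t) :
    MeasurePreserving (shift ν t) (law lam m) (law lam m) :=
  ⟨measurable_shift ν t, Measure.ext fun F hF => by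
    rw [Measure.map_apply (measurable_shift ν t) hF]
    exact law_shift hlam hν ht hF⟩

/-- The first arrival is the minimum of independent exponential variables, so the rates add up. -/
lemma law_lt_start (hlam : ∀ i, 0 < lam i) (ht : 0 ≤ t) [Nonempty ι] :
    law lam m {w | t < w.start} = ENNReal.ofReal (Real.exp (-((∑ i, lam i) * t))) := by
  have := fun i => Stream.isProbabilityMeasure_law (hlam i) (m := m i)
  have := fun i => isProbabilityMeasure_expMeasure (hlam i)
  have := Stream.isProbabilityMeasure_law one_pos (m := Measure.dirac ())
  have h1 : {w : World ι | t < w.start} =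
      (univ.pi fun _ => {x : Stream Mark | t < x.epoch 0}) ×ˢ univ := by
    ext w
    simp [lt_start_iff]
  have h2 : ∀ i, Stream.law (lam i) (m i) {x : Stream Mark | t < x.epoch 0} =
      ENNReal.ofReal (Real.exp (-(lam i * t))) := fun i => by
    have h3 : {x : Stream Mark | t < x.epoch 0} = (fun x => x 0) ⁻¹' (Ioi t ×ˢ univ) := by
      ext x
      simp [Stream.epoch, Stream.gapSum]
    rw [h3, ← Measure.map_apply (by fun_prop) (measurableSet_Ioi.prod .univ), Stream.law,
      Measure.infinitePi_map_eval, Measure.prod_prod, expMeasure_Ioi (hlam i) ht, measure_univ,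
      mul_one]
  rw [h1, law, Measure.prod_prod, measure_univ, mul_one, Measure.pi_pi]
  simp_rw [h2]
  rw [← ENNReal.ofReal_prod_of_nonneg fun _ _ => (Real.exp_pos _).le, ← Real.exp_sum,
    Finset.sum_neg_distrib, Finset.sum_mul]

/-- The rational infimum is measurable but agrees with `busy` only for proper streams, hence the
almost everywhere form. -/
lemma aemeasurable_busy [Nonempty ι] (hlam : ∀ i, 0 < lam i) (hν : 0 ≤ ν) :
    AEMeasurable (busy ν) (law lam m) := by
  classical
  have hS : ∀ q : ℚ≥0, MeasurableSet {w : World ι | Idle ν (w.start + q) w} := fun q =>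
    (measurableSet_idle_prod ν).preimage
      (f := fun w : World ι => (w.start + (q : ℝ), w)) (by fun_prop)
  refine ⟨fun w => ⨅ q : ℚ≥0, if Idle ν (w.start + q) w then ((q : ℝ≥0) : ℝ≥0∞) else ⊤,
    .iInf fun q => .ite (hS q) measurable_const measurable_const, ?_⟩
  filter_upwards [ae_isProper hlam] with w hw
  rw [busy_eq_iInf_rat hw hν]
  refine iInf_congr fun q => ?_
  by_cases h : Idle ν (w.start + (q : ℝ)) w <;> simp [h]

lemma aemeasurable_cycle [Nonempty ι] (hlam : ∀ i, 0 < lam i) (hν : 0 ≤ ν) :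
    AEMeasurable (cycle ν) (law lam m) :=
  measurable_start.ennreal_ofReal.aemeasurable.add (aemeasurable_busy hlam hν)

end

end World

/-! ### Batch sizes, generating functions and marks -/

section GeneratingFunction

variable (q : PMF ℕ) {x y z : ℝ}

lemma summable_pmf_toReal : Summable fun n => (q n).toReal :=
  ENNReal.summable_toReal (by simp [q.tsum_coe])

lemma tsum_pmf_toReal : ∑' n, (q n).toReal = 1 := by
  rw [← ENNReal.tsum_toReal_eq q.apply_ne_top, q.tsum_coe, ENNReal.toReal_one]

lemma summable_pgf (hz : z ∈ Icc (0 : ℝ) 1) : Summable fun n => (q n).toReal * z ^ n :=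
  (summable_pmf_toReal q).of_nonneg_of_le
    (fun _ => mul_nonneg ENNReal.toReal_nonneg (pow_nonneg hz.1 _))
    fun _ => mul_le_of_le_one_right ENNReal.toReal_nonneg (pow_le_one₀ hz.1 hz.2)

lemma pgf_mono (hx : 0 ≤ x) (hxy : x ≤ y) (hy : y ≤ 1) : pgf q x ≤ pgf q y :=
  (summable_pgf q ⟨hx, hxy.trans hy⟩).tsum_le_tsum
    (fun n => mul_le_mul_of_nonneg_left (pow_le_pow_left₀ hx hxy n) ENNReal.toReal_nonneg)
    (summable_pgf q ⟨hx.trans hxy, hy⟩)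

lemma pgf_mem_Icc (hz : z ∈ Icc (0 : ℝ) 1) : pgf q z ∈ Icc (0 : ℝ) 1 := by
  refine ⟨tsum_nonneg fun n => mul_nonneg ENNReal.toReal_nonneg (pow_nonneg hz.1 n), ?_⟩
  refine (pgf_mono q hz.1 hz.2 le_rfl).trans_eq ?_
  simp [pgf, tsum_pmf_toReal]

variable (B : Measure ℝ)

lemma pgf_cdf_mem_Icc (x : ℝ) : pgf q (cdf B x) ∈ Icc (0 : ℝ) 1 :=
  pgf_mem_Icc q ⟨cdf_nonneg B x, cdf_le_one B x⟩

lemma monotone_pgf_cdf : Monotone fun x => pgf q (cdf B x) := fun _ _ h =>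
  pgf_mono q (cdf_nonneg B _) (monotone_cdf B h) (cdf_le_one B _)

/-- The law of the mark of a batch. -/
def markLaw : Measure Mark :=
  (q.toMeasure.map (Nat.cast : ℕ → ℝ)).prod (Measure.infinitePi fun _ : ℕ => B)

variable [IsProbabilityMeasure B]

instance : IsProbabilityMeasure (markLaw q B) := by
  have := Measure.isProbabilityMeasure_map (μ := q.toMeasure)
    (measurable_from_nat (f := (Nat.cast : ℕ → ℝ))).aemeasurable
  unfold markLaw; infer_instance

/-- Given batch size `n`, all `n` independent service times are at most `y` with probability `B(y) ^
n`; averaging over `n` gives the generating function. -/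
lemma markLaw_real_service_le (y : ℝ) :
    (markLaw q B).real {k | ∀ j : ℕ, (j : ℝ) < k.1 → k.2 j ≤ y} = pgf q (cdf B y) := by
  have hc : Measurable (Nat.cast : ℕ → ℝ) := measurable_from_nat
  have := Measure.isProbabilityMeasure_map (μ := q.toMeasure) hc.aemeasurable
  have hS : MeasurableSet {k : Mark | ∀ j : ℕ, (j : ℝ) < k.1 → k.2 j ≤ y} := by
    simp only [ofPred_forall, imp_iff_not_or]
    refine .iInter fun j => ?_
    have hv : Measurable fun k : Mark => k.2 j := by fun_prop
    exact (measurableSet_lt measurable_const measurable_fst).compl.union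
      (measurableSet_le hv measurable_const)
  have h1 : ∀ n : ℕ, (Measure.infinitePi fun _ : ℕ => B)
      (Prod.mk (n : ℝ) ⁻¹' {k : Mark | ∀ j : ℕ, (j : ℝ) < k.1 → k.2 j ≤ y}) =
        (B (Iic y)) ^ n := fun n => by
    have : Prod.mk (n : ℝ) ⁻¹' {k : Mark | ∀ j : ℕ, (j : ℝ) < k.1 → k.2 j ≤ y} =
        (Finset.range n : Set ℕ).pi fun _ => Iic y := by
      ext v
      simp [Set.mem_pi]
    rw [this, Measure.infinitePi_pi _ fun _ _ => measurableSet_Iic]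
    simp
  have h2 : markLaw q B {k | ∀ j : ℕ, (j : ℝ) < k.1 → k.2 j ≤ y} =
      ∑' n, q n * (B (Iic y)) ^ n := by
    rw [markLaw, Measure.prod_apply hS, lintegral_map (measurable_measure_prodMk_left hS) hc]
    simp_rw [h1]
    rw [lintegral_countable']
    simp_rw [PMF.toMeasure_apply_singleton _ _ (measurableSet_singleton _), mul_comm]
  rw [measureReal_def, h2, ENNReal.tsum_toReal_eq, pgf]
  · simp [cdf_eq_real, measureReal_def]
  · exact fun n => ENNReal.mul_ne_top (q.apply_ne_top n) (ENNReal.pow_ne_top (measure_ne_top _ _))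

end GeneratingFunction

/-! ### The intensity of batches that still matter -/

section Intensity

variable {ι : Type*} [Fintype ι] (lam : ι → ℝ) (q : ι → PMF ℕ) (B : ι → Measure ℝ)

/-- The rate at which customers arrive that are still present after time `x`. -/
def intensity (x : ℝ) : ℝ := ∑ i, lam i * (1 - pgf (q i) (cdf (B i) x))

variable {lam}

lemma antitone_intensity (hlam : ∀ i, 0 < lam i) : Antitone (intensity lam q B) := fun _ _ h =>
  Finset.sum_le_sum fun i _ => mul_le_mul_of_nonneg_left
    (sub_le_sub_left (monotone_pgf_cdf (q i) (B i) h) 1) (hlam i).le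

lemma intensity_nonneg (hlam : ∀ i, 0 < lam i) (x : ℝ) : 0 ≤ intensity lam q B x :=
  Finset.sum_nonneg fun i _ => mul_nonneg (hlam i).le
    (sub_nonneg.2 (pgf_cdf_mem_Icc (q i) (B i) x).2)

lemma intensity_le (hlam : ∀ i, 0 < lam i) (x : ℝ) : intensity lam q B x ≤ ∑ i, lam i :=
  Finset.sum_le_sum fun i _ => mul_le_of_le_one_right (hlam i).le
    (by linarith [(pgf_cdf_mem_Icc (q i) (B i) x).1])

lemma intervalIntegrable_intensity (hlam : ∀ i, 0 < lam i) (x y : ℝ) :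
    IntervalIntegrable (intensity lam q B) volume x y :=
  (antitone_intensity q B hlam).intervalIntegrable

end Intensity

/-- The formula for the probability of an empty system, in terms of the time reversed intensity. -/
lemma idleFormula_eq_one_sub {a : ℝ → ℝ} (ha : Antitone a) {ν t : ℝ} (ht : 0 ≤ t) :
    idleFormula a ν t = 1 - ∫ x in (0 : ℝ)..t,
      Real.exp (-(ν * (t - x))) * (a (t - x) * Real.exp (-∫ y in x..t, a (t - y))) := by
  have hb : Monotone fun x => a (t - x) := fun x y h => ha (by linarith)
  have hbi : ∀ x y, IntervalIntegrable (fun x => a (t - x) + ν) volume x y := fun x y =>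
    (hb.add_const ν).intervalIntegrable
  have hexp : ∀ x, Real.exp (-∫ y in x..t, (a (t - y) + ν)) =
      Real.exp (-(ν * (t - x))) * Real.exp (-∫ y in x..t, a (t - y)) := fun x => by
    rw [intervalIntegral.integral_add hb.intervalIntegrable intervalIntegrable_const,
      ← Real.exp_add]
    congr 1
    simp
    ring
  have hrefl : ∀ x, ∫ y in x..t, (a (t - y) + ν) = ∫ y in (0 : ℝ)..(t - x), (a y + ν) := fun x => by
    rw [intervalIntegral.integral_comp_sub_left (fun y => a y + ν) t, sub_self]
  have hcont : Continuous fun x => Real.exp (-∫ y in x..t, (a (t - y) + ν)) := by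
    simp_rw [intervalIntegral.integral_symm t, neg_neg]
    exact Real.continuous_exp.comp (intervalIntegral.continuous_primitive hbi t)
  -- The expansion is applied to the rate `a(t - x) + ν`; its `ν` part is, after reflection, exactly
  -- the second term of `idleFormula`.
  have h1 := one_sub_exp_neg_integral ht (hb.add_const ν).measurable hbi
    (hb.add_const ν).countable_not_continuousAt
  have h2 : ∫ x in (0 : ℝ)..t, (a (t - x) + ν) * Real.exp (-∫ y in x..t, (a (t - y) + ν)) =
      (∫ x in (0 : ℝ)..t, a (t - x) * Real.exp (-∫ y in x..t, (a (t - y) + ν))) +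
        ν * ∫ x in (0 : ℝ)..t, Real.exp (-∫ y in x..t, (a (t - y) + ν)) := by
    simp_rw [add_mul]
    rw [intervalIntegral.integral_add, intervalIntegral.integral_const_mul]
    · exact hb.intervalIntegrable.mul_continuousOn hcont.continuousOn
    · exact (hcont.intervalIntegrable _ _).const_mul ν
  have h3 : ∫ x in (0 : ℝ)..t, Real.exp (-∫ y in x..t, (a (t - y) + ν)) =
      ∫ u in (0 : ℝ)..t, Real.exp (-∫ x in (0 : ℝ)..u, (a x + ν)) := by
    simp_rw [hrefl]
    rw [intervalIntegral.integral_comp_sub_left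
      (fun u => Real.exp (-∫ x in (0 : ℝ)..u, (a x + ν))) t, sub_self, sub_zero]
  have h4 : ∫ x in (0 : ℝ)..t,
      Real.exp (-(ν * (t - x))) * (a (t - x) * Real.exp (-∫ y in x..t, a (t - y))) =
        ∫ x in (0 : ℝ)..t, a (t - x) * Real.exp (-∫ y in x..t, (a (t - y) + ν)) := by
    refine intervalIntegral.integral_congr fun x _ => ?_
    simp only [hexp]
    ring
  have h5 := hrefl 0
  rw [sub_zero] at h5
  rw [idleFormula, h4, ← h5, ← h3]
  linarith

/-! ### The probability of an empty system -/

namespace World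

open Classical in
/-- Void probability of a stream of batches for a given clock. -/
lemma stream_law_void {r ν t : ℝ} (hr : 0 < r) (hν : 0 ≤ ν) (ht : 0 ≤ t) (q : PMF ℕ)
    (B : Measure ℝ) [IsProbabilityMeasure B] (c : Stream Unit) :
    (Stream.law r (markLaw q B)).real {x | ∀ n, (x.epoch n, (x n).2) ∉
      {p : ℝ × Mark | p.1 ≤ t ∧ (∃ j : ℕ, (j : ℝ) < p.2.1 ∧ t < p.1 + p.2.2 j) ∧
        ∀ m, ¬ (ν * p.1 < c.epoch m ∧ c.epoch m ≤ ν * t)}} =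
    Real.exp (-∫ a in (0 : ℝ)..t, r * (1 - if ∀ m, ¬ (ν * a < c.epoch m ∧ c.epoch m ≤ ν * t)
      then pgf q (cdf B (t - a)) else 1)) := by
  -- Monotonicity yields both measurability and countably many discontinuities. The function is not
  -- the avoidance probability for `a > t`, which `law_real_avoids` permits.
  have hanti : Antitone fun a => if ∀ m, ¬ (ν * a < c.epoch m ∧ c.epoch m ≤ ν * t)
      then pgf q (cdf B (t - a)) else 1 := by
    intro a a' haa
    by_cases h : ∀ m, ¬ (ν * a < c.epoch m ∧ c.epoch m ≤ ν * t)
    · have h' : ∀ m, ¬ (ν * a' < c.epoch m ∧ c.epoch m ≤ ν * t) := fun m hm =>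
        h m ⟨(mul_le_mul_of_nonneg_left haa hν).trans_lt hm.1, hm.2⟩
      simp only [if_pos h, if_pos h']
      exact monotone_pgf_cdf q B (by linarith)
    · simp only [if_neg h]
      split_ifs
      · exact (pgf_cdf_mem_Icc q B _).2
      · exact le_rfl
  refine Stream.law_real_avoids hr ?_ ht (fun p hp => hp.1) hanti.measurable
    hanti.countable_not_continuousAt (fun a ha => ?_) fun a => ?_
  · have h1 : MeasurableSet {p : ℝ × Mark | ∃ j : ℕ, (j : ℝ) < p.2.1 ∧ t < p.1 + p.2.2 j} := by
      simp only [ofPred_exists]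
      refine .iUnion fun j => ?_
      have hv : Measurable fun p : ℝ × Mark => p.1 + p.2.2 j := by fun_prop
      have hs : Measurable fun p : ℝ × Mark => p.2.1 := by fun_prop
      exact (measurableSet_lt measurable_const hs).inter (measurableSet_lt measurable_const hv)
    have h2 : MeasurableSet
        {p : ℝ × Mark | ∀ m, ¬ (ν * p.1 < c.epoch m ∧ c.epoch m ≤ ν * t)} := by
      simp only [ofPred_forall]
      refine .iInter fun m => MeasurableSet.compl ?_
      have hp : Measurable fun p : ℝ × Mark => ν * p.1 := by fun_prop
      exact (measurableSet_lt hp measurable_const).inter (.const _)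
    exact (measurableSet_le measurable_fst measurable_const).inter (h1.inter h2)
  · split_ifs with h
    · rw [← markLaw_real_service_le]
      congr 1
      ext k
      constructor
      · rintro hk ⟨_, ⟨j, hj, hlt⟩, _⟩
        simp only at hlt
        linarith [hk j hj]
      · intro hk j hj
        by_contra! hlt
        refine hk ⟨ha, ⟨j, hj, ?_⟩, h⟩
        simp only
        linarith
    · have : {k | (a, k) ∉ {p : ℝ × Mark | p.1 ≤ t ∧
          (∃ j : ℕ, (j : ℝ) < p.2.1 ∧ t < p.1 + p.2.2 j) ∧
          ∀ m, ¬ (ν * p.1 < c.epoch m ∧ c.epoch m ≤ ν * t)}} = univ :=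
        eq_univ_of_forall fun k hk => h hk.2.2
      rw [this]
      simp
  · split_ifs
    · exact pgf_cdf_mem_Icc q B _
    · exact ⟨zero_le_one, le_rfl⟩

/-- The probability that the clock does not tick in `(ν x, ν t]`. -/
lemma clock_void {ν t x : ℝ} (hν : 0 ≤ ν) (hx : 0 ≤ x) (hxt : x ≤ t) :
    (Stream.law 1 (Measure.dirac ())).real
      {c | ∀ m, ¬ (ν * x < c.epoch m ∧ c.epoch m ≤ ν * t)} = Real.exp (-(ν * (t - x))) := by
  have := Stream.isProbabilityMeasure_law one_pos (m := Measure.dirac ())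
  have := isProbabilityMeasure_expMeasure one_pos
  have hνx := mul_nonneg hν hx
  have hνt : 0 ≤ ν * t - ν * x := sub_nonneg.2 (mul_le_mul_of_nonneg_left hxt hν)
  -- The clock is restarted at `ν x`; the event then says that the first gap of the restarted clock
  -- exceeds `ν t - ν x`.
  have h := congrArg (Measure.map Prod.snd)
    (Stream.law_map_past_shift (m := Measure.dirac ()) one_pos hνx)
  have := Measure.isProbabilityMeasure_map (μ := Stream.law 1 (Measure.dirac ()))
    (Stream.measurable_past (ν * x)).aemeasurable
  rw [Measure.map_map measurable_snd (by fun_prop), ← Measure.snd, Measure.snd_prod] at h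
  have h1 : {c : Stream Unit | ∀ m, ¬ (ν * x < c.epoch m ∧ c.epoch m ≤ ν * t)}
      =ᵐ[Stream.law 1 (Measure.dirac ())]
        Stream.shift (ν * x) ⁻¹' ((fun c => c 0) ⁻¹' (Ioi (ν * t - ν * x) ×ˢ univ)) := by
    filter_upwards [Stream.ae_isProper one_pos] with c hc
    refine propext ?_
    have h2 : c.shift (ν * x) ∈ (fun c : Stream Unit => c 0) ⁻¹' (Ioi (ν * t - ν * x) ×ˢ univ) ↔
        ν * t < c.epoch (c.count (ν * x)) := by
      have h3 := Stream.epoch_shift (ν * x) c 0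
      simp only [Stream.epoch, Stream.gapSum_succ, Stream.gapSum_zero, zero_add, add_zero] at h3
      simp only [mem_preimage, mem_prod, mem_Ioi, mem_univ, and_true, h3, Stream.epoch,
        Stream.gapSum_succ]
      exact sub_lt_sub_iff_right _
    refine Iff.trans ?_ h2.symm
    constructor
    · intro hm
      by_contra! hle
      exact hm _ ⟨hc.lt_epoch_iff.2 le_rfl, hle⟩
    · rintro hlt m ⟨h3, h4⟩
      have := hc.strictMono_epoch.monotone (hc.lt_epoch_iff.1 h3)
      linarith
  have hS : MeasurableSet (Ioi (ν * t - ν * x) ×ˢ (univ : Set Unit)) := measurableSet_Ioi.prod .univ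
  rw [measureReal_def, measure_congr h1, ← Measure.map_apply (by fun_prop)
    (hS.preimage (by fun_prop))]
  change (Measure.map (Prod.snd ∘ fun x_1 : Stream Unit => (Stream.past (ν * x) x_1,
    Stream.shift (ν * x) x_1)) (Stream.law 1 (Measure.dirac ())) _).toReal = _
  rw [h, ← Measure.map_apply (by fun_prop) hS, Stream.law, Measure.infinitePi_map_eval,
    Measure.prod_prod, expMeasure_Ioi one_pos hνt, measure_univ, mul_one,
    ENNReal.toReal_ofReal (Real.exp_pos _).le]
  congr 1
  ring

variable {ι : Type*} [Fintype ι] {lam : ι → ℝ} {q : ι → PMF ℕ} {B : ι → Measure ℝ}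
  [∀ i, IsProbabilityMeasure (B i)] {ν t : ℝ}

-- For a fixed clock the types are independent, so the void probabilities multiply and the exponents
-- add up to the intensity, cut off where a catastrophe intervenes.
open Classical in
lemma law_idle_eq_lintegral (hlam : ∀ i, 0 < lam i) (hν : 0 ≤ ν) (ht : 0 ≤ t) :
    law lam (fun i => markLaw (q i) (B i)) {w | Idle ν t w} =
      ∫⁻ c, ENNReal.ofReal (Real.exp (-∫ a in (0 : ℝ)..t,
        if ∀ m, ¬ (ν * a < c.epoch m ∧ c.epoch m ≤ ν * t) then intensity lam q B (t - a) else 0))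
          ∂(Stream.law 1 (Measure.dirac ())) := by
  have := fun i => Stream.isProbabilityMeasure_law (hlam i) (m := markLaw (q i) (B i))
  have := Stream.isProbabilityMeasure_law one_pos (m := Measure.dirac ())
  rw [law, Measure.prod_apply_symm (measurableSet_idle ν t)]
  refine lintegral_congr fun c => ?_
  have h1 : (fun x : ι → Stream Mark => (x, c)) ⁻¹' {w | Idle ν t w} =
      univ.pi fun _ => {x : Stream Mark | ∀ n, (x.epoch n, (x n).2) ∉
        {p : ℝ × Mark | p.1 ≤ t ∧ (∃ j : ℕ, (j : ℝ) < p.2.1 ∧ t < p.1 + p.2.2 j) ∧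
          ∀ m, ¬ (ν * p.1 < c.epoch m ∧ c.epoch m ≤ ν * t)}} := by
    ext x
    simp only [mem_preimage, mem_ofPred_eq, mem_univ_pi, Idle, Present]
    refine forall_congr' fun i => forall_congr' fun n => ?_
    constructor
    · rintro h ⟨h1, ⟨j, h2, h3⟩, h4⟩
      exact h j ⟨h2, h1, h3, h4⟩
    · rintro h j ⟨h1, h2, h3, h4⟩
      exact h ⟨h2, ⟨j, h1, h3⟩, h4⟩
  rw [h1, Measure.pi_pi]
  rw [Finset.prod_congr rfl fun i _ => (ofReal_measureReal (measure_ne_top _ _)).symm.trans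
    (congrArg ENNReal.ofReal (stream_law_void (hlam i) hν ht (q i) (B i) c)), ← ENNReal.ofReal_prod_of_nonneg fun _ _ => (Real.exp_pos _).le, ← Real.exp_sum,
    Finset.sum_neg_distrib, ← intervalIntegral.integral_finsetSum]
  · congr 3
    refine intervalIntegral.integral_congr fun a _ => ?_
    by_cases h : ∀ m, ¬ (ν * a < c.epoch m ∧ c.epoch m ≤ ν * t)
    · simp only [if_pos h, intensity]
    · simp only [if_neg h, sub_self, mul_zero, Finset.sum_const_zero]
  · intro i _
    have hmono : Monotone fun a => lam i * (1 - if ∀ m, ¬ (ν * a < c.epoch m ∧ c.epoch m ≤ ν * t)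
        then pgf (q i) (cdf (B i) (t - a)) else 1) := by
      intro a a' haa
      refine mul_le_mul_of_nonneg_left (sub_le_sub_left ?_ 1) (hlam i).le
      by_cases h : ∀ m, ¬ (ν * a < c.epoch m ∧ c.epoch m ≤ ν * t)
      · have h' : ∀ m, ¬ (ν * a' < c.epoch m ∧ c.epoch m ≤ ν * t) := fun m hm =>
          h m ⟨(mul_le_mul_of_nonneg_left haa hν).trans_lt hm.1, hm.2⟩
        simp only [if_pos h, if_pos h']
        exact monotone_pgf_cdf (q i) (B i) (by linarith)
      · simp only [if_neg h]
        split_ifs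
        · exact (pgf_cdf_mem_Icc (q i) (B i) _).2
        · exact le_rfl
    exact hmono.intervalIntegrable

/-- The probability of an empty system. -/
theorem law_real_idle (hlam : ∀ i, 0 < lam i) (hν : 0 ≤ ν) (ht : 0 ≤ t) :
    (law lam (fun i => markLaw (q i) (B i))).real {w | Idle ν t w} =
      idleFormula (intensity lam q B) ν t := by
  classical
  have hP := Stream.isProbabilityMeasure_law one_pos (m := Measure.dirac ())
  let P := Stream.law 1 (Measure.dirac ())
  let b : ℝ → ℝ := fun x => intensity lam q B (t - x)
  have hb : Monotone b := fun x y h => antitone_intensity q B hlam (by linarith)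
  have hb0 : ∀ x, 0 ≤ b x := fun x => intensity_nonneg q B hlam _
  let Void : Stream Unit → ℝ → Prop := fun c a => ∀ m, ¬ (ν * a < c.epoch m ∧ c.epoch m ≤ ν * t)
  have hVoid : ∀ c x y, x ≤ y → Void c x → Void c y := fun c x y hxy h m hm =>
    h m ⟨(mul_le_mul_of_nonneg_left hxy hν).trans_lt hm.1, hm.2⟩
  let φ : ℝ → ℝ := fun x => b x * Real.exp (-∫ y in x..t, b y)
  have hcont : Continuous fun x => Real.exp (-∫ y in x..t, b y) := by
    simp_rw [intervalIntegral.integral_symm t, neg_neg]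
    exact Real.continuous_exp.comp
      (intervalIntegral.continuous_primitive (fun _ _ => hb.intervalIntegrable) t)
  have hφm : Measurable φ := hb.measurable.mul hcont.measurable
  have hφi : IntervalIntegrable φ volume 0 t :=
    hb.intervalIntegrable.mul_continuousOn hcont.continuousOn
  -- If no catastrophe falls in `(x, t]`, none falls in `(y, t]` for `y ≥ x`. In the expansion the
  -- inner indicator is therefore `1` wherever the outer one is, and the right-hand side becomes
  -- linear in the indicator, ready for Fubini.
  have key : ∀ c, Real.exp (-∫ a in (0 : ℝ)..t, if Void c a then b a else 0) =
      1 - ∫ x in (0 : ℝ)..t, if Void c x then φ x else 0 := by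
    intro c
    have hmono : Monotone fun a => if Void c a then b a else 0 := by
      intro x y hxy
      by_cases h : Void c x
      · simp only [if_pos h, if_pos (hVoid c x y hxy h)]
        exact hb hxy
      · simp only [if_neg h]
        split_ifs
        · exact hb0 y
        · exact le_rfl
    have h := one_sub_exp_neg_integral ht hmono.measurable (fun _ _ => hmono.intervalIntegrable)
      hmono.countable_not_continuousAt
    have h2 : ∫ x in (0 : ℝ)..t, (if Void c x then b x else 0) *
        Real.exp (-∫ y in x..t, if Void c y then b y else 0) =
          ∫ x in (0 : ℝ)..t, if Void c x then φ x else 0 := by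
      refine intervalIntegral.integral_congr fun x hx => ?_
      rw [uIcc_of_le ht] at hx
      by_cases hv : Void c x
      · simp only [if_pos hv, φ]
        congr 3
        refine intervalIntegral.integral_congr fun y hy => ?_
        rw [uIcc_of_le hx.2] at hy
        simp only [if_pos (hVoid c x y hy.1 hv)]
      · simp only [if_neg hv, zero_mul]
    rw [h2] at h
    linarith
  have hVm : MeasurableSet {p : Stream Unit × ℝ | Void p.1 p.2} := by
    simp only [Void, ofPred_forall]
    refine .iInter fun m => MeasurableSet.compl ?_
    have hc : Measurable fun p : Stream Unit × ℝ => p.1.epoch m :=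
      (Stream.measurable_epoch m).comp measurable_fst
    exact (measurableSet_lt (by fun_prop) hc).inter (measurableSet_le hc measurable_const)
  have hint : Integrable (fun p : Stream Unit × ℝ => if Void p.1 p.2 then φ p.2 else 0)
      (P.prod (volume.restrict (Ioc 0 t))) := by
    have h1 : Integrable (fun p : Stream Unit × ℝ => φ p.2)
        (P.prod (volume.restrict (Ioc 0 t))) :=
      ((intervalIntegrable_iff_integrableOn_Ioc_of_le ht).1 hφi).comp_snd P
    refine h1.mono (Measurable.aestronglyMeasurable ?_) (Filter.Eventually.of_forall fun p => ?_)
    · exact Measurable.ite hVm (hφm.comp measurable_snd) measurable_const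
    · split_ifs <;> simp
  rw [measureReal_def, law_idle_eq_lintegral hlam hν ht]
  have e1 : ∀ c : Stream Unit, Real.exp (-∫ a in (0 : ℝ)..t,
      if ∀ m, ¬ (ν * a < c.epoch m ∧ c.epoch m ≤ ν * t) then intensity lam q B (t - a) else 0) =
      1 - ∫ x in Ioc 0 t, if Void c x then φ x else 0 := fun c => by
    rw [← intervalIntegral.integral_of_le ht]
    exact key c
  rw [← integral_eq_lintegral_of_nonneg_ae
    (Filter.Eventually.of_forall fun c => (Real.exp_pos _).le)]
  · simp_rw [e1]
    rw [integral_sub (integrable_const _) hint.integral_prod_left, integral_const]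
    rw [integral_integral_swap hint, idleFormula_eq_one_sub (antitone_intensity q B hlam) ht,
      intervalIntegral.integral_of_le ht]
    simp only [probReal_univ, smul_eq_mul, mul_one]
    congr 1
    refine setIntegral_congr_fun measurableSet_Ioc fun x hx => ?_
    have h2 : MeasurableSet {c | Void c x} := hVm.preimage measurable_prodMk_right
    have h3 : (fun c => if Void c x then φ x else 0) = {c | Void c x}.indicator fun _ => φ x := by
      ext c
      by_cases h : Void c x <;> simp [h]
    simp only [h3]
    rw [integral_indicator_const _ h2, smul_eq_mul, ← clock_void hν hx.1.le hx.2]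
  · simp_rw [e1]
    exact (aestronglyMeasurable_const.sub hint.integral_prod_left.aestronglyMeasurable)

end World

/-! ### Regeneration on a grid and the renewal equation -/

namespace World

open Filter Topology

variable {ι : Type*} {ν t h : ℝ} {w : World ι} {k : ℕ}

/-- The first time on the grid `h ℕ` after the first arrival at which the system is empty
is `k h`. -/
def gridIdle (ι : Type*) (ν h : ℝ) (k : ℕ) : Set (World ι) :=
  {w | (w.start ≤ k * h ∧ Idle ν (k * h) w) ∧
    ∀ l < k, ¬ (w.start ≤ l * h ∧ Idle ν (l * h) w)}

lemma eq_of_mem_gridIdle {l : ℕ} (hk : w ∈ gridIdle ι ν h k) (hl : w ∈ gridIdle ι ν h l) :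
    k = l := by
  rcases lt_trichotomy k l with hlt | heq | hlt
  · exact absurd hk.1 (hl.2 k hlt)
  · exact heq
  · exact absurd hl.1 (hk.2 l hlt)

lemma sum_indicator_gridIdle {f : ℕ → World ι → ℝ} (hh : 0 < h)
    (hk : w ∈ gridIdle ι ν h k) (hkt : k * h ≤ t) :
    ∑ l ∈ Finset.range (⌊t / h⌋₊ + 1), (gridIdle ι ν h l).indicator (f l) w = f k w := by
  rw [Finset.sum_eq_single k, indicator_of_mem hk]
  · exact fun l _ hl => indicator_of_notMem (fun h' => hl (eq_of_mem_gridIdle h' hk)) _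
  · intro hk'
    refine absurd (Finset.mem_range.2 (Nat.lt_succ_of_le (Nat.le_floor ?_))) hk'
    exact (le_div_iff₀ hh).2 hkt

lemma sum_indicator_gridIdle_eq_zero {f : ℕ → World ι → ℝ} (hh : 0 < h) (ht : 0 ≤ t)
    (hk : ∀ k : ℕ, k * h ≤ t → w ∉ gridIdle ι ν h k) :
    ∑ l ∈ Finset.range (⌊t / h⌋₊ + 1), (gridIdle ι ν h l).indicator (f l) w = 0 := by
  refine Finset.sum_eq_zero fun l hl => indicator_of_notMem (hk l ?_) _
  rw [← le_div_iff₀ hh]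
  exact (Nat.le_floor_iff (by positivity)).1 (Nat.lt_succ_iff.1 (Finset.mem_range.1 hl))

lemma mul_le_of_mem_range_floor {l : ℕ} (hh : 0 < h) (ht : 0 ≤ t)
    (hl : l ∈ Finset.range (⌊t / h⌋₊ + 1)) : l * h ≤ t := by
  rw [← le_div_iff₀ hh]
  exact (Nat.le_floor_iff (by positivity)).1 (Nat.lt_succ_iff.1 (Finset.mem_range.1 hl))

variable [Fintype ι] [Nonempty ι]

lemma measurableSet_gridIdle (ν h : ℝ) (k : ℕ) : MeasurableSet (gridIdle ι ν h k) := by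
  have h1 : ∀ l : ℕ, MeasurableSet {w : World ι | w.start ≤ l * h ∧ Idle ν (l * h) w} := fun l =>
    (measurableSet_le measurable_start measurable_const).inter (measurableSet_idle ν _)
  have h2 : MeasurableSet
      {w : World ι | ∀ l < k, ¬ (w.start ≤ l * h ∧ Idle ν (l * h) w)} := by
    simp only [ofPred_forall]
    exact .iInter fun l => .iInter fun _ => (h1 l).compl
  exact (h1 k).inter h2

/-- The event concerns only the states at grid points up to `k h`, hence only the past of `k h`.
This makes `k h` a regeneration point although the index `k` depends on the path. -/
lemma past_mem_gridIdle (hw : w.IsProper) (hν : 0 ≤ ν) (hh : 0 ≤ h) :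
    w.past ν (k * h) ∈ gridIdle ι ν h k ↔ w ∈ gridIdle ι ν h k := by
  have h1 : ∀ l ≤ k, ((w.past ν (k * h)).start ≤ l * h ∧ Idle ν (l * h) (w.past ν (k * h)) ↔
      w.start ≤ l * h ∧ Idle ν (l * h) w) := fun l hl => by
    have h2 : (0 : ℝ) ≤ l * h := by positivity
    have h3 : (l : ℝ) * h ≤ k * h := by gcongr
    rw [← not_lt, lt_start_past hw h2 h3, not_lt, idle_past hw hν h2 h3]
  exact and_congr (h1 k le_rfl) (forall_congr' fun l => forall_congr' fun hl =>
    not_congr (h1 l hl.le))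

lemma cycle_le_of_mem_gridIdle (hw : w.IsProper) (hk : w ∈ gridIdle ι ν h k) :
    cycle ν w ≤ ENNReal.ofReal (k * h) :=
  cycle_le (start_pos hw).le hk.1.1 hk.1.2

/-- An empty epoch `s < t` is followed by a whole empty interval, which contains the first grid
point from `s` on when the mesh is small. -/
lemma exists_mem_gridIdle (hw : w.IsProper) (hν : 0 ≤ ν) (hc : cycle ν w < ENNReal.ofReal t) :
    ∃ δ > 0, ∀ h, 0 < h → h < δ → ∃ k : ℕ, w ∈ gridIdle ι ν h k ∧ k * h < t := by
  classical
  have hT := start_pos hw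
  obtain ⟨s, hs1, hs2, hs3⟩ := exists_idle_of_cycle_lt hT.le hc
  obtain ⟨δ, hδ, hd⟩ := exists_idle_add hw hν hs3
  refine ⟨min δ (t - s), lt_min hδ (by linarith), fun h hh hhd => ?_⟩
  have h1 := hhd.trans_le (min_le_left _ _)
  have h2 := hhd.trans_le (min_le_right _ _)
  have hs0 : 0 ≤ s / h := by have := hT.le.trans hs1; positivity
  have h3 : s ≤ ⌈s / h⌉₊ * h := (div_le_iff₀ hh).1 (Nat.le_ceil _)
  have h4 : ⌈s / h⌉₊ * h < s + h := by
    have := mul_lt_mul_of_pos_right (Nat.ceil_lt_add_one hs0) hh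
    rwa [add_mul, div_mul_cancel₀ _ hh.ne', one_mul] at this
  have hex : ∃ k : ℕ, w.start ≤ k * h ∧ Idle ν (k * h) w := by
    refine ⟨⌈s / h⌉₊, hs1.trans h3, ?_⟩
    have := hd (⌈s / h⌉₊ * h - s) (by linarith) (by linarith)
    rwa [add_sub_cancel] at this
  refine ⟨Nat.find hex, ⟨Nat.find_spec hex, fun l hl => Nat.find_min hex hl⟩, ?_⟩
  have h5 : (Nat.find hex : ℝ) ≤ ⌈s / h⌉₊ := by
    refine Nat.cast_le.2 (Nat.find_min' hex ⟨hs1.trans h3, ?_⟩)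
    have := hd (⌈s / h⌉₊ * h - s) (by linarith) (by linarith)
    rwa [add_sub_cancel] at this
  have h6 : (Nat.find hex : ℝ) * h ≤ ⌈s / h⌉₊ * h := by gcongr
  linarith

variable {lam : ι → ℝ} {m : ι → Measure Mark} [∀ i, IsProbabilityMeasure (m i)]

/-- Regeneration at a deterministic grid point. -/
lemma law_gridIdle_inter_idle (hlam : ∀ i, 0 < lam i) (hν : 0 ≤ ν) (hh : 0 ≤ h)
    (hkt : k * h ≤ t) :
    law lam m (gridIdle ι ν h k ∩ {w | Idle ν t w}) =
      law lam m (gridIdle ι ν h k) * law lam m {w | Idle ν (t - k * h) w} := by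
  rw [← law_inter_shift hlam hν (t := k * h) (by positivity) (measurableSet_gridIdle ν h k)
    (measurableSet_idle ν _) fun w hw => past_mem_gridIdle hw hν hh]
  refine measure_congr ?_
  filter_upwards [ae_isProper hlam] with w hw
  refine propext (and_congr_right fun hk => ?_)
  have := idle_shift hw hν (sub_nonneg.2 hkt) hk.1.2
  rw [add_sub_cancel] at this
  exact this.symm

open Classical in
/-- Renewal equation for the probability of an empty system. -/
theorem law_real_idle_renewal (hlam : ∀ i, 0 < lam i) (hν : 0 ≤ ν)
    (hP : ContinuousOn (fun t => (law lam m).real {w | Idle ν t w}) (Ici 0)) (ht : 0 < t)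
    (hct : law lam m {w | cycle ν w = ENNReal.ofReal t} = 0) :
    (law lam m).real {w | Idle ν t w} = Real.exp (-((∑ i, lam i) * t)) +
      ∫ w, (if cycle ν w ≤ ENNReal.ofReal t then
        (law lam m).real {w' | Idle ν (t - (cycle ν w).toReal) w'} else 0) ∂(law lam m) := by
  have hprob := isProbabilityMeasure_law hlam (m := m)
  set μ := law lam m with hμ
  let P : ℝ → ℝ := fun t => μ.real {w | Idle ν t w}
  let e : ℕ → ℝ := fun n => 1 / ((n : ℝ) + 1)
  have he : ∀ n, 0 < e n := fun n => by positivity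
  have he0 : Tendsto e atTop (𝓝 0) := tendsto_one_div_add_atTop_nhds_zero_nat
  -- On the event that the first empty grid point is `l h`, `ψ` records whether the system is empty
  -- at `t`, and `φ` replaces this by its conditional probability `P(t - l h)`.
  let φ : ℕ → World ι → ℝ := fun n w => ∑ l ∈ Finset.range (⌊t / e n⌋₊ + 1),
    (gridIdle ι ν (e n) l).indicator (fun _ => P (t - l * e n)) w
  let ψ : ℕ → World ι → ℝ := fun n w => ∑ l ∈ Finset.range (⌊t / e n⌋₊ + 1),
    (gridIdle ι ν (e n) l).indicator ({w | Idle ν t w}.indicator fun _ => 1) w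
  have hP0 : ∀ t, 0 ≤ P t := fun t => measureReal_nonneg
  have hP1 : ∀ t, P t ≤ 1 := fun t => measureReal_le_one
  have hbound : ∀ (f : ℕ → World ι → ℝ) n w, (∀ l w, ‖f l w‖ ≤ 1) →
      ‖∑ l ∈ Finset.range (⌊t / e n⌋₊ + 1), (gridIdle ι ν (e n) l).indicator (f l) w‖ ≤ 1 := by
    intro f n w hf
    by_cases hk : ∃ k : ℕ, k * e n ≤ t ∧ w ∈ gridIdle ι ν (e n) k
    · obtain ⟨k, hk1, hk2⟩ := hk
      rw [sum_indicator_gridIdle (he n) hk2 hk1]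
      exact hf k w
    · push Not at hk
      rw [sum_indicator_gridIdle_eq_zero (he n) ht.le hk]
      simp
  have hψ1 : ∀ w : World ι, ‖({w | Idle ν t w}.indicator (fun _ => (1 : ℝ))) w‖ ≤ 1 := fun w => by
    by_cases hw : Idle ν t w <;> simp [hw]
  have hφm : ∀ n, Measurable (φ n) := fun n => Finset.measurable_sum _ fun l _ =>
    measurable_const.indicator (measurableSet_gridIdle ν _ l)
  have hψm : ∀ n, Measurable (ψ n) := fun n => Finset.measurable_sum _ fun l _ =>
    (measurable_const.indicator (measurableSet_idle ν t)).indicator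
      (measurableSet_gridIdle ν _ l)
  -- Equality holds term by term, by regeneration at `l h`.
  have hint : ∀ n, ∫ w, φ n w ∂μ = ∫ w, ψ n w ∂μ := fun n => by
    simp only [φ, ψ]
    rw [integral_finsetSum, integral_finsetSum]
    · refine Finset.sum_congr rfl fun l hl => ?_
      have hl' := mul_le_of_mem_range_floor (he n) ht.le hl
      rw [integral_indicator_const _ (measurableSet_gridIdle ν _ l), indicator_indicator,
        integral_indicator_const _ ((measurableSet_gridIdle ν _ l).inter (measurableSet_idle ν t))]
      simp only [smul_eq_mul, mul_one, P, measureReal_def, ← ENNReal.toReal_mul]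
      rw [hμ, law_gridIdle_inter_idle hlam hν (he n).le hl']
    · exact fun l _ => (integrable_const _).indicator (measurableSet_gridIdle ν _ l) |>.mono'
        ((measurable_const.indicator (measurableSet_idle ν t)).indicator
          (measurableSet_gridIdle ν _ l)).aestronglyMeasurable
        (Eventually.of_forall fun w => by
          by_cases hw : w ∈ gridIdle ι ν (e n) l
          · rw [indicator_of_mem hw, indicator_of_mem hw]; exact hψ1 w
          · rw [indicator_of_notMem hw, indicator_of_notMem hw]; simp)
    · exact fun l _ => (integrable_const _).indicator (measurableSet_gridIdle ν _ l)
  have hlimφ : ∀ᵐ w ∂μ, Tendsto (fun n => φ n w) atTop (𝓝 (if cycle ν w ≤ ENNReal.ofReal t then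
      P (t - (cycle ν w).toReal) else 0)) ∧ Tendsto (fun n => ψ n w) atTop
        (𝓝 ({w | Idle ν t w ∧ w.start ≤ t}.indicator (fun _ => 1) w)) := by
    have hne : ∀ᵐ w ∂μ, cycle ν w ≠ ENNReal.ofReal t := by
      rw [ae_iff]; simpa using hct
    filter_upwards [ae_isProper hlam, hne] with w hw hwt
    have hT := start_pos hw
    rcases lt_or_gt_of_ne hwt with hlt | hgt
    · have hfin : cycle ν w ≠ ⊤ := (hlt.trans ENNReal.ofReal_lt_top).ne
      set c := (cycle ν w).toReal with hc
      have hcc : cycle ν w = ENNReal.ofReal c := (ENNReal.ofReal_toReal hfin).symm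
      have hct : c < t := by
        rw [hcc] at hlt
        exact (ENNReal.ofReal_lt_ofReal_iff ht).1 hlt
      have hc0 : 0 ≤ c := ENNReal.toReal_nonneg
      -- The first empty grid points converge to the end of the cycle, never from below.
      have hgrid : ∀ ε > 0, ∀ᶠ n in atTop, ∃ k : ℕ, w ∈ gridIdle ι ν (e n) k ∧
          c ≤ k * e n ∧ k * e n < c + ε := by
        intro ε hε
        have : cycle ν w < ENNReal.ofReal (c + ε) := by
          rw [hcc]; exact (ENNReal.ofReal_lt_ofReal_iff (by linarith)).2 (by linarith)
        obtain ⟨δ, hδ, hd⟩ := exists_mem_gridIdle hw hν this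
        filter_upwards [he0.eventually (gt_mem_nhds hδ)] with n hn
        obtain ⟨k, hk1, hk2⟩ := hd (e n) (he n) hn
        refine ⟨k, hk1, ?_, hk2⟩
        have := cycle_le_of_mem_gridIdle hw hk1
        rw [hcc] at this
        have hn0 : 0 ≤ k * e n := mul_nonneg k.cast_nonneg (he n).le
        exact (ENNReal.ofReal_le_ofReal_iff hn0).1 this
      constructor
      · rw [if_pos hlt.le]
        refine Metric.tendsto_nhds.2 fun ε hε => ?_
        have hcont : ContinuousWithinAt P (Ici 0) (t - c) := hP _ (by simp; linarith)
        obtain ⟨δ, hδ, hd⟩ := Metric.continuousWithinAt_iff.1 hcont ε hε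
        filter_upwards [hgrid (min δ (t - c)) (lt_min hδ (by linarith))] with n ⟨k, hk1, hk2, hk3⟩
        have h1 := min_le_left δ (t - c)
        have h2 := min_le_right δ (t - c)
        have h3 : φ n w = P (t - k * e n) :=
          sum_indicator_gridIdle (he n) hk1 (by linarith)
        rw [h3]
        refine hd (by simp; linarith) ?_
        rw [Real.dist_eq, abs_lt]
        constructor <;> linarith
      · refine tendsto_const_nhds.congr' ?_
        filter_upwards [hgrid (t - c) (by linarith)] with n ⟨k, hk1, hk2, hk3⟩
        have h3 : ψ n w = {w | Idle ν t w}.indicator (fun _ => 1) w :=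
          sum_indicator_gridIdle (he n) hk1 (by linarith)
        rw [h3]
        have hst : w.start ≤ t := by
          have : w.start ≤ k * e n := hk1.1.1
          linarith
        simp [indicator, hst]
    -- If the cycle lasts beyond `t`, both sums vanish for every mesh. The case of a cycle ending
    -- exactly at `t` is null by assumption.
    · have hno : ¬ (Idle ν t w ∧ w.start ≤ t) := fun hi =>
        absurd (cycle_le hT.le hi.2 hi.1) (not_le.2 hgt)
      have hno' : ∀ n (k : ℕ), k * e n ≤ t → w ∉ gridIdle ι ν (e n) k := fun n k hk hmem =>
        absurd ((cycle_le_of_mem_gridIdle hw hmem).trans (ENNReal.ofReal_le_ofReal hk))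
          (not_le.2 hgt)
      have h1 : ∀ n, φ n w = 0 := fun n => sum_indicator_gridIdle_eq_zero (he n) ht.le (hno' n)
      have h2 : ∀ n, ψ n w = 0 := fun n => sum_indicator_gridIdle_eq_zero (he n) ht.le (hno' n)
      rw [if_neg (not_le.2 hgt), indicator_of_notMem (by exact hno)]
      simp [h1, h2]
  have l1 := tendsto_integral_of_dominated_convergence (fun _ => (1 : ℝ))
    (fun n => (hφm n).aestronglyMeasurable) (integrable_const _)
    (fun n => Eventually.of_forall fun w => hbound _ n w fun l w => by
      rw [Real.norm_of_nonneg (hP0 _)]; exact hP1 _) (hlimφ.mono fun w hw => hw.1)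
  have l2 := tendsto_integral_of_dominated_convergence (fun _ => (1 : ℝ))
    (fun n => (hψm n).aestronglyMeasurable) (integrable_const _)
    (fun n => Eventually.of_forall fun w => hbound _ n w fun l w => hψ1 w)
    (hlimφ.mono fun w hw => hw.2)
  have l3 := tendsto_nhds_unique (l1.congr hint) l2
  have hlast : MeasurableSet {w : World ι | Idle ν t w ∧ w.start ≤ t} :=
    (measurableSet_idle ν t).inter (measurableSet_le measurable_start measurable_const)
  rw [integral_indicator_const _ hlast, smul_eq_mul, mul_one] at l3
  have hsplit : μ.real {w | Idle ν t w} =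
      μ.real {w | Idle ν t w ∧ w.start ≤ t} + μ.real {w | t < w.start} := by
    have hd : Disjoint {w : World ι | Idle ν t w ∧ w.start ≤ t} {w | t < w.start} :=
      disjoint_left.2 fun w hw hw' => absurd hw.2 (not_le.2 hw')
    rw [← measureReal_union hd (measurableSet_lt measurable_const measurable_start)]
    refine measureReal_congr ?_
    filter_upwards [ae_isProper hlam] with w hw
    refine propext ⟨fun hi => ?_, fun hi => ?_⟩
    · rcases le_or_gt w.start t with h1 | h1
      · exact .inl ⟨hi, h1⟩
      · exact .inr h1
    · rcases hi with hi | hi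
      · exact hi.1
      · exact idle_of_lt_start hw hi
  have hstart : μ.real {w | t < w.start} = Real.exp (-((∑ i, lam i) * t)) := by
    rw [measureReal_def, hμ, law_lt_start hlam ht.le, ENNReal.toReal_ofReal (Real.exp_pos _).le]
  rw [hsplit, hstart, add_comm, ← l3]

end World

/-! ### Laplace transforms of functions and of laws on `[0, ∞]` -/

section Transforms

variable {Ω : Type*} [MeasurableSpace Ω] {P : Measure Ω} {s : ℂ}

open Classical in
/-- The integrand of the Laplace–Stieltjes transform. -/
def lstKernel (s : ℂ) (y : ℝ≥0∞) : ℂ := if y = ⊤ then 0 else Complex.exp (-s * (y.toReal : ℂ))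

lemma lstKernel_top (s : ℂ) : lstKernel s ⊤ = 0 := if_pos rfl

lemma lstKernel_of_ne_top {y : ℝ≥0∞} (hy : y ≠ ⊤) :
    lstKernel s y = Complex.exp (-s * (y.toReal : ℂ)) := if_neg hy

lemma measurable_lstKernel (s : ℂ) : Measurable (lstKernel s) := by
  classical
  refine Measurable.ite (measurableSet_singleton _) measurable_const ?_
  have : Measurable fun y : ℝ≥0∞ => ((y.toReal : ℝ) : ℂ) :=
    Complex.measurable_ofReal.comp ENNReal.measurable_toReal
  exact Complex.measurable_exp.comp (this.const_mul (-s))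

lemma norm_lstKernel_le (hs : 0 < s.re) (y : ℝ≥0∞) : ‖lstKernel s y‖ ≤ 1 := by
  unfold lstKernel
  split_ifs
  · simp
  · rw [Complex.norm_exp, Real.exp_le_one_iff]
    simp only [neg_mul, Complex.neg_re, Complex.re_mul_ofReal]
    have : 0 ≤ y.toReal := ENNReal.toReal_nonneg
    nlinarith

lemma lst_eq (P : Measure Ω) (Y : Ω → ℝ≥0∞) (s : ℂ) : lst P Y s = ∫ ω, lstKernel s (Y ω) ∂P := rfl

lemma lst_congr {Y Y' : Ω → ℝ≥0∞} (h : Y =ᵐ[P] Y') : lst P Y s = lst P Y' s :=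
  integral_congr_ae (h.fun_comp (lstKernel s))

lemma integrable_lstKernel [IsFiniteMeasure P] (hs : 0 < s.re) {Y : Ω → ℝ≥0∞}
    (hY : AEMeasurable Y P) : Integrable (fun ω => lstKernel s (Y ω)) P :=
  (integrable_const (1 : ℝ)).mono' ((measurable_lstKernel s).comp_aemeasurable hY).aestronglyMeasurable
    (Filter.Eventually.of_forall fun _ => norm_lstKernel_le hs _)

lemma norm_exp_neg_mul_ofReal (s : ℂ) (t : ℝ) :
    ‖Complex.exp (-s * t)‖ = Real.exp (-s.re * t) := by
  rw [Complex.norm_exp]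
  simp

lemma integrableOn_exp_neg_mul (hs : 0 < s.re) :
    IntegrableOn (fun t : ℝ => Real.exp (-s.re * t)) (Ioi 0) :=
  integrableOn_exp_mul_Ioi (by linarith) 0

lemma integrableOn_laplace (hs : 0 < s.re) {f : ℝ → ℝ} (hf : Measurable f) (hf1 : ∀ t, |f t| ≤ 1) :
    IntegrableOn (fun t : ℝ => Complex.exp (-s * t) * (f t : ℂ)) (Ioi 0) := by
  refine (integrableOn_exp_neg_mul hs).mono' (Measurable.aestronglyMeasurable (by fun_prop))
    (Filter.Eventually.of_forall fun t => ?_)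
  rw [norm_mul, norm_exp_neg_mul_ofReal, Complex.norm_real]
  exact mul_le_of_le_one_right (Real.exp_pos _).le (hf1 t)

lemma laplace_congr {f g : ℝ → ℝ} (h : ∀ᵐ t, 0 < t → f t = g t) : laplace f s = laplace g s := by
  refine setIntegral_congr_ae measurableSet_Ioi ?_
  filter_upwards [h] with t ht h0
  rw [ht h0]

lemma laplace_exp_neg (hs : 0 < s.re) {r : ℝ} (hr : 0 ≤ r) :
    laplace (fun t => Real.exp (-(r * t))) s = 1 / (r + s) := by
  have h1 : ∀ t : ℝ, Complex.exp (-s * t) * ((Real.exp (-(r * t)) : ℝ) : ℂ) =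
      Complex.exp (-(r + s) * t) := fun t => by
    rw [Complex.ofReal_exp, ← Complex.exp_add]
    congr 1
    push_cast
    ring
  have h2 : (-(r + s) : ℂ).re < 0 := by simp; linarith
  simp_rw [laplace, h1]
  rw [integral_exp_mul_complex_Ioi h2]
  have h3 : (r + s : ℂ) ≠ 0 := fun h => by simp [h] at h2
  field_simp
  simp

open Classical in
/-- Laplace transform of the convolution with a distribution on `[0, ∞]`. -/
lemma laplace_convolution [IsProbabilityMeasure P] (hs : 0 < s.re) {Y : Ω → ℝ≥0∞}
    (hY : Measurable Y) {f : ℝ → ℝ} (hf : Measurable f) (hf1 : ∀ t, |f t| ≤ 1) :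
    laplace (fun t => ∫ ω, (if Y ω ≤ ENNReal.ofReal t then f (t - (Y ω).toReal) else 0) ∂P) s =
      lst P Y s * laplace f s := by
  let g : ℝ → Ω → ℝ := fun t ω => if Y ω ≤ ENNReal.ofReal t then f (t - (Y ω).toReal) else 0
  have hg : Measurable fun p : ℝ × Ω => g p.1 p.2 := by
    refine Measurable.ite (measurableSet_le (hY.comp measurable_snd)
      (ENNReal.measurable_ofReal.comp measurable_fst)) (hf.comp ?_) measurable_const
    exact measurable_fst.sub (ENNReal.measurable_toReal.comp (hY.comp measurable_snd))
  have hg1 : ∀ t ω, |g t ω| ≤ 1 := fun t ω => by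
    simp only [g]
    split_ifs
    · exact hf1 _
    · simp
  have hint : Integrable (fun p : ℝ × Ω => Complex.exp (-s * p.1) * (g p.1 p.2 : ℂ))
      ((volume.restrict (Ioi 0)).prod P) := by
    have h1 : Integrable (fun p : ℝ × Ω => Real.exp (-s.re * p.1))
        ((volume.restrict (Ioi 0)).prod P) :=
      Integrable.comp_fst (integrableOn_exp_neg_mul hs) P
    refine h1.mono' (Measurable.aestronglyMeasurable ?_) (Filter.Eventually.of_forall fun p => ?_)
    · exact Measurable.mul (by fun_prop) (Complex.measurable_ofReal.comp hg)
    · rw [norm_mul, norm_exp_neg_mul_ofReal, Complex.norm_real]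
      exact mul_le_of_le_one_right (Real.exp_pos _).le (hg1 _ _)
  have h2 : laplace (fun t => ∫ ω, g t ω ∂P) s =
      ∫ t in Ioi (0 : ℝ), ∫ ω, Complex.exp (-s * t) * (g t ω : ℂ) ∂P := by
    refine integral_congr_ae (Filter.Eventually.of_forall fun t => ?_)
    simp only
    rw [integral_const_mul, integral_complex_ofReal]
  change laplace (fun t => ∫ ω, g t ω ∂P) s = _
  rw [h2, integral_integral_swap hint, lst_eq, ← integral_mul_const]
  refine integral_congr_ae (Filter.Eventually.of_forall fun ω => ?_)
  simp only [lstKernel, g]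
  split_ifs with h
  · simp [h]
  · set c := (Y ω).toReal with hc
    have hc0 : 0 ≤ c := ENNReal.toReal_nonneg
    have hY : Y ω = ENNReal.ofReal c := (ENNReal.ofReal_toReal h).symm
    rw [hY, laplace, ← integral_const_mul, ← integral_indicator measurableSet_Ioi,
      ← integral_indicator measurableSet_Ioi]
    rw [← integral_sub_right_eq_self ((Ioi (0 : ℝ)).indicator fun t : ℝ =>
      Complex.exp (-s * c) * (Complex.exp (-s * t) * (f t : ℂ))) c]
    refine integral_congr_ae ?_
    -- At `t = c` the left-hand integrand carries `f 0`, whereas the shifted half-line is open; one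
    -- point is negligible.
    have hne : ∀ᵐ t : ℝ, t ≠ c := by simp [ae_iff, measure_singleton]
    filter_upwards [hne] with t ht
    by_cases h0 : c < t
    · have h1 : t ∈ Ioi (0 : ℝ) := hc0.trans_lt h0
      have h3 : t - c ∈ Ioi (0 : ℝ) := sub_pos.2 h0
      rw [indicator_of_mem h1, indicator_of_mem h3, if_pos (ENNReal.ofReal_le_ofReal h0.le),
        ← mul_assoc, ← Complex.exp_add]
      congr 2
      push_cast
      ring
    · have h3 : t - c ∉ Ioi (0 : ℝ) := by simpa using h0
      have h4 : t < c := lt_of_le_of_ne (not_lt.1 h0) ht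
      rw [indicator_of_notMem h3]
      by_cases h1 : t ∈ Ioi (0 : ℝ)
      · rw [indicator_of_mem h1, if_neg]
        · simp
        · rw [not_le]
          exact (ENNReal.ofReal_lt_ofReal_iff (lt_trans h1 h4)).2 h4
      · rw [indicator_of_notMem h1]

/-- `1 - s ∫_0^T e^{-st} dt = e^{-sT}`. -/
lemma exp_neg_mul_eq (hs : 0 < s.re) {T : ℝ} (hT : 0 ≤ T) :
    Complex.exp (-s * T) =
      1 - s * ∫ t in Ioi (0 : ℝ), Complex.exp (-s * t) * (Iio T).indicator 1 t := by
  have hs0 : s ≠ 0 := fun h => by simp [h] at hs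
  have h1 : ∫ t in Ioi (0 : ℝ), Complex.exp (-s * t) * (Iio T).indicator 1 t =
      ∫ t in (0 : ℝ)..T, Complex.exp (-s * t) := by
    rw [intervalIntegral.integral_of_le hT, ← integral_Ioc_eq_integral_Ioo.symm,
      ← integral_indicator measurableSet_Ioi, ← integral_indicator measurableSet_Ioo]
    refine integral_congr_ae (Filter.Eventually.of_forall fun t => ?_)
    by_cases h1 : 0 < t <;> by_cases h2 : t < T <;> simp [indicator, h1, h2]
  rw [h1, integral_exp_mul_complex (neg_ne_zero.2 hs0)]
  field_simp
  simp

end Transforms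

/-! ### Transforms and finiteness of the busy period -/

namespace World

open Filter Topology

variable {ι : Type*} [Fintype ι] [Nonempty ι] {ν t : ℝ} {s : ℂ} {lam : ι → ℝ}
  {m : ι → Measure Mark} [∀ i, IsProbabilityMeasure (m i)]

/-- The busy period is independent of the preceding idle period. -/
lemma setIntegral_lstKernel_busy (hlam : ∀ i, 0 < lam i) (hν : 0 ≤ ν) (ht : 0 ≤ t) (s : ℂ) :
    ∫ w in {w | t < w.start}, lstKernel s (busy ν w) ∂(law lam m) =
      Real.exp (-((∑ i, lam i) * t)) * lst (law lam m) (busy ν) s := by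
  have hprob := isProbabilityMeasure_law hlam (m := m)
  have hb := aemeasurable_busy hlam hν (m := m)
  set Y := hb.mk _ with hY
  have hYm : Measurable Y := hb.measurable_mk
  have hYe : busy ν =ᵐ[law lam m] Y := hb.ae_eq_mk
  have hS : MeasurableSet {w : World ι | t < w.start} :=
    measurableSet_lt measurable_const measurable_start
  -- On `{t < start}`, an event of the past, the busy period is that of the shifted world, which is
  -- independent of the past and has the same law.
  have hmap : ((law lam m).restrict {w | t < w.start}).map Y =
      law lam m {w | t < w.start} • (law lam m).map Y := by
    refine Measure.ext fun A hA => ?_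
    rw [Measure.map_apply hYm hA, Measure.restrict_apply (hYm hA), Measure.smul_apply,
      Measure.map_apply hYm hA, smul_eq_mul, ← law_inter_shift hlam hν ht hS (hYm hA)
        fun w hw => lt_start_past hw ht le_rfl, inter_comm]
    refine measure_congr ?_
    filter_upwards [ae_isProper hlam, hYe,
      (measurePreserving_shift hlam hν ht).quasiMeasurePreserving.ae hYe] with w hw h1 h2
    refine propext (and_congr_right fun h3 => ?_)
    have h4 : Y w = Y (w.shift ν t) := by rw [← h1, ← h2, busy_shift hw hν h3]
    change Y w ∈ A ↔ Y (w.shift ν t) ∈ A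
    rw [h4]
  have hK := (measurable_lstKernel s).aestronglyMeasurable (μ := (law lam m).map Y)
  have hK' := (measurable_lstKernel s).aestronglyMeasurable
    (μ := ((law lam m).restrict {w | t < w.start}).map Y)
  calc ∫ w in {w | t < w.start}, lstKernel s (busy ν w) ∂(law lam m)
      = ∫ w in {w | t < w.start}, lstKernel s (Y w) ∂(law lam m) :=
        integral_congr_ae (ae_restrict_of_ae (hYe.fun_comp (lstKernel s)))
    _ = ∫ y, lstKernel s y ∂((law lam m).restrict {w | t < w.start}).map Y :=
        (integral_map hYm.aemeasurable hK').symm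
    _ = Real.exp (-((∑ i, lam i) * t)) * ∫ w, lstKernel s (Y w) ∂(law lam m) := by
        rw [hmap, integral_smul_measure, integral_map hYm.aemeasurable hK, law_lt_start hlam ht,
          ENNReal.toReal_ofReal (Real.exp_pos _).le, Complex.real_smul]
    _ = _ := by rw [lst_congr hYe]; rfl

/-- With `T` the idle period, `e^{-sT} = 1 - s ∫_0^T e^{-st} dt`. Multiplied by the kernel of the
busy period and integrated, this reduces by Fubini to `setIntegral_lstKernel_busy` for each `t`, and
leaves the factor `1 - s/(Λ+s)`. -/
lemma lst_cycle (hlam : ∀ i, 0 < lam i) (hν : 0 ≤ ν) (hs : 0 < s.re) :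
    lst (law lam m) (cycle ν) s =
      (∑ i, lam i : ℝ) / ((∑ i, lam i : ℝ) + s) * lst (law lam m) (busy ν) s := by
  have hprob := isProbabilityMeasure_law hlam (m := m)
  have hb := aemeasurable_busy hlam hν (m := m)
  set Λ : ℝ := ∑ i, lam i with hΛ
  have hΛ0 : 0 ≤ Λ := Finset.sum_nonneg fun i _ => (hlam i).le
  set μ := law lam m with hμ
  let Z : World ι → ℂ := fun w => lstKernel s (busy ν w)
  have hZi : Integrable Z μ := integrable_lstKernel hs hb
  have hS : MeasurableSet {p : World ι × ℝ | p.2 < p.1.start} :=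
    measurableSet_lt measurable_snd (measurable_start.comp measurable_fst)
  let g : World ι → ℝ → ℂ := fun w t => Complex.exp (-s * t) * (Iio w.start).indicator 1 t * Z w
  have hgi : Integrable (fun p : World ι × ℝ => g p.1 p.2) (μ.prod (volume.restrict (Ioi 0))) := by
    have h1 := hZi.mul_prod (ν := volume.restrict (Ioi (0 : ℝ)))
      (g := fun t : ℝ => (Real.exp (-s.re * t) : ℂ)) (integrableOn_exp_neg_mul hs).ofReal
    have h2 : Measurable fun p : World ι × ℝ => (Iio p.1.start).indicator (1 : ℝ → ℂ) p.2 :=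
      measurable_one.indicator hS
    refine h1.mono (.mul (.mul (Measurable.aestronglyMeasurable (by fun_prop))
      h2.aestronglyMeasurable) hZi.aestronglyMeasurable.comp_fst) (Eventually.of_forall fun p => ?_)
    simp only [g, norm_mul, norm_exp_neg_mul_ofReal, Complex.norm_real, Real.norm_eq_abs,
      Real.abs_exp]
    rw [mul_comm ‖Z p.1‖]
    refine mul_le_mul_of_nonneg_right (mul_le_of_le_one_right (Real.exp_pos _).le ?_)
      (norm_nonneg _)
    by_cases h : p.2 < p.1.start <;> simp [h]
  have h1 : ∀ᵐ w ∂μ, lstKernel s (cycle ν w) = Z w - s * ∫ t in Ioi (0 : ℝ), g w t := by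
    filter_upwards [ae_isProper hlam] with w hw
    have hT := (start_pos hw).le
    simp only [g]
    rw [integral_mul_const, ← mul_assoc]
    have h2 := exp_neg_mul_eq hs hT
    have h3 : lstKernel s (cycle ν w) = Complex.exp (-s * w.start) * Z w := by
      simp only [Z]
      by_cases hbt : busy ν w = ⊤
      · rw [cycle, hbt, add_top, lstKernel_top, mul_zero]
      · have hct : cycle ν w ≠ ⊤ := ENNReal.add_ne_top.2 ⟨ENNReal.ofReal_ne_top, hbt⟩
        rw [lstKernel_of_ne_top hbt, lstKernel_of_ne_top hct, cycle,
          ENNReal.toReal_add ENNReal.ofReal_ne_top hbt, ENNReal.toReal_ofReal hT, ← Complex.exp_add]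
        congr 1
        push_cast
        ring
    rw [h3, h2]
    ring
  have h2 : ∀ t ∈ Ioi (0 : ℝ), ∫ w, g w t ∂μ =
      Complex.exp (-s * t) * (Real.exp (-(Λ * t)) : ℝ) * lst μ (busy ν) s := fun t ht => by
    have h3 : ∀ w, g w t = Complex.exp (-s * t) * {w : World ι | t < w.start}.indicator Z w :=
      fun w => by by_cases h : t < w.start <;> simp [g, h]
    simp_rw [h3]
    rw [integral_const_mul, integral_indicator (measurableSet_lt measurable_const measurable_start),
      setIntegral_lstKernel_busy hlam hν (le_of_lt ht), mul_assoc]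
  have hne : (Λ + s : ℂ) ≠ 0 := fun h => by
    have := congrArg Complex.re h
    simp at this
    linarith
  rw [lst_eq, integral_congr_ae h1, integral_sub hZi (hgi.integral_prod_left.const_mul s),
    integral_const_mul, integral_integral_swap hgi, setIntegral_congr_fun measurableSet_Ioi h2,
    integral_mul_const]
  have h3 := laplace_exp_neg hs hΛ0
  rw [laplace] at h3
  rw [h3]
  change lst μ (busy ν) s - _ = _
  field_simp
  ring

/-- The transforms of the busy period and the busy cycle, in terms of the probability of an empty
system. -/
theorem transforms (hlam : ∀ i, 0 < lam i) (hν : 0 ≤ ν)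
    (hP : ContinuousOn (fun t => (law lam m).real {w | Idle ν t w}) (Ici 0)) (hs : 0 < s.re) :
    laplace (fun t => (law lam m).real {w | Idle ν t w}) s ≠ 0 ∧
    lst (law lam m) (busy ν) s = 1 + ((∑ i, lam i : ℝ) : ℂ)⁻¹ *
      (s - 1 / laplace (fun t => (law lam m).real {w | Idle ν t w}) s) ∧
    lst (law lam m) (cycle ν) s = 1 - 1 / (((∑ i, lam i : ℝ) + s) *
      laplace (fun t => (law lam m).real {w | Idle ν t w}) s) := by
  classical
  have hprob := isProbabilityMeasure_law hlam (m := m)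
  have hcm := aemeasurable_cycle hlam hν (m := m)
  have hlc := lst_cycle (m := m) hlam hν hs
  have hΛ0 : 0 < ∑ i, lam i := Finset.sum_pos (fun i _ => hlam i) Finset.univ_nonempty
  set Λ : ℝ := ∑ i, lam i with hΛ
  set P : ℝ → ℝ := fun t => (law lam m).real {w | Idle ν t w} with hPdef
  have hPm : Measurable P :=
    (measurable_measure_prodMk_left (measurableSet_idle_prod ν)).ennreal_toReal
  have hP1 : ∀ t, |P t| ≤ 1 := fun t => by
    rw [abs_of_nonneg measureReal_nonneg]; exact measureReal_le_one
  set Y := hcm.mk _ with hY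
  have hYm : Measurable Y := hcm.measurable_mk
  have hYe : cycle ν =ᵐ[law lam m] Y := hcm.ae_eq_mk
  let f : ℝ → ℝ := fun t => ∫ w, (if Y w ≤ ENNReal.ofReal t then P (t - (Y w).toReal) else 0)
    ∂(law lam m)
  -- The law of the cycle has at most countably many atoms, so the renewal equation holds for almost
  -- every `t`, which is all that a Laplace transform sees.
  have hatom : ∀ᵐ t : ℝ, 0 < t → law lam m {w | Y w = ENNReal.ofReal t} = 0 := by
    have h1 : Set.Countable {y : ℝ≥0∞ | 0 < law lam m {w | Y w = y}} :=
      Measure.countable_meas_level_set_pos hYm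
    have h3 : {t : ℝ | 0 < t ∧ 0 < law lam m {w | Y w = ENNReal.ofReal t}}.Countable := by
      refine (h1.image ENNReal.toReal).mono ?_
      rintro t ⟨h0, ht⟩
      exact ⟨ENNReal.ofReal t, ht, ENNReal.toReal_ofReal h0.le⟩
    filter_upwards [h3.ae_notMem volume] with t ht h0
    by_contra hne
    exact ht ⟨h0, pos_iff_ne_zero.2 hne⟩
  have hren : ∀ᵐ t : ℝ, 0 < t → P t = Real.exp (-(Λ * t)) + f t := by
    filter_upwards [hatom] with t ht h0
    have h1 : law lam m {w | cycle ν w = ENNReal.ofReal t} = 0 := by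
      rw [← ht h0]
      refine measure_congr ?_
      filter_upwards [hYe] with w hw
      change (cycle ν w = _) = (Y w = _)
      rw [hw]
    refine (law_real_idle_renewal hlam hν hP h0 h1).trans ?_
    congr 1
    refine integral_congr_ae ?_
    filter_upwards [hYe] with w hw
    simp only [hw]
    rfl
  have hfm : Measurable f := by
    have : Measurable fun p : ℝ × World ι =>
        if Y p.2 ≤ ENNReal.ofReal p.1 then P (p.1 - (Y p.2).toReal) else 0 := by
      refine Measurable.ite (measurableSet_le (hYm.comp measurable_snd)
        (ENNReal.measurable_ofReal.comp measurable_fst)) (hPm.comp ?_) measurable_const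
      exact measurable_fst.sub (ENNReal.measurable_toReal.comp (hYm.comp measurable_snd))
    exact (this.stronglyMeasurable.integral_prod_right (ν := law lam m)).measurable
  have hf1 : ∀ t, |f t| ≤ 1 := fun t => by
    have := norm_integral_le_of_norm_le_const (μ := law lam m) (C := 1)
      (f := fun w => if Y w ≤ ENNReal.ofReal t then P (t - (Y w).toReal) else 0)
      (Eventually.of_forall fun w => by
        split_ifs
        · exact hP1 _
        · simp)
    simpa using this
  have hL : laplace P s = 1 / (Λ + s) + lst (law lam m) (cycle ν) s * laplace P s := by
    conv_lhs => rw [laplace_congr hren]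
    rw [lst_congr hYe, ← laplace_convolution hs hYm hPm hP1, ← laplace_exp_neg hs hΛ0.le, laplace,
      laplace, laplace]
    have hexp : Measurable fun t : ℝ => Real.exp (-(Λ * t)) := by fun_prop
    have hi : IntegrableOn (fun t : ℝ => Complex.exp (-s * t) * (Real.exp (-(Λ * t)) : ℝ))
        (Ioi 0) := by
      refine (integrableOn_exp_neg_mul hs).mono' (Measurable.aestronglyMeasurable (by fun_prop)) ?_
      refine (ae_restrict_iff' measurableSet_Ioi).2 (Eventually.of_forall fun t ht => ?_)
      have ht' : 0 < t := ht
      rw [norm_mul, norm_exp_neg_mul_ofReal, Complex.norm_real, Real.norm_of_nonneg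
        (Real.exp_pos _).le]
      refine mul_le_of_le_one_right (Real.exp_pos _).le (Real.exp_le_one_iff.2 ?_)
      have := mul_pos hΛ0 ht'
      linarith
    rw [← integral_add hi (integrableOn_laplace hs hfm hf1)]
    refine integral_congr_ae (Eventually.of_forall fun t => ?_)
    simp only
    push_cast
    ring
  have hne : (Λ + s : ℂ) ≠ 0 := fun h => by
    have := congrArg Complex.re h
    simp at this
    linarith
  have hΛc : (Λ : ℂ) ≠ 0 := by exact_mod_cast hΛ0.ne'
  -- A zero of the transform would reduce the renewal equation to `0 = 1/(Λ+s)`.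
  have hL0 : laplace P s ≠ 0 := fun h => by
    rw [h, mul_zero, add_zero] at hL
    exact one_div_ne_zero hne hL.symm
  have hcyc : lst (law lam m) (cycle ν) s = 1 - 1 / ((Λ + s) * laplace P s) := by
    have h1 : lst (law lam m) (cycle ν) s * laplace P s = laplace P s - 1 / (Λ + s) := by
      linear_combination -hL
    rw [eq_sub_iff_add_eq, ← mul_left_inj' hL0, add_mul, h1]
    field_simp
    ring
  refine ⟨hL0, ?_, hcyc⟩
  rw [hcyc] at hlc
  have h1 : lst (law lam m) (busy ν) s = (Λ + s) / Λ * (1 - 1 / ((Λ + s) * laplace P s)) := by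
    rw [hlc]
    field_simp
  rw [h1]
  field_simp
  ring

/-- If the probability of an empty system is bounded away from zero, then the busy period is
finite. -/
theorem ae_busy_lt_top (hlam : ∀ i, 0 < lam i) (hν : 0 ≤ ν)
    (hP : ContinuousOn (fun t => (law lam m).real {w | Idle ν t w}) (Ici 0)) {c : ℝ} (hc : 0 < c)
    (hPc : ∀ t, 0 ≤ t → c ≤ (law lam m).real {w | Idle ν t w}) :
    ∀ᵐ w ∂(law lam m), busy ν w < ⊤ := by
  have hprob := isProbabilityMeasure_law hlam (m := m)
  have hb := aemeasurable_busy hlam hν (m := m)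
  have hΛ0 : 0 < ∑ i, lam i := Finset.sum_pos (fun i _ => hlam i) Finset.univ_nonempty
  have htr := fun (s : ℂ) (hs : 0 < s.re) => transforms (m := m) hlam hν hP hs
  set Λ : ℝ := ∑ i, lam i with hΛ
  set P : ℝ → ℝ := fun t => (law lam m).real {w | Idle ν t w} with hPdef
  have hPm : Measurable P :=
    (measurable_measure_prodMk_left (measurableSet_idle_prod ν)).ennreal_toReal
  have hP1 : ∀ t, |P t| ≤ 1 := fun t => by
    rw [abs_of_nonneg measureReal_nonneg]; exact measureReal_le_one
  set F : Set (World ι) := {w | busy ν w < ⊤} with hF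
  have hFm : NullMeasurableSet F (law lam m) := nullMeasurableSet_lt hb aemeasurable_const
  -- For real `x > 0` the bound `P ≥ c` gives `P̃(x) ≥ c/x`, so the formula for the transform gives
  -- `|1 - π̂(x)| ≤ Λ⁻¹(x + x/c)`; on the other side `|π̂(x)|` is at most the probability that `π`
  -- is finite. Then `x → 0`.
  have hle : ∀ x : ℝ, 0 < x → 1 - Λ⁻¹ * (x + x / c) ≤ (law lam m).real F := by
    intro x hx
    have hs : 0 < (x : ℂ).re := by simpa using hx
    obtain ⟨-, h2, -⟩ := htr x hs
    have hLc : c / x ≤ ‖laplace P x‖ := by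
      refine le_trans ?_ (Complex.re_le_norm _)
      have hre : (laplace P x).re = ∫ t in Ioi (0 : ℝ), Real.exp (-x * t) * P t := by
        have h4 : (laplace P x).re =
            ∫ t in Ioi (0 : ℝ), (Complex.exp (-(x : ℂ) * t) * (P t : ℂ)).re :=
          (integral_re (integrableOn_laplace hs hPm hP1)).symm
        rw [h4]
        refine integral_congr_ae (Eventually.of_forall fun t => ?_)
        simp only
        rw [← Complex.ofReal_neg, ← Complex.ofReal_mul, ← Complex.ofReal_exp, ← Complex.ofReal_mul,
          Complex.ofReal_re]
      have hi : IntegrableOn (fun t : ℝ => Real.exp (-x * t)) (Ioi 0) :=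
        integrableOn_exp_mul_Ioi (by linarith) 0
      have h5 : ∫ t in Ioi (0 : ℝ), Real.exp (-x * t) * c = c / x := by
        rw [integral_mul_const, integral_exp_mul_Ioi (by linarith)]
        simp
        field_simp
      rw [hre, ← h5]
      refine setIntegral_mono_on (hi.mul_const c) ?_ measurableSet_Ioi fun t ht =>
        mul_le_mul_of_nonneg_left (hPc t (le_of_lt ht)) (Real.exp_pos _).le
      refine hi.mono' (Measurable.aestronglyMeasurable (by fun_prop)) (Eventually.of_forall
        fun t => ?_)
      rw [norm_mul, Real.norm_of_nonneg (Real.exp_pos _).le]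
      exact mul_le_of_le_one_right (Real.exp_pos _).le (hP1 t)
    have hLi : ‖1 / laplace P x‖ ≤ x / c := by
      rw [norm_div, norm_one, ← one_div_div c x]
      exact one_div_le_one_div_of_le (by positivity) hLc
    have h3 : ‖1 - lst (law lam m) (busy ν) x‖ ≤ Λ⁻¹ * (x + x / c) := by
      rw [h2, sub_add_cancel_left, norm_neg, norm_mul, norm_inv, Complex.norm_real,
        Real.norm_of_nonneg hΛ0.le]
      refine mul_le_mul_of_nonneg_left ((norm_sub_le _ _).trans (add_le_add ?_ hLi)) (by positivity)
      rw [Complex.norm_real, Real.norm_of_nonneg hx.le]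
    have h4 : ‖lst (law lam m) (busy ν) x‖ ≤ (law lam m).real F := by
      rw [lst_eq]
      refine (norm_integral_le_integral_norm _).trans ?_
      rw [← mul_one ((law lam m).real F), ← smul_eq_mul, ← setIntegral_const, ← integral_indicator₀ hFm]
      refine integral_mono (integrable_lstKernel hs hb).norm
        ((integrable_const _).indicator₀ hFm) fun w => ?_
      by_cases hw : w ∈ F
      · rw [indicator_of_mem hw]; exact norm_lstKernel_le hs _
      · have : busy ν w = ⊤ := by simpa [hF] using hw
        simp [lstKernel, this, hF]
    have h5 := norm_sub_norm_le (1 : ℂ) (lst (law lam m) (busy ν) x)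
    rw [norm_one] at h5
    linarith
  have h1 : 1 ≤ (law lam m).real F := by
    have hlim : Tendsto (fun x : ℝ => 1 - Λ⁻¹ * (x + x / c)) (𝓝[>] 0) (𝓝 1) := by
      have : Continuous fun x : ℝ => 1 - Λ⁻¹ * (x + x / c) := by fun_prop
      have h := (this.tendsto 0).mono_left (nhdsWithin_le_nhds (s := Ioi 0))
      simpa using h
    exact le_of_tendsto hlim (eventually_mem_nhdsWithin.mono fun x hx => hle x hx)
  have h2 : (law lam m).real F = 1 := le_antisymm measureReal_le_one h1
  have h3 : law lam m F = 1 := by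
    rw [← ofReal_measureReal (μ := law lam m), h2, ENNReal.ofReal_one]
  exact (prob_compl_eq_zero_iff₀ hFm).2 h3

end World

/-! ### From an arbitrary model to the canonical system -/

section Transfer

open Measure

lemma infinitePi_map_option {α E : Type*} [MeasurableSpace E] (ρ : Option α → Measure E)
    [∀ a, IsProbabilityMeasure (ρ a)] :
    (infinitePi ρ).map (fun x => (x none, fun a => x (some a))) =
      (ρ none).prod (infinitePi fun a => ρ (some a)) := by
  have h := infinitePi_map_prodMk ρ (f := fun _ : Unit => none) (g := some)
    (Function.Injective.sumElim (fun _ _ _ => rfl) (Option.some_injective α) (by simp))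
  have h2 := congrArg (Measure.map (Prod.map (fun u : Unit → E => u ()) id)) h
  rw [map_map (by fun_prop) (by fun_prop), ← map_prod_map _ _ (by fun_prop) measurable_id,
    infinitePi_map_eval, Measure.map_id] at h2
  exact h2

variable {ι Ω : Type*}

/-- Position of an input variable of the streams of batches: the gap, the size or a service time
of a batch. -/
def Label.ofIndex : ι × ℕ × Option (Option ℕ) → Label ι
  | (i, n, none) => .gap i n
  | (i, n, some none) => .size i n
  | (i, n, some (some j)) => .service i n j

lemma Label.injective_sumElim :
    Function.Injective (Sum.elim (Label.ofIndex (ι := ι)) (Label.clock (ι := ι))) := by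
  refine Function.Injective.sumElim ?_ (fun a b h => by injection h) ?_
  · rintro ⟨i, n, _ | _ | j⟩ ⟨i', n', _ | _ | j'⟩ h <;> simp_all [Label.ofIndex]
  · rintro ⟨i, n, _ | _ | j⟩ m h <;> simp [Label.ofIndex] at h

lemma Label.surjective_sumElim :
    Function.Surjective (Sum.elim (Label.ofIndex (ι := ι)) (Label.clock (ι := ι))) := by
  rintro (⟨i, n⟩ | ⟨i, n⟩ | ⟨i, n, j⟩ | m)
  · exact ⟨.inl (i, n, none), rfl⟩
  · exact ⟨.inl (i, n, some none), rfl⟩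
  · exact ⟨.inl (i, n, some (some j)), rfl⟩
  · exact ⟨.inr m, rfl⟩

instance [Countable ι] : Countable (Label ι) := Label.surjective_sumElim.countable

/-- The laws of the input variables. -/
def labelLaw (lam : ι → ℝ) (q : ι → PMF ℕ) (B : ι → Measure ℝ) : Label ι → Measure ℝ
  | .gap i _ => expMeasure (lam i)
  | .size i _ => (q i).toMeasure.map (Nat.cast : ℕ → ℝ)
  | .service i _ _ => B i
  | .clock _ => expMeasure 1

variable {lam : ι → ℝ} {q : ι → PMF ℕ} {B : ι → Measure ℝ}

lemma isProbabilityMeasure_labelLaw (hlam : ∀ i, 0 < lam i) [∀ i, IsProbabilityMeasure (B i)]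
    (l : Label ι) : IsProbabilityMeasure (labelLaw lam q B l) := by
  rcases l with ⟨i, n⟩ | ⟨i, n⟩ | ⟨i, n, j⟩ | m
  · exact isProbabilityMeasure_expMeasure (hlam i)
  · exact isProbabilityMeasure_map (measurable_from_nat (f := (Nat.cast : ℕ → ℝ))).aemeasurable
  · exact inferInstanceAs (IsProbabilityMeasure (B i))
  · exact isProbabilityMeasure_expMeasure one_pos

/-- The world built from labelled input variables. -/
def worldOfLabels (x : Label ι → ℝ) : World ι :=
  (fun i n => (x (.gap i n), x (.size i n), fun j => x (.service i n j)),
    fun m => (x (.clock m), ()))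

namespace Inputs

/-- The world described by the input variables. -/
def world (X : Inputs ι Ω) (ω : Ω) : World ι := worldOfLabels fun l => X.family l ω

variable {X : Inputs ι Ω} {ν t : ℝ} {ω : Ω}

lemma idlePeriod_eq_start (X : Inputs ι Ω) (ω : Ω) : X.idlePeriod ω = (X.world ω).start := rfl

lemma isIdle_iff_idle (h : (X.world ω).IsProper) (hν : 0 ≤ ν) (t : ℝ) :
    X.IsIdle (X.catastrophes ν) t ω ↔ World.Idle ν t (X.world ω) := by
  have key : ∀ a, (∀ c ∈ X.catastrophes ν ω, ¬ (a < c ∧ c ≤ t)) ↔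
      ∀ m, ¬ (ν * a < (X.world ω).2.epoch m ∧ (X.world ω).2.epoch m ≤ ν * t) := by
    intro a
    rcases hν.eq_or_lt with rfl | hν'
    -- At speed `0` neither side has a catastrophe: the epochs of a proper clock are positive, and
    -- no `c` makes `0 * c` positive.
    · refine iff_of_true ?_ fun m hm => ?_
      · rintro c ⟨m, hm⟩
        have h1 := h.2.epoch_pos m
        have h2 : (0 : ℝ) * c = (X.world ω).2.epoch m := hm
        linarith
      · linarith [hm.1, hm.2]
    · constructor
      · intro hc m hm
        refine hc ((X.world ω).2.epoch m / ν) ⟨m, ?_⟩ ⟨?_, ?_⟩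
        · rw [mul_div_cancel₀ _ hν'.ne']; rfl
        · rw [lt_div_iff₀ hν', mul_comm]; exact hm.1
        · rw [div_le_iff₀ hν', mul_comm]; exact hm.2
      · rintro hm c ⟨m, hc⟩ ⟨h1, h2⟩
        have h3 : ν * c = (X.world ω).2.epoch m := hc
        refine hm m ?_
        rw [← h3]
        exact ⟨mul_lt_mul_of_pos_left h1 hν', mul_le_mul_of_nonneg_left h2 hν⟩
  refine forall_congr' fun i => ?_
  rw [number, encard_eq_zero, eq_empty_iff_forall_notMem, Prod.forall]
  refine forall_congr' fun n => forall_congr' fun j => not_congr ?_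
  exact and_congr Nat.cast_lt.symm (and_congr_right fun _ => and_congr_right fun _ => key _)

lemma isIdle_empty_iff_idle (t : ℝ) :
    X.IsIdle (fun _ => ∅) t ω ↔ World.Idle 0 t (X.world ω) := by
  refine forall_congr' fun i => ?_
  rw [number, encard_eq_zero, eq_empty_iff_forall_notMem, Prod.forall]
  refine forall_congr' fun n => forall_congr' fun j => not_congr ?_
  refine and_congr Nat.cast_lt.symm (and_congr_right fun _ => and_congr_right fun _ => ?_)
  refine iff_of_true (by simp) fun m hm => ?_
  linarith [hm.1, hm.2]

lemma busyPeriod_eq_busy (h : (X.world ω).IsProper) (hν : 0 ≤ ν) :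
    X.busyPeriod (X.catastrophes ν) ω = World.busy ν (X.world ω) := by
  simp only [busyPeriod, World.busy, isIdle_iff_idle h hν, idlePeriod_eq_start]

lemma busyCycle_eq_cycle (h : (X.world ω).IsProper) (hν : 0 ≤ ν) :
    X.busyCycle (X.catastrophes ν) ω = World.cycle ν (X.world ω) := by
  rw [busyCycle, World.cycle, busyPeriod_eq_busy h hν, idlePeriod_eq_start]

end Inputs

variable [Fintype ι]

/-- The index set `ι × ℕ × Option (Option ℕ)` is chosen so that currying separates types and
batches, and splitting off `none` twice separates gap, size and service times. The clock is a
disjoint block of labels. -/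
lemma measurePreserving_worldOfLabels (hlam : ∀ i, 0 < lam i) [∀ i, IsProbabilityMeasure (B i)] :
    MeasurePreserving worldOfLabels (infinitePi (labelLaw lam q B))
      (World.law lam fun i => markLaw (q i) (B i)) := by
  have hL := isProbabilityMeasure_labelLaw (q := q) (B := B) hlam
  have hexp := fun i => isProbabilityMeasure_expMeasure (hlam i)
  have hexp1 := isProbabilityMeasure_expMeasure one_pos
  let ρ : ι → Option (Option ℕ) → Measure ℝ := fun i o => labelLaw lam q B (.ofIndex (i, 0, o))
  have hρ : ∀ i o, IsProbabilityMeasure (ρ i o) := fun i o => hL _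
  have hρL : ∀ i n o, labelLaw lam q B (.ofIndex (i, n, o)) = ρ i o := fun i n o => by
    rcases o with _ | _ | j <;> rfl
  -- the variables of one batch
  have h1 : ∀ i, MeasurePreserving (fun x : Option (Option ℕ) → ℝ =>
      (x none, x (some none), fun j => x (some (some j)))) (infinitePi (ρ i))
        ((expMeasure (lam i)).prod (markLaw (q i) (B i))) := fun i => by
    have e1 : MeasurePreserving (fun x : Option (Option ℕ) → ℝ => (x none, fun a => x (some a)))
        (infinitePi (ρ i)) _ := ⟨by fun_prop, infinitePi_map_option (ρ i)⟩
    have e2 : MeasurePreserving (fun x : Option ℕ → ℝ => (x none, fun a => x (some a)))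
        (infinitePi fun a => ρ i (some a)) _ :=
      ⟨by fun_prop, infinitePi_map_option fun a => ρ i (some a)⟩
    exact ((MeasurePreserving.id (ρ i none)).prod e2).comp e1
  -- the stream of batches of one type
  have h2 : ∀ i, MeasurePreserving (fun (x : ℕ → Option (Option ℕ) → ℝ) (n : ℕ) =>
      (x n none, x n (some none), fun j => x n (some (some j))))
        (infinitePi fun _ : ℕ => infinitePi (ρ i)) (Stream.law (lam i) (markLaw (q i) (B i))) :=
    fun i => by
      refine ⟨by fun_prop, ?_⟩
      have := infinitePi_map_pi (fun _ : ℕ => infinitePi (ρ i)) fun _ => (h1 i).measurable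
      rw [this]
      simp_rw [(h1 i).map_eq]
      rfl
  have h3 : ∀ i, MeasurePreserving (MeasurableEquiv.curry ℕ (Option (Option ℕ)) ℝ)
      (infinitePi fun p : ℕ × Option (Option ℕ) => ρ i p.2)
        (infinitePi fun _ : ℕ => infinitePi (ρ i)) := fun i =>
    ⟨MeasurableEquiv.measurable _, infinitePi_map_curry fun _ => ρ i⟩
  have h4 : MeasurePreserving (MeasurableEquiv.curry ι (ℕ × Option (Option ℕ)) ℝ)
      (infinitePi fun p : ι × ℕ × Option (Option ℕ) => ρ p.1 p.2.2)
        (Measure.pi fun i => infinitePi fun p : ℕ × Option (Option ℕ) => ρ i p.2) :=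
    ⟨MeasurableEquiv.measurable _, by
      rw [← infinitePi_eq_pi]
      exact infinitePi_map_curry fun i (p : ℕ × Option (Option ℕ)) => ρ i p.2⟩
  have := fun i => Stream.isProbabilityMeasure_law (hlam i) (m := markLaw (q i) (B i))
  have := Stream.isProbabilityMeasure_law one_pos (m := Measure.dirac ())
  have h5 := (measurePreserving_pi _ _ fun i => (h2 i).comp (h3 i)).comp h4
  have h6 : MeasurePreserving (fun (x : ℕ → ℝ) n => (x n, ())) (infinitePi fun _ => expMeasure 1)
      (Stream.law 1 (Measure.dirac ())) := by
    refine ⟨by fun_prop, ?_⟩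
    rw [infinitePi_map_pi (fun _ : ℕ => expMeasure 1) (f := fun _ a => (a, ()))
      fun _ => by fun_prop]
    simp_rw [← prod_dirac]
    rfl
  have h7 : MeasurePreserving (fun x : Label ι → ℝ =>
      (fun p => x (.ofIndex p), fun m => x (.clock m))) (infinitePi (labelLaw lam q B))
        ((infinitePi fun p : ι × ℕ × Option (Option ℕ) => ρ p.1 p.2.2).prod
          (infinitePi fun _ => expMeasure 1)) := by
    refine ⟨by fun_prop, ?_⟩
    rw [infinitePi_map_prodMk _ Label.injective_sumElim]
    congr 2
    funext p
    exact hρL p.1 p.2.1 p.2.2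
  exact (h5.prod h6).comp h7

namespace IsModel

variable [MeasurableSpace Ω] {P : Measure Ω} {X : Inputs ι Ω} [∀ i, IsProbabilityMeasure (B i)]

/-- Joint independence makes the law of the whole family a product measure, so any two models with
the same parameters have the same world in law. -/
lemma hasLaw_world (hX : IsModel X P lam q B) (hlam : ∀ i, 0 < lam i) :
    HasLaw X.world (World.law lam fun i => markLaw (q i) (B i)) P := by
  have hfam : ∀ l, HasLaw (X.family l) (labelLaw lam q B l) P := by
    rintro (⟨i, n⟩ | ⟨i, n⟩ | ⟨i, n, j⟩ | m)
    · exact hX.gap_law i n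
    · have h := hX.size_law i n
      have hc : Measurable (Nat.cast : ℕ → ℝ) := measurable_from_nat
      refine ⟨hc.comp_aemeasurable h.aemeasurable, ?_⟩
      change P.map ((Nat.cast : ℕ → ℝ) ∘ X.size i n) = _
      rw [← AEMeasurable.map_map_of_aemeasurable hc.aemeasurable h.aemeasurable, h.map_eq]
      rfl
    · exact hX.service_law i n j
    · exact hX.clock_law m
  have h1 := hX.indep.hasLaw_infinitePi hfam (aemeasurable_pi_iff.2 fun l => (hfam l).aemeasurable)
  have h2 := measurePreserving_worldOfLabels (q := q) (B := B) hlam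
  refine ⟨h2.measurable.comp_aemeasurable h1.aemeasurable, ?_⟩
  change P.map (worldOfLabels ∘ fun ω l => X.family l ω) = _
  rw [← AEMeasurable.map_map_of_aemeasurable h2.measurable.aemeasurable h1.aemeasurable, h1.map_eq,
    h2.map_eq]

variable {ν t : ℝ} {s : ℂ}

lemma ae_isProper (hX : IsModel X P lam q B) (hlam : ∀ i, 0 < lam i) :
    ∀ᵐ ω ∂P, (X.world ω).IsProper := by
  have h := hX.hasLaw_world hlam
  refine ae_of_ae_map h.aemeasurable ?_
  rw [h.map_eq]
  exact World.ae_isProper hlam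

lemma idleProb_eq (hX : IsModel X P lam q B) (hlam : ∀ i, 0 < lam i) (hν : 0 ≤ ν) (t : ℝ) :
    X.idleProb P (X.catastrophes ν) t =
      (World.law lam fun i => markLaw (q i) (B i)).real {w | World.Idle ν t w} := by
  rw [← (hX.hasLaw_world hlam).measureReal_eq (World.measurableSet_idle ν t), Inputs.idleProb]
  refine measureReal_congr ?_
  filter_upwards [hX.ae_isProper hlam] with ω h using propext (Inputs.isIdle_iff_idle h hν t)

lemma idleProb_empty_eq (hX : IsModel X P lam q B) (hlam : ∀ i, 0 < lam i) (t : ℝ) :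
    X.idleProb P (fun _ => ∅) t =
      (World.law lam fun i => markLaw (q i) (B i)).real {w | World.Idle 0 t w} := by
  rw [← (hX.hasLaw_world hlam).measureReal_eq (World.measurableSet_idle 0 t), Inputs.idleProb]
  simp only [Inputs.isIdle_empty_iff_idle]

lemma busyPeriod_ae_eq (hX : IsModel X P lam q B) (hlam : ∀ i, 0 < lam i) (hν : 0 ≤ ν) :
    X.busyPeriod (X.catastrophes ν) =ᵐ[P] World.busy ν ∘ X.world := by
  filter_upwards [hX.ae_isProper hlam] with ω h using Inputs.busyPeriod_eq_busy h hν

lemma busyCycle_ae_eq (hX : IsModel X P lam q B) (hlam : ∀ i, 0 < lam i) (hν : 0 ≤ ν) :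
    X.busyCycle (X.catastrophes ν) =ᵐ[P] World.cycle ν ∘ X.world := by
  filter_upwards [hX.ae_isProper hlam] with ω h using Inputs.busyCycle_eq_cycle h hν

lemma lst_comp_world (hX : IsModel X P lam q B) (hlam : ∀ i, 0 < lam i) {Y : World ι → ℝ≥0∞}
    (hY : AEMeasurable Y (World.law lam fun i => markLaw (q i) (B i))) (s : ℂ) :
    lst P (Y ∘ X.world) s = lst (World.law lam fun i => markLaw (q i) (B i)) Y s := by
  have h := hX.hasLaw_world hlam
  rw [lst_eq, lst_eq, ← h.map_eq, integral_map h.aemeasurable]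
  · rfl
  · rw [h.map_eq]
    exact ((measurable_lstKernel s).comp_aemeasurable hY).aestronglyMeasurable

variable [Nonempty ι]

lemma aemeasurable_busyPeriod (hX : IsModel X P lam q B) (hlam : ∀ i, 0 < lam i) (hν : 0 ≤ ν) :
    AEMeasurable (X.busyPeriod (X.catastrophes ν)) P := by
  have h := hX.hasLaw_world hlam
  have hb := World.aemeasurable_busy (m := fun i => markLaw (q i) (B i)) hlam hν
  rw [← h.map_eq] at hb
  exact (hb.comp_aemeasurable h.aemeasurable).congr (hX.busyPeriod_ae_eq hlam hν).symm

lemma aemeasurable_busyCycle (hX : IsModel X P lam q B) (hlam : ∀ i, 0 < lam i) (hν : 0 ≤ ν) :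
    AEMeasurable (X.busyCycle (X.catastrophes ν)) P := by
  have h := hX.hasLaw_world hlam
  have hb := World.aemeasurable_cycle (m := fun i => markLaw (q i) (B i)) hlam hν
  rw [← h.map_eq] at hb
  exact (hb.comp_aemeasurable h.aemeasurable).congr (hX.busyCycle_ae_eq hlam hν).symm

end IsModel

end Transfer

/-! ### Analysis of the formula for the empty system -/

section IdleFormula

variable {a : ℝ → ℝ} {ν t : ℝ}

lemma continuous_exp_neg_integral (ha : ∀ x y, IntervalIntegrable a volume x y) :
    Continuous fun u => Real.exp (-∫ x in (0 : ℝ)..u, a x) :=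
  Real.continuous_exp.comp (intervalIntegral.continuous_primitive ha 0).neg

lemma intervalIntegrable_antitone_add_const (ha : Antitone a) (ν x y : ℝ) :
    IntervalIntegrable (fun x => a x + ν) volume x y :=
  ha.intervalIntegrable.add intervalIntegrable_const

lemma continuous_idleFormula (ha : Antitone a) (ν : ℝ) : Continuous (idleFormula a ν) := by
  have h := continuous_exp_neg_integral (intervalIntegrable_antitone_add_const ha ν)
  exact h.add (continuous_const.mul
    (intervalIntegral.continuous_primitive (fun x y => h.intervalIntegrable x y) 0))

lemma idleFormula_zero (a : ℝ → ℝ) (t : ℝ) :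
    idleFormula a 0 t = Real.exp (-∫ x in (0 : ℝ)..t, a x) := by
  simp [idleFormula]

/-- With catastrophes, the probability of an empty system is bounded away from zero. -/
lemma le_idleFormula (ha : Antitone a) {r : ℝ} (har : ∀ x, a x ≤ r) (hr : 0 < r) (hν : 0 ≤ ν)
    (ht : 0 ≤ t) : ν / (r + ν) ≤ idleFormula a ν t := by
  have hrν : 0 < r + ν := by linarith
  have hcont := continuous_exp_neg_integral (intervalIntegrable_antitone_add_const ha ν)
  have h1 : ∀ u, 0 ≤ u → Real.exp (-((r + ν) * u)) ≤
      Real.exp (-∫ x in (0 : ℝ)..u, (a x + ν)) := fun u hu => by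
    refine Real.exp_le_exp.2 (neg_le_neg ?_)
    have := intervalIntegral.integral_mono_on hu
      (intervalIntegrable_antitone_add_const ha ν 0 u)
      (intervalIntegrable_const (c := r + ν)) fun x _ => by linarith [har x]
    rwa [intervalIntegral.integral_const, sub_zero, smul_eq_mul, mul_comm u] at this
  have hexp : Continuous fun u : ℝ => Real.exp (-((r + ν) * u)) := by fun_prop
  have h2 : ∫ u in (0 : ℝ)..t, Real.exp (-((r + ν) * u)) =
      (1 - Real.exp (-((r + ν) * t))) / (r + ν) := by
    have hd : ∀ u ∈ uIcc 0 t, HasDerivAt (fun u : ℝ => -Real.exp (-((r + ν) * u)) / (r + ν))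
        (Real.exp (-((r + ν) * u))) u := fun u _ => by
      have := ((((hasDerivAt_id u).const_mul (r + ν)).neg.exp).neg).div_const (r + ν)
      refine this.congr_deriv ?_
      simp only [id, Pi.neg_apply]
      field_simp
    rw [intervalIntegral.integral_eq_sub_of_hasDerivAt hd (hexp.intervalIntegrable _ _)]
    simp
    ring
  have h3 := intervalIntegral.integral_mono_on (μ := volume) ht (hexp.intervalIntegrable _ _)
    (hcont.intervalIntegrable 0 t) fun u hu => h1 u hu.1
  rw [h2] at h3
  have h4 := h1 t ht
  have h5 := mul_le_mul_of_nonneg_left h3 hν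
  -- After the rate `a` is replaced by its bound `r`, the formula becomes a convex combination of
  -- `ν/(r+ν)` and `1`, with weight `e^{-(r+ν)t}` on `1`.
  have h6 : ν / (r + ν) = ν * ((1 - Real.exp (-((r + ν) * t))) / (r + ν)) +
      ν / (r + ν) * Real.exp (-((r + ν) * t)) := by
    field_simp
    ring
  have h7 : ν / (r + ν) * Real.exp (-((r + ν) * t)) ≤ 1 * Real.exp (-((r + ν) * t)) :=
    mul_le_mul_of_nonneg_right ((div_le_one hrν).2 (by linarith)) (Real.exp_pos _).le
  rw [idleFormula, h6]
  linarith

/-- The Laplace transform of the probability of an empty system, in terms of the system without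
catastrophes. -/
lemma mul_laplace_idleFormula (ha : Antitone a) (hν : 0 ≤ ν)
    (h1 : ∀ t, 0 ≤ t → idleFormula a ν t ≤ 1) {s : ℂ} (hs : 0 < s.re) :
    s * laplace (idleFormula a ν) s = (ν + s) * laplace (idleFormula a 0) (ν + s) := by
  have hai := intervalIntegrable_antitone_add_const ha ν
  set f : ℝ → ℝ := fun u => Real.exp (-∫ x in (0 : ℝ)..u, (a x + ν)) with hf
  have hfc : Continuous f := continuous_exp_neg_integral hai
  set H : ℝ → ℝ := fun t => ∫ u in (0 : ℝ)..t, f u with hH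
  have hHd : ∀ t, HasDerivAt H (f t) t := fun t =>
    intervalIntegral.integral_hasDerivAt_right (hfc.intervalIntegrable _ _)
      (hfc.stronglyMeasurableAtFilter _ _) hfc.continuousAt
  have hHc : Continuous H := continuous_iff_continuousAt.2 fun t => (hHd t).continuousAt
  have hf0 : ∀ t, 0 ≤ f t := fun t => (Real.exp_pos _).le
  have hH0 : ∀ t, 0 ≤ t → 0 ≤ H t := fun t ht =>
    intervalIntegral.integral_nonneg ht fun u _ => hf0 u
  have hΦ : ∀ t, idleFormula a ν t = f t + ν * H t := fun t => rfl
  -- Both summands are nonnegative and their sum is at most `1` by assumption, so each is bounded by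
  -- `1`.
  have hb : ∀ t, 0 ≤ t → |f t| ≤ 1 ∧ |ν * H t| ≤ 1 := fun t ht => by
    have h2 := h1 t ht
    rw [hΦ] at h2
    have h3 := mul_nonneg hν (hH0 t ht)
    rw [abs_of_nonneg (hf0 t), abs_of_nonneg h3]
    constructor <;> linarith [hf0 t]
  have hint : ∀ g : ℝ → ℝ, Continuous g → (∀ t, 0 ≤ t → |g t| ≤ 1) →
      IntegrableOn (fun t : ℝ => Complex.exp (-s * t) * (g t : ℂ)) (Ioi 0) := fun g hg hg1 => by
    refine (integrableOn_exp_neg_mul hs).mono' (Measurable.aestronglyMeasurable (by fun_prop)) ?_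
    refine (ae_restrict_iff' measurableSet_Ioi).2 (Filter.Eventually.of_forall fun t ht => ?_)
    rw [norm_mul, norm_exp_neg_mul_ofReal, Complex.norm_real]
    exact mul_le_of_le_one_right (Real.exp_pos _).le (hg1 t (le_of_lt ht))
  have hif := hint f hfc fun t ht => (hb t ht).1
  have hiH := hint (fun t => ν * H t) (by fun_prop) fun t ht => (hb t ht).2
  have e1 : laplace (idleFormula a ν) s = laplace f s + laplace (fun t => ν * H t) s := by
    simp only [laplace, hΦ]
    rw [← integral_add hif hiH]
    refine integral_congr_ae (Filter.Eventually.of_forall fun t => ?_)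
    simp only
    push_cast
    ring
  -- The constant `ν` in the rate multiplies the catastrophe-free probability by `e^{-νt}`, which
  -- shifts the argument of its transform.
  have e2 : laplace (idleFormula a 0) (ν + s) = laplace f s := by
    refine integral_congr_ae (Filter.Eventually.of_forall fun t => ?_)
    simp only [idleFormula_zero, hf, Complex.ofReal_exp, ← Complex.exp_add]
    rw [intervalIntegral.integral_add ha.intervalIntegrable intervalIntegrable_const]
    congr 1
    simp
    ring
  -- Integration by parts: `e^{-st} ν H(t)` vanishes at `0` and at infinity, so its derivative
  -- integrates to zero.
  have e3 : s * laplace (fun t => ν * H t) s = ν * laplace f s := by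
    have hd : ∀ t ∈ Ici (0 : ℝ), HasDerivAt
        (fun t : ℝ => Complex.exp (-s * t) * ((ν * H t : ℝ) : ℂ))
        (ν * (Complex.exp (-s * t) * (f t : ℂ)) -
          s * (Complex.exp (-s * t) * ((ν * H t : ℝ) : ℂ))) t := fun t _ => by
      have hE : HasDerivAt (fun t : ℝ => Complex.exp (-s * t)) (Complex.exp (-s * t) * (-s)) t := by
        simpa using (((hasDerivAt_id (t : ℂ)).const_mul (-s)).cexp).comp_ofReal
      refine (hE.mul ((hHd t).const_mul ν).ofReal_comp).congr_deriv ?_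
      push_cast
      ring
    have hlim : Filter.Tendsto (fun t : ℝ => Complex.exp (-s * t) * ((ν * H t : ℝ) : ℂ))
        Filter.atTop (nhds 0) := by
      have h2 : Filter.Tendsto (fun t : ℝ => Real.exp (-s.re * t)) Filter.atTop (nhds 0) :=
        Real.tendsto_exp_atBot.comp
          (Filter.tendsto_id.const_mul_atTop_of_neg (by linarith : -s.re < 0))
      refine squeeze_zero_norm' ?_ h2
      filter_upwards [Filter.eventually_ge_atTop 0] with t ht
      rw [norm_mul, norm_exp_neg_mul_ofReal, Complex.norm_real]
      exact mul_le_of_le_one_right (Real.exp_pos _).le (hb t ht).2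
    have h3 := integral_Ioi_of_hasDerivAt_of_tendsto' hd
      ((hif.const_mul (ν : ℂ)).sub (hiH.const_mul s)) hlim
    rw [integral_sub (hif.const_mul (ν : ℂ)) (hiH.const_mul s), integral_const_mul,
      integral_const_mul] at h3
    have h4 : H 0 = 0 := intervalIntegral.integral_same
    rw [h4] at h3
    simp only [mul_zero, Complex.ofReal_zero, sub_zero] at h3
    exact (sub_eq_zero.1 h3).symm
  rw [e1, e2, mul_add, e3]
  ring

end IdleFormula

/-! ### Bounding the integrated intensity by mean values -/

section MeanLoad

variable {q : PMF ℕ} {z : ℝ}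

lemma pgf_pure_one (z : ℝ) : pgf (PMF.pure 1) z = z := by
  rw [pgf, tsum_eq_single 1 fun n hn => by simp [PMF.pure_apply, hn]]
  simp

lemma integrable_pure (n : ℕ) : Integrable (fun n : ℕ => (n : ℝ)) (PMF.pure n).toMeasure := by
  rw [PMF.toMeasure_pure]
  exact integrable_dirac (by simp)

lemma summable_mean (hq : Integrable (fun n : ℕ => (n : ℝ)) q.toMeasure) :
    Summable fun n : ℕ => (q n).toReal * n := by
  have h := hq.hasFiniteIntegral
  rw [HasFiniteIntegral, lintegral_countable'] at h
  refine (ENNReal.summable_toReal h.ne).congr fun n => ?_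
  rw [PMF.toMeasure_apply_singleton _ _ (measurableSet_singleton _), ENNReal.toReal_mul, mul_comm]
  simp

/-- Bernoulli's inequality `1 - z ^ n ≤ n (1 - z)`, averaged over `n`. -/
lemma one_sub_pgf_le (hq : Integrable (fun n : ℕ => (n : ℝ)) q.toMeasure) (hz : z ∈ Icc (0 : ℝ) 1) :
    1 - pgf q z ≤ (∑' n : ℕ, (q n).toReal * n) * (1 - z) := by
  rw [pgf]
  nth_rewrite 1 [← tsum_pmf_toReal q]
  rw [← (summable_pmf_toReal q).tsum_sub (summable_pgf q hz),
    ← tsum_mul_right]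
  refine ((summable_pmf_toReal q).sub (summable_pgf q hz)).tsum_le_tsum (fun n => ?_)
    ((summable_mean hq).mul_right _)
  have h := one_add_mul_le_pow (a := z - 1) (by linarith [hz.1]) n
  have h2 := mul_le_mul_of_nonneg_left h (ENNReal.toReal_nonneg (a := q n))
  rw [add_sub_cancel] at h2
  linarith

/-- The integral of the tail over the whole half-line is the mean, by the layer-cake formula. -/
lemma integral_one_sub_cdf_le {B : Measure ℝ} [IsProbabilityMeasure B] (hB0 : B (Iio 0) = 0)
    (hB : Integrable (fun x => x) B) {t : ℝ} (ht : 0 ≤ t) :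
    ∫ x in (0 : ℝ)..t, (1 - cdf B x) ≤ ∫ x, x ∂B := by
  have hpos : 0 ≤ᵐ[B] fun x : ℝ => x := by
    rw [Filter.EventuallyLE, ae_iff]
    convert hB0 using 2
    ext x
    simp
  have hcdf : ∀ x, ENNReal.ofReal (1 - cdf B x) = B {y | x < y} := fun x => by
    rw [cdf_eq_real, ← probReal_compl_eq_one_sub measurableSet_Iic, compl_Iic, ofReal_measureReal]
    rfl
  have hm : Measurable fun x => 1 - cdf B x := measurable_const.sub (monotone_cdf B).measurable
  rw [integral_eq_lintegral_of_nonneg_ae hpos hB.aestronglyMeasurable,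
    intervalIntegral.integral_of_le ht, integral_eq_lintegral_of_nonneg_ae
      (Filter.Eventually.of_forall fun x => by simp [cdf_le_one]) hm.aestronglyMeasurable,
    lintegral_eq_lintegral_meas_lt B hpos aemeasurable_id]
  refine ENNReal.toReal_mono ?_ ?_
  · rw [← lintegral_eq_lintegral_meas_lt B hpos aemeasurable_id]
    exact hB.lintegral_lt_top.ne
  · simp only [hcdf]
    exact lintegral_mono_set Ioc_subset_Ioi_self

/-- The mean number of customers in service is bounded. -/
lemma exists_integral_intensity_le {ι : Type*} [Fintype ι] {lam : ι → ℝ} {q : ι → PMF ℕ}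
    {B : ι → Measure ℝ} [∀ i, IsProbabilityMeasure (B i)] (hlam : ∀ i, 0 < lam i)
    (hq : ∀ i, Integrable (fun n : ℕ => (n : ℝ)) (q i).toMeasure) (hB0 : ∀ i, B i (Iio 0) = 0)
    (hB : ∀ i, Integrable (fun x => x) (B i)) :
    ∃ C, ∀ t, 0 ≤ t → ∫ x in (0 : ℝ)..t, intensity lam q B x ≤ C := by
  refine ⟨∑ i, lam i * (∑' n : ℕ, (q i n).toReal * n) * ∫ x, x ∂(B i), fun t ht => ?_⟩
  have hanti : ∀ i, Antitone fun x => 1 - cdf (B i) x := fun i x y h =>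
    sub_le_sub_left (monotone_cdf (B i) h) 1
  have hm : ∀ i, 0 ≤ lam i * ∑' n : ℕ, (q i n).toReal * n := fun i =>
    mul_nonneg (hlam i).le (tsum_nonneg fun n => by positivity)
  have hi : ∀ i ∈ Finset.univ, IntervalIntegrable
      (fun x => lam i * (∑' n : ℕ, (q i n).toReal * n) * (1 - cdf (B i) x)) volume 0 t :=
    fun i _ => (hanti i).intervalIntegrable.const_mul _
  have h1 : ∫ x in (0 : ℝ)..t, intensity lam q B x ≤ ∫ x in (0 : ℝ)..t,
      ∑ i, lam i * (∑' n : ℕ, (q i n).toReal * n) * (1 - cdf (B i) x) := by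
    refine intervalIntegral.integral_mono_on ht (intervalIntegrable_intensity q B hlam 0 t) ?_
      fun x _ => Finset.sum_le_sum fun i _ => ?_
    · simpa only [Finset.sum_fn] using IntervalIntegrable.sum _ hi
    · rw [mul_assoc]
      exact mul_le_mul_of_nonneg_left
        (one_sub_pgf_le (hq i) ⟨cdf_nonneg _ x, cdf_le_one _ x⟩) (hlam i).le
  refine h1.trans ?_
  rw [intervalIntegral.integral_finsetSum hi]
  refine Finset.sum_le_sum fun i _ => ?_
  rw [intervalIntegral.integral_const_mul]
  exact mul_le_mul_of_nonneg_left (integral_one_sub_cdf_le (hB0 i) (hB i) ht) (hm i)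

end MeanLoad

/-! ### Results for an arbitrary model -/

namespace IsModel

variable {ι Ω : Type*} [Fintype ι] [MeasurableSpace Ω] {P : Measure Ω} {X : Inputs ι Ω}
  {lam : ι → ℝ} {q : ι → PMF ℕ} {B : ι → Measure ℝ} [∀ i, IsProbabilityMeasure (B i)] {ν t : ℝ}

lemma continuousOn_law_real_idle (hlam : ∀ i, 0 < lam i) (hν : 0 ≤ ν) :
    ContinuousOn (fun t => (World.law lam fun i => markLaw (q i) (B i)).real
      {w | World.Idle ν t w}) (Ici 0) :=
  (continuous_idleFormula (antitone_intensity q B hlam) ν).continuousOn.congr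
    fun _ ht => World.law_real_idle hlam hν ht

/-- The probability of an empty system. -/
theorem idleProb_eq_idleFormula (hX : IsModel X P lam q B) (hlam : ∀ i, 0 < lam i) (hν : 0 ≤ ν)
    (ht : 0 ≤ t) : X.idleProb P (X.catastrophes ν) t = idleFormula (intensity lam q B) ν t := by
  rw [hX.idleProb_eq hlam hν, World.law_real_idle hlam hν ht]

/-- The probability of an empty system without catastrophes. -/
theorem idleProb_empty_eq_exp (hX : IsModel X P lam q B) (hlam : ∀ i, 0 < lam i) (ht : 0 ≤ t) :
    X.idleProb P (fun _ => ∅) t = Real.exp (-∫ x in (0 : ℝ)..t, intensity lam q B x) := by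
  rw [hX.idleProb_empty_eq hlam, World.law_real_idle hlam le_rfl ht, idleFormula_zero]

variable [Nonempty ι]

/-- The transforms of the busy period and the busy cycle. -/
theorem transforms (hX : IsModel X P lam q B) (hlam : ∀ i, 0 < lam i) (hν : 0 ≤ ν) {s : ℂ}
    (hs : 0 < s.re) :
    laplace (idleFormula (intensity lam q B) ν) s ≠ 0 ∧
    lst P (X.busyPeriod (X.catastrophes ν)) s = 1 + ((∑ i, lam i : ℝ) : ℂ)⁻¹ *
      (s - 1 / laplace (idleFormula (intensity lam q B) ν) s) ∧
    lst P (X.busyCycle (X.catastrophes ν)) s = 1 - 1 / (((∑ i, lam i : ℝ) + s) *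
      laplace (idleFormula (intensity lam q B) ν) s) := by
  have h := World.transforms (m := fun i => markLaw (q i) (B i)) hlam hν
    (continuousOn_law_real_idle hlam hν) hs
  have e : laplace (fun t => (World.law lam fun i => markLaw (q i) (B i)).real
      {w | World.Idle ν t w}) s = laplace (idleFormula (intensity lam q B) ν) s :=
    laplace_congr (Filter.Eventually.of_forall fun t ht => World.law_real_idle hlam hν ht.le)
  rw [e] at h
  rwa [lst_congr (hX.busyPeriod_ae_eq hlam hν), lst_congr (hX.busyCycle_ae_eq hlam hν),
    hX.lst_comp_world hlam (World.aemeasurable_busy hlam hν),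
    hX.lst_comp_world hlam (World.aemeasurable_cycle hlam hν)]

/-- If there are catastrophes or the mean batch sizes are finite, then the busy period is
finite. -/
theorem ae_busyPeriod_lt_top (hX : IsModel X P lam q B) (hlam : ∀ i, 0 < lam i) (hν : 0 ≤ ν)
    (hB0 : ∀ i, B i (Iio 0) = 0) (hB : ∀ i, Integrable (fun x => x) (B i))
    (hq : 0 < ν ∨ ∀ i, Integrable (fun n : ℕ => (n : ℝ)) (q i).toMeasure) :
    ∀ᵐ ω ∂P, X.busyPeriod (X.catastrophes ν) ω < ⊤ := by
  have hpos : ∃ c, 0 < c ∧ ∀ t, 0 ≤ t → c ≤ idleFormula (intensity lam q B) ν t := by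
    have hΛ : 0 < ∑ i, lam i := Finset.sum_pos (fun i _ => hlam i) Finset.univ_nonempty
    -- Without catastrophes the lower bound `e^{-C}` comes from the bounded mean load; with
    -- catastrophes `ν/(Λ+ν)` works for any batch sizes.
    rcases hν.eq_or_lt with rfl | hν'
    · obtain ⟨C, hC⟩ := exists_integral_intensity_le hlam (hq.resolve_left (lt_irrefl 0)) hB0 hB
      refine ⟨Real.exp (-C), Real.exp_pos _, fun t ht => ?_⟩
      rw [idleFormula_zero]
      exact Real.exp_le_exp.2 (neg_le_neg (hC t ht))
    · exact ⟨ν / (∑ i, lam i + ν), by positivity, fun t ht =>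
        le_idleFormula (antitone_intensity q B hlam) (intensity_le q B hlam) hΛ hν ht⟩
  obtain ⟨c, hc, hcP⟩ := hpos
  have h := World.ae_busy_lt_top (m := fun i => markLaw (q i) (B i)) hlam hν
    (continuousOn_law_real_idle hlam hν) hc fun t ht => by
      rw [World.law_real_idle hlam hν ht]
      exact hcP t ht
  have hw := hX.hasLaw_world hlam
  rw [← hw.map_eq] at h
  filter_upwards [ae_of_ae_map hw.aemeasurable h, hX.busyPeriod_ae_eq hlam hν] with ω h1 h2
  rw [h2]
  exact h1

end IsModel

end InfServer

end

/-! ### The three systems as special cases -/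

theorem mainTheorem10 {Ω : Type*} [MeasurableSpace Ω] (P : Measure Ω) [IsProbabilityMeasure P]
    (ν : ℝ) (hν : 0 ≤ ν) :
    -- M|G|∞ with catastrophes
    (∀ (lam : ℝ) (B : Measure ℝ) (X : InfServer.Inputs Unit Ω), 0 < lam →
      IsProbabilityMeasure B → B (Set.Iio 0) = 0 → Integrable (fun x => x) B →
      InfServer.IsModel X P (fun _ => lam) (fun _ => PMF.pure 1) (fun _ => B) →
      let K := X.catastrophes ν
      let P₀ := X.idleProb P K
      let p₀ := X.idleProb P (fun _ => ∅)
      AEMeasurable (X.busyPeriod K) P ∧ AEMeasurable (X.busyCycle K) P ∧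
      (∀ᵐ ω ∂P, X.busyPeriod K ω < ⊤) ∧
      (∀ t : ℝ, 0 ≤ t → P₀ t = InfServer.idleFormula (fun x => lam * (1 - cdf B x)) ν t) ∧
      (∀ t : ℝ, 0 ≤ t → p₀ t = Real.exp (-∫ x in (0 : ℝ)..t, lam * (1 - cdf B x))) ∧
      ∀ s : ℂ, 0 < s.re →
        InfServer.laplace P₀ s ≠ 0 ∧
        InfServer.lst P (X.busyPeriod K) s
          = 1 + s / lam * (1 - 1 / (s * InfServer.laplace P₀ s)) ∧
        InfServer.lst P (X.busyCycle K) s = 1 - 1 / ((lam + s) * InfServer.laplace P₀ s) ∧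
        s * InfServer.laplace P₀ s = (ν + s) * InfServer.laplace p₀ (ν + s)) ∧
    -- BM|G|∞ with catastrophes
    (∀ (lam : ℝ) (q : PMF ℕ) (B : Measure ℝ) (X : InfServer.Inputs Unit Ω), 0 < lam → q 0 = 0 →
      IsProbabilityMeasure B → B (Set.Iio 0) = 0 → Integrable (fun x => x) B →
      InfServer.IsModel X P (fun _ => lam) (fun _ => q) (fun _ => B) →
      let K := X.catastrophes ν
      let P₀ := InfServer.idleFormula (fun x => lam * (1 - InfServer.pgf q (cdf B x))) ν
      AEMeasurable (X.busyPeriod K) P ∧ AEMeasurable (X.busyCycle K) P ∧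
      (0 < ν ∨ Integrable (fun n : ℕ => (n : ℝ)) q.toMeasure →
        ∀ᵐ ω ∂P, X.busyPeriod K ω < ⊤) ∧
      (∀ t : ℝ, 0 ≤ t → X.idleProb P K t = P₀ t) ∧
      ∀ s : ℂ, 0 < s.re →
        InfServer.laplace P₀ s ≠ 0 ∧
        InfServer.lst P (X.busyPeriod K) s
          = 1 + (lam : ℂ)⁻¹ * (s - 1 / InfServer.laplace P₀ s) ∧
        InfServer.lst P (X.busyCycle K) s = 1 - 1 / ((lam + s) * InfServer.laplace P₀ s)) ∧
    -- M_k|G_k|∞ with catastrophes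
    (∀ (k : ℕ) (lam : Fin k → ℝ) (B : Fin k → Measure ℝ) (X : InfServer.Inputs (Fin k) Ω),
      0 < k → (∀ i, 0 < lam i) →
      (∀ i, IsProbabilityMeasure (B i)) → (∀ i, B i (Set.Iio 0) = 0) →
      (∀ i, Integrable (fun x => x) (B i)) →
      InfServer.IsModel X P lam (fun _ => PMF.pure 1) B →
      let K := X.catastrophes ν
      let Λ : ℝ := ∑ i, lam i
      let P₀ := InfServer.idleFormula (fun x => ∑ i, lam i * (1 - cdf (B i) x)) ν
      AEMeasurable (X.busyPeriod K) P ∧ AEMeasurable (X.busyCycle K) P ∧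
      (∀ᵐ ω ∂P, X.busyPeriod K ω < ⊤) ∧
      (∀ t : ℝ, 0 ≤ t → X.idleProb P K t = P₀ t) ∧
      ∀ s : ℂ, 0 < s.re →
        InfServer.laplace P₀ s ≠ 0 ∧
        InfServer.lst P (X.busyPeriod K) s
          = 1 + (Λ : ℂ)⁻¹ * (s - 1 / InfServer.laplace P₀ s) ∧
        InfServer.lst P (X.busyCycle K) s = 1 - 1 / ((Λ + s) * InfServer.laplace P₀ s)) := by
  refine ⟨?_, ?_, ?_⟩
  · intro lam B X hlam hBp hB0 hB hX
    have hI : InfServer.intensity (fun _ : Unit => lam) (fun _ => PMF.pure 1) (fun _ => B) =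
        fun x => lam * (1 - cdf B x) := by
      funext x
      simp [InfServer.intensity, InfServer.pgf_pure_one]
    have hl : ∀ _ : Unit, 0 < lam := fun _ => hlam
    have hP := fun (t : ℝ) (ht : 0 ≤ t) => hX.idleProb_eq_idleFormula hl hν ht
    have hp := fun (t : ℝ) (ht : 0 ≤ t) => hX.idleProb_empty_eq_exp hl ht
    have hanti := InfServer.antitone_intensity (fun _ : Unit => PMF.pure 1) (fun _ => B) hl
    refine ⟨hX.aemeasurable_busyPeriod hl hν, hX.aemeasurable_busyCycle hl hν,
      hX.ae_busyPeriod_lt_top hl hν (fun _ => hB0) (fun _ => hB)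
        (.inr fun _ => InfServer.integrable_pure 1), ?_, ?_, fun s hs => ?_⟩
    · rwa [← hI]
    · simpa only [hI] using hp
    · have h := hX.transforms hl hν hs
      -- The required upper bound `1` holds because the formula is a probability.
      have h1 := InfServer.mul_laplace_idleFormula hanti hν
        (fun t ht => (hP t ht).symm.trans_le measureReal_le_one) hs
      have e1 : InfServer.laplace (X.idleProb P (X.catastrophes ν)) s = _ :=
        InfServer.laplace_congr (Filter.Eventually.of_forall fun t ht => hP t ht.le)
      have e2 : InfServer.laplace (X.idleProb P fun _ => ∅) (ν + s) = _ :=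
        InfServer.laplace_congr (Filter.Eventually.of_forall fun t ht =>
          (hp t ht.le).trans (InfServer.idleFormula_zero _ t).symm)
      rw [e1, e2]
      simp only [Finset.univ_unique, Finset.sum_const, Finset.card_singleton, one_smul] at h
      refine ⟨h.1, ?_, h.2.2, h1⟩
      have hs0 : s ≠ 0 := fun h0 => by simp [h0] at hs
      have hlam0 : (lam : ℂ) ≠ 0 := Complex.ofReal_ne_zero.2 hlam.ne'
      have hL := h.1
      rw [h.2.1]
      field_simp
  · intro lam q B X hlam _ hBp hB0 hB hX
    have hI : InfServer.intensity (fun _ : Unit => lam) (fun _ => q) (fun _ => B) =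
        fun x => lam * (1 - InfServer.pgf q (cdf B x)) := by
      funext x
      simp [InfServer.intensity]
    have hl : ∀ _ : Unit, 0 < lam := fun _ => hlam
    refine ⟨hX.aemeasurable_busyPeriod hl hν, hX.aemeasurable_busyCycle hl hν,
      fun h => hX.ae_busyPeriod_lt_top hl hν (fun _ => hB0) (fun _ => hB)
        (h.imp_right fun h _ => h), ?_, fun s hs => ?_⟩
    · rw [← hI]
      exact fun t ht => hX.idleProb_eq_idleFormula hl hν ht
    · have h := hX.transforms hl hν hs
      simpa only [Finset.univ_unique, Finset.sum_const, Finset.card_singleton, one_smul, hI] using h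
  · intro k lam B X hk hlam hBp hB0 hB hX
    have := Fin.pos_iff_nonempty.1 hk
    have hI : InfServer.intensity lam (fun _ => PMF.pure 1) B =
        fun x => ∑ i, lam i * (1 - cdf (B i) x) := by
      funext x
      simp [InfServer.intensity, InfServer.pgf_pure_one]
    refine ⟨hX.aemeasurable_busyPeriod hlam hν, hX.aemeasurable_busyCycle hlam hν,
      hX.ae_busyPeriod_lt_top hlam hν hB0 hB (.inr fun _ => InfServer.integrable_pure 1), ?_,
      fun s hs => ?_⟩
    · rw [← hI]
      exact fun t ht => hX.idleProb_eq_idleFormula hlam hν ht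
    · rw [← hI]
      exact hX.transforms hlam hν hs
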